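/- Setting. Let $(X,d)$ be a compact metric space, $f:X\to X$ continuous, $\phi:X\to\mathbb R$ continuous, and $\mathbb N=\{0,1,2,\dots\}$. Let $d_n(x,y)=\max_{0\le k<n}d(f^kx,f^ky)$, $B_n(x,\epsilon)=\{y:d_n(x,y)<\epsilon\}$, $\Phi(x,n)=\Phi(x,n,0)=\sum_{k=0}^{n-1}\phi(f^kx)$ and $\Phi(x,n,\epsilon)=\sup_{y\in B_n(x,\epsilon)}\Phi(y,n)$ for $\epsilon>0$. A set $E$ is $(n,\delta)$-separated if $d_n(x,y)>\delta$ for all distinct $x,y\in E$. For $\mathcal C\subset X\times\mathbb N$ let $\mathcal C^{(n)}=\{x:(x,n)\in\mathcal C\}$ and $$P(\mathcal C,\phi,\delta,\epsilon)=\limsup_{n\to\infty}\frac1n\ln\sup\Big\{\sum_{x\in E}e^{\Phi(x,n,\epsilon)}: E\subset\mathcal C^{(n)}\ (n,\delta)\text{-separated}\Big\}\qquad(\ln 0=-\infty).$$ Write $P(\mathcal C,\phi,\delta)=P(\mathcal C,\phi,\delta,0)$, $P(\mathcal C,\phi)=\lim_{\delta\to0}P(\mathcal C,\phi,\delta)$,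 $P(Y,\phi,\delta)=P(Y\times\mathbb N,\phi,\delta)$ for $Y\subset X$, $P(\phi)=P(X\times\mathbb N,\phi)$, and $$P^*(\phi)=\liminf_{n\to\infty}\sup_{x\in X}\tfrac1n\Phi(x,n).$$ Let $\Gamma_\epsilon(x)=\{y: d(f^nx,f^ny)<\epsilon\ \forall n\in\mathbb N\}$, $\mathrm{NE}(\epsilon)=\{x:\Gamma_\epsilon(x)\neq\{x\}\}$, and let $P^\perp_{\exp}(\phi,\epsilon)$ be the supremum ($-\infty$ if there are none) of $h_\mu(f)+\int\phi\,d\mu$ over the ergodic $f$-invariant Borel probability measures $\mu$ with $\mu(\mathrm{NE}(\epsilon))>0$, where $h_\mu(f)$ is the metric entropy. A collection $\mathcal C\subset X\times\mathbb N$ satisfies $\mathrm{GO}(\delta)$ if there are integers $N\ge 0$ and $\tau\ge1$ such that for every sequence $(x_k,m_k)_{k\ge1}$ in $\mathcal C$ with all $m_k\ge N$ there are $r_k\in\{0,\dots,\tau-1\}$ and $z\in X$ with $d(f^{t_k+j}z,f^jx_k)\le\delta$ for all $k\ge 1$ and $0\le j<m_k$, where $t_k=\sum_{i<k}(m_i+r_i)$.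 The potential $\phi$ satisfies $\mathrm{BP}(\epsilon)$ on $\mathcal C$ if $\sup\{|\Phi(x,n)-\Phi(y,n)|:(x,n)\in\mathcal C,\ y\in B_n(x,\epsilon)\}<\infty$. A CT-decomposition for $\mathcal D\subset X\times\mathbb N$ is a triple $\mathcal P,\mathcal G,\mathcal S\subset X\times\mathbb N$ with functions $p,g,s:\mathcal D\to\mathbb N$ such that, for every $(x,n)\in\mathcal D$ and with $p,g,s$ evaluated at $(x,n)$, $p+g+s=n$, $(x,p)\in\mathcal P$, $(f^{p}x,g)\in\mathcal G$ and $(f^{p+g}x,s)\in\mathcal S$; put $\mathcal G_M=\{(x,n)\in\mathcal D: p(x,n)\le M,\ s(x,n)\le M\}$. For $\delta,\gamma,\epsilon>0$, $(X,f,\phi)$ satisfies $\mathrm{CT}(\delta,\gamma,\epsilon)$ if $16\delta<8\gamma<\epsilon$ and there are $\mathcal D\subset X\times\mathbb N$ and a CT-decomposition $(\mathcal P,\mathcal G,\mathcal S)$ for $\mathcal D$ such that (1) $\mathcal G_M$ satisfies $\mathrm{GO}(\delta)$ for every $M\in\mathbb N$; (2) $P(\mathcal D^c,\phi,2\gamma,2\gamma)<P(\phi)$;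 (3) $P(\mathcal P\cup\mathcal S,\phi,\gamma,3\gamma)<P(\phi)$; (4) $\phi$ satisfies $\mathrm{BP}(3\gamma)$ on $\mathcal G$; (5) $P^\perp_{\exp}(\phi,\epsilon)<P(\phi)$. Proposition. Suppose that $(X,f,\phi)$ satisfies $\mathrm{CT}(\delta,\gamma,\epsilon)$. Then for every $\alpha\in(P^*(\phi),P(\phi))$ and every $\eta_0>0$ there is a compact set $\Lambda\subset X$ with $f(\Lambda)\subset\Lambda$ such that $$|P(\Lambda,\phi,2\delta)-\alpha|<\eta_0.$$ -/

import Mathlib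

open Filter Topology MeasureTheory
open scoped ENNReal

namespace CTSystem

noncomputable section

section Pressure

variable {X : Type*} [MetricSpace X]

/-- The open Bowen ball `B_n(x, ε) = {y | d_n(x, y) < ε}`, where
`d_n(x, y) = max {d(f^k x, f^k y) | 0 ≤ k < n}`. -/
def bowenBall (f : X → X) (n : ℕ) (x : X) (ε : ℝ) : Set X :=
  {y | ∀ k < n, dist (f^[k] x) (f^[k] y) < ε}

/-- `E` is `(n, δ)`-separated: `d_n(x, y) > δ` for all distinct `x, y ∈ E`. -/
def IsSeparated (f : X → X) (n : ℕ) (δ : ℝ) (E : Set X) : Prop :=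
  ∀ x ∈ E, ∀ y ∈ E, x ≠ y → ∃ k < n, δ < dist (f^[k] x) (f^[k] y)

/-- `Φ(x, n, ε)`: the supremum over `y ∈ B_n(x, ε)` of the Birkhoff sum
`∑_{k < n} φ (f^k y)`; for `ε = 0` this means, by convention, the Birkhoff sum `Φ(x, n)` at `x`
itself. -/
def ballSum (f : X → X) (φ : X → ℝ) (x : X) (n : ℕ) (ε : ℝ) : ℝ :=
  if 0 < ε then sSup (birkhoffSum f φ n '' bowenBall f n x ε) else birkhoffSum f φ n x

/-- The partition function `Θ(Y, φ, n, δ, ε)` of a set of points: the supremum of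
`∑_{x ∈ E} exp Φ(x, n, ε)` over the `(n, δ)`-separated subsets `E` of `Y`. (On a compact space and
for `δ > 0` every such `E` is finite.) -/
def partitionFn (f : X → X) (φ : X → ℝ) (Y : Set X) (n : ℕ) (δ ε : ℝ) : ℝ≥0∞ :=
  ⨆ (E : Finset X) (_ : (E : Set X) ⊆ Y ∧ IsSeparated f n δ (E : Set X)),
    ∑ x ∈ E, ENNReal.ofReal (Real.exp (ballSum f φ x n ε))

/-- The slice `C^(n) = {x | (x, n) ∈ C}` of a collection `C` of orbit segments, where `(x, n)`
stands for the segment `x, f x, …, f^(n-1) x`. -/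
def slice (C : Set (X × ℕ)) (n : ℕ) : Set X := {x | (x, n) ∈ C}

/-- `P(C, φ, δ, ε) = limsup (1/n) log Θ(C^(n), φ, n, δ, ε)`, with `log 0 = -∞`. -/
def pressureAt (f : X → X) (φ : X → ℝ) (C : Set (X × ℕ)) (δ ε : ℝ) : EReal :=
  limsup (fun n : ℕ => ENNReal.log (partitionFn f φ (slice C n) n δ ε) / (n : EReal)) atTop

/-- `P(C, φ) = lim_{δ → 0} P(C, φ, δ)`, with `P(C, φ, δ) = P(C, φ, δ, 0)`. As `P(C, φ, δ)` does not
increase with `δ`, the limit is a supremum, see `tendsto_pressureAt`. -/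
def pressure (f : X → X) (φ : X → ℝ) (C : Set (X × ℕ)) : EReal :=
  ⨆ (δ : ℝ) (_ : 0 < δ), pressureAt f φ C δ 0

/-- `P(Y, φ, δ) = P(Y × ℕ, φ, δ, 0)` for a set of points `Y`. -/
def setPressureAt (f : X → X) (φ : X → ℝ) (Y : Set X) (δ : ℝ) : EReal :=
  pressureAt f φ (Y ×ˢ Set.univ) δ 0

/-- The topological pressure `P(φ)` of the whole system. -/
def topPressure (f : X → X) (φ : X → ℝ) : EReal := pressure f φ Set.univ

/-- `P^*(φ) = liminf_n sup_x (1/n) ∑_{k < n} φ (f^k x)`. -/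
def lowerThreshold (f : X → X) (φ : X → ℝ) : EReal :=
  liminf (fun n : ℕ => ⨆ x : X, ((birkhoffSum f φ n x / n : ℝ) : EReal)) atTop

theorem pressureAt_anti (f : X → X) (φ : X → ℝ) (C : Set (X × ℕ)) (ε : ℝ) :
    Antitone (fun δ => pressureAt f φ C δ ε) := by
  intro δ δ' h
  refine limsup_le_limsup (Eventually.of_forall fun n => ?_)
  refine EReal.div_le_div_right_of_nonneg (by positivity) (ENNReal.log_monotone ?_)
  refine iSup_mono fun E => iSup_mono' fun hE => ⟨⟨hE.1, fun x hx y hy hxy => ?_⟩, le_rfl⟩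
  obtain ⟨k, hk, hd⟩ := hE.2 x hx y hy hxy
  exact ⟨k, hk, h.trans_lt hd⟩

theorem tendsto_pressureAt (f : X → X) (φ : X → ℝ) (C : Set (X × ℕ)) :
    Tendsto (fun δ => pressureAt f φ C δ 0) (𝓝[>] 0) (𝓝 (pressure f φ C)) := by
  have h := (pressureAt_anti f φ C 0).tendsto_nhdsGT 0
  rw [sSup_image] at h
  exact h

end Pressure

section Measures

variable {X : Type*} [MeasurableSpace X]

/-- The Shannon entropy `H_μ(ξ) = -∑_i μ(ξ = i) log μ(ξ = i)` of the partition of `X` into the level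
sets of a map `ξ` with finitely many values. -/
def shannonEntropy {ι : Type*} [Fintype ι] (μ : Measure X) (ξ : X → ι) : ℝ :=
  ∑ i, Real.negMulLog (μ.real (ξ ⁻¹' {i}))

/-- `h_μ(f, ξ) = lim (1/n) H_μ(ξ ∨ f⁻¹ξ ∨ ⋯ ∨ f^{-(n-1)}ξ)` for a finite measurable partition given
by its labelling `ξ : X → Fin m`. (The limit exists for every invariant probability measure.) -/
def partitionEntropy (f : X → X) (μ : Measure X) {m : ℕ} (ξ : X → Fin m) : EReal :=
  limsup (fun n : ℕ =>
    ((shannonEntropy μ (fun (x : X) (k : Fin n) => ξ (f^[k] x)) / n : ℝ) : EReal)) atTop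

/-- The Kolmogorov–Sinai (metric) entropy `h_μ(f)`. -/
def metricEntropy (f : X → X) (μ : Measure X) : EReal :=
  ⨆ (m : ℕ) (ξ : X → Fin m) (_ : Measurable ξ), partitionEntropy f μ ξ

/-- `P_μ(φ) = h_μ(f) + ∫ φ dμ`. -/
def measurePressure (f : X → X) (φ : X → ℝ) (μ : Measure X) : EReal :=
  metricEntropy f μ + ((∫ x, φ x ∂μ : ℝ) : EReal)

end Measures

section Expansivity

variable {X : Type*} [MetricSpace X]

/-- `Γ_ε(x) = {y | d(f^n x, f^n y) < ε for every n ≥ 0}`. -/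
def gammaSet (f : X → X) (ε : ℝ) (x : X) : Set X :=
  {y | ∀ n : ℕ, dist (f^[n] x) (f^[n] y) < ε}

/-- `NE(ε) = {x | Γ_ε(x) ≠ {x}}`. -/
def nonExpansive (f : X → X) (ε : ℝ) : Set X := {x | gammaSet f ε x ≠ {x}}

/-- The pressure `P_exp^⊥(φ, ε)` of obstructions to expansivity at scale `ε`: the supremum of
`P_μ(φ)` over the ergodic `f`-invariant Borel probability measures `μ` with `μ(NE(ε)) > 0`
(`-∞` if there are none). -/
def expObstruction [MeasurableSpace X] (f : X → X) (φ : X → ℝ) (ε : ℝ) : EReal :=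
  ⨆ (μ : Measure X) (_ : IsProbabilityMeasure μ ∧ Ergodic f μ ∧ 0 < μ (nonExpansive f ε)),
    measurePressure f φ μ

end Expansivity

section Structure

variable {X : Type*} [MetricSpace X]

/-- The potential satisfies BP(`ε`) on `C`: `|Φ(x, n) - Φ(y, n)|` is bounded uniformly in
`(x, n) ∈ C` and `y ∈ B_n(x, ε)`. -/
def BowenProp (f : X → X) (φ : X → ℝ) (C : Set (X × ℕ)) (ε : ℝ) : Prop :=
  ∃ V : ℝ, ∀ x n, (x, n) ∈ C → ∀ y ∈ bowenBall f n x ε,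
    |birkhoffSum f φ n x - birkhoffSum f φ n y| ≤ V

/-- The starting time `t_k = ∑_{i < k} (m_i + r_i)` of the `k`-th segment (counted from `0`) when
segments of lengths `m_i` are glued with gaps `r_i`. -/
def startTime (m r : ℕ → ℕ) (k : ℕ) : ℕ := ∑ i ∈ Finset.range k, (m i + r i)

/-- The sequence of segments `(x_k, m_k)` with gaps `r_k` is `δ`-traced by `z`. -/
def Traces (f : X → X) (δ : ℝ) (x : ℕ → X) (m r : ℕ → ℕ) (z : X) : Prop :=
  ∀ k, ∀ j < m k, dist (f^[startTime m r k + j] z) (f^[j] (x k)) ≤ δ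

/-- `C` satisfies GO(`δ`): there are `N` and `τ > 0` such that every sequence of segments of `C` of
length at least `N` is `δ`-traced by some point, with gaps in `{0, …, τ - 1}`. -/
def GluingOrbit (f : X → X) (C : Set (X × ℕ)) (δ : ℝ) : Prop :=
  ∃ N τ : ℕ, 0 < τ ∧ ∀ (x : ℕ → X) (m : ℕ → ℕ), (∀ k, (x k, m k) ∈ C ∧ N ≤ m k) →
    ∃ (r : ℕ → ℕ) (z : X), (∀ k, r k < τ) ∧ Traces f δ x m r z

/-- `(P, G, S)` with the functions `p, g, s` is a CT-decomposition for `D`: each segment of `D` is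
the concatenation of a segment in `P`, one in `G` and one in `S`, of lengths `p`, `g`, `s`. Only
the values of `p, g, s` on `D` matter. -/
def IsCTDecomposition (f : X → X) (D P G S : Set (X × ℕ)) (p g s : X → ℕ → ℕ) : Prop :=
  ∀ x n, (x, n) ∈ D →
    (x, p x n) ∈ P ∧
    (f^[p x n] x, g x n) ∈ G ∧
    (f^[p x n + g x n] x, s x n) ∈ S ∧
    p x n + g x n + s x n = n

/-- `G_M = {(x, n) ∈ D | p(x, n) ≤ M and s(x, n) ≤ M}`. -/
def goodUpTo (D : Set (X × ℕ)) (p s : X → ℕ → ℕ) (M : ℕ) : Set (X × ℕ) :=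
  {a | a ∈ D ∧ p a.1 a.2 ≤ M ∧ s a.1 a.2 ≤ M}

/-- `(X, f, φ)` satisfies CT(`δ, γ, ε`). -/
def SatisfiesCT [MeasurableSpace X] (f : X → X) (φ : X → ℝ) (δ γ ε : ℝ) : Prop :=
  0 < δ ∧ 16 * δ < 8 * γ ∧ 8 * γ < ε ∧
  ∃ (D P G S : Set (X × ℕ)) (p g s : X → ℕ → ℕ),
    IsCTDecomposition f D P G S p g s ∧
    (∀ M : ℕ, GluingOrbit f (goodUpTo D p s M) δ) ∧
    pressureAt f φ Dᶜ (2 * γ) (2 * γ) < topPressure f φ ∧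
    pressureAt f φ (P ∪ S) γ (3 * γ) < topPressure f φ ∧
    BowenProp f φ G (3 * γ) ∧
    expObstruction f φ ε < topPressure f φ

end Structure

end

end CTSystem

/-!
The proof produces one collection of segments with three properties: it can be glued, the
potential has bounded distortion on it, and its growth rate exceeds the prescribed value `α`.
Invariant sets of pressure close to `α` are then built out of thinned-out families of these
segments.

*Where the growth is.* The pressure `P(φ)` is a limit over scales, but the conditions on `D`, `P`
and `S` speak of fixed scales. As the measures of large pressure are expansive at scale `ε > 8γ`, the
limit is already reached at scale `4γ` (`topPressure_le_pressureAt`). The argument goes through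
measures: if the growth at some finer scale exceeded the growth at scale `4γ`, then Misiurewicz's
construction would give an invariant measure whose entropy for a finite partition, plus integral,
exceeds it too (`exists_invariant_measure_of_lt_pressureAt`). By the ergodic decomposition, realized
by the conditional measures given the invariant σ-algebra (`ae_ergodic_condExpKernel`,
`mul_le_integral_shannonEntropy_condExpKernel`), ergodic measures with this property would exist. If
such a measure charges the nonexpansive points, this contradicts the bound on the obstructions to
expansivity; if not, a partition into sets of small `d_n`-diameter almost determines every other
partition, and its entropy is bounded by counting separated sets at scale `4γ`
(`eventually_entropy_add_integral_lt`).

*Which segments carry it.* At scale `4γ` the whole space is covered by `D` and its complement, and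
segments in `D` are concatenations along the decomposition. As everything except the cores grows
strictly slower, a renewal argument shows that for every `β < P(φ)` with `β` above these slower
rates, some `𝒢_M` grows at least like `exp (n β)` at scale `2γ` (`exists_le_pressureAt_goodUpTo`).

*Thinning and gluing.* Every single weight `exp Φ(x, n)` is smaller than `exp (n α)` for large `n`,
because `α > P^*(φ)`. So for `P(𝒢_M) > α` there is a separated set `E` of segments in `𝒢_M` whose
total weight lies between `exp (n α)` and `2 exp (n α)`. The set `Λ` is the closure of the forward
orbits of all points that trace sequences of segments of `E` with bounded gaps. Bounded distortion
and bounded gaps cost a factor independent of `n` per segment, which for large `n` changes the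
growth rate by less than `η₀` (`exists_invariant_of_gluing`).
-/

namespace CTSystem

/-! ### Separated sets and partition functions -/

section Weights

variable {X : Type*}

/-- The weighted size `∑_{x ∈ E} exp Φ(x, n)` of a finite set. -/
noncomputable def expSum (f : X → X) (φ : X → ℝ) (n : ℕ) (E : Finset X) : ℝ :=
  ∑ x ∈ E, Real.exp (birkhoffSum f φ n x)

theorem abs_birkhoffSum_le {f : X → X} {φ : X → ℝ} {B : ℝ} (hB : ∀ x, |φ x| ≤ B) (n : ℕ) (x : X) :
    |birkhoffSum f φ n x| ≤ n * B := by
  refine (Finset.abs_sum_le_sum_abs _ _).trans ?_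
  simpa using Finset.sum_le_sum fun k (_ : k ∈ Finset.range n) => hB (f^[k] x)

theorem expSum_le_card {f : X → X} {φ : X → ℝ} {B : ℝ} (hB : ∀ x, |φ x| ≤ B) (n : ℕ)
    (E : Finset X) : expSum f φ n E ≤ E.card * Real.exp (n * B) := by
  rw [← nsmul_eq_mul]
  exact Finset.sum_le_card_nsmul _ _ _ fun x _ =>
    Real.exp_le_exp.2 ((le_abs_self _).trans (abs_birkhoffSum_le (f := f) hB n x))

end Weights

section Basic

variable {X : Type*} [MetricSpace X]

theorem IsSeparated.mono {f : X → X} {n : ℕ} {δ : ℝ} {E F : Set X} (h : IsSeparated f n δ F)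
    (hEF : E ⊆ F) : IsSeparated f n δ E :=
  fun x hx y hy hxy => h x (hEF hx) y (hEF hy) hxy

theorem IsSeparated.anti {f : X → X} {n : ℕ} {δ δ' : ℝ} {E : Set X} (h : IsSeparated f n δ' E)
    (hδ : δ ≤ δ') : IsSeparated f n δ E := fun x hx y hy hxy => by
  obtain ⟨k, hk, hd⟩ := h x hx y hy hxy
  exact ⟨k, hk, hδ.trans_lt hd⟩

theorem card_le_of_isSeparated {f : X → X} {n l : ℕ} {ρ : ℝ} {c : X → Fin l}
    (hc : ∀ x y, c x = c y → dist x y ≤ ρ) {E : Finset X} (hE : IsSeparated f n ρ (E : Set X)) :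
    E.card ≤ l ^ n := by
  have := Finset.card_le_card_of_injOn (s := E) (t := Finset.univ)
    (fun x (k : Fin n) => c (f^[k] x)) (by simp) (fun x hx y hy hxy => by
      by_contra hne
      obtain ⟨k, hk, hd⟩ := hE x hx y hy hne
      exact absurd (hc _ _ (congr_fun hxy ⟨k, hk⟩)) (not_le.2 hd))
  simpa using this

theorem partitionFn_zero_le_iff {f : X → X} {φ : X → ℝ} {Y : Set X} {n : ℕ} {δ c : ℝ}
    (hc : 0 ≤ c) :
    partitionFn f φ Y n δ 0 ≤ ENNReal.ofReal c ↔
      ∀ E : Finset X, (E : Set X) ⊆ Y → IsSeparated f n δ (E : Set X) → expSum f φ n E ≤ c := by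
  simp only [partitionFn, iSup_le_iff, and_imp]
  refine forall_congr' fun E => forall_congr' fun _ => forall_congr' fun _ => ?_
  rw [← ENNReal.ofReal_sum_of_nonneg fun _ _ => (Real.exp_pos _).le,
    ENNReal.ofReal_le_ofReal_iff hc]
  simp [ballSum, expSum]

theorem log_div_le_iff {a : ℝ≥0∞} {n : ℕ} (hn : 0 < n) (b : ℝ) :
    ENNReal.log a / (n : EReal) ≤ b ↔ a ≤ ENNReal.ofReal (Real.exp (n * b)) := by
  have hn' : (0 : EReal) < n := by exact_mod_cast hn
  rw [EReal.div_le_iff_le_mul hn' (EReal.natCast_ne_top n), ← ENNReal.log_le_log_iff,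
    ENNReal.log_ofReal_of_pos (Real.exp_pos _), Real.log_exp]
  norm_cast

/-- Finite growth rates: an upper bound for the pressure gives eventual exponential bounds. -/
theorem eventually_expSum_le {f : X → X} {φ : X → ℝ} {C : Set (X × ℕ)} {δ b : ℝ}
    (h : pressureAt f φ C δ 0 < b) :
    ∀ᶠ n in atTop, ∀ E : Finset X, (E : Set X) ⊆ slice C n → IsSeparated f n δ (E : Set X) →
      expSum f φ n E ≤ Real.exp (n * b) := by
  filter_upwards [eventually_lt_of_limsup_lt h, eventually_gt_atTop 0] with n hn h0
  exact (partitionFn_zero_le_iff (Real.exp_pos _).le).1 ((log_div_le_iff h0 b).1 hn.le)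

theorem pressureAt_le_of_eventually {f : X → X} {φ : X → ℝ} {C : Set (X × ℕ)} {δ b : ℝ}
    (h : ∀ᶠ n : ℕ in atTop, ∀ E : Finset X, (E : Set X) ⊆ slice C n →
      IsSeparated f n δ (E : Set X) → expSum f φ n E ≤ Real.exp (n * b)) :
    pressureAt f φ C δ 0 ≤ b := by
  refine limsup_le_of_le (h := ?_)
  filter_upwards [h, eventually_gt_atTop 0] with n hn h0
  exact (log_div_le_iff h0 b).2 ((partitionFn_zero_le_iff (Real.exp_pos _).le).2 hn)

theorem frequently_exists_expSum_gt {f : X → X} {φ : X → ℝ} {C : Set (X × ℕ)} {δ b : ℝ}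
    (h : b < pressureAt f φ C δ 0) :
    ∃ᶠ n : ℕ in atTop, ∃ E : Finset X, (E : Set X) ⊆ slice C n ∧ IsSeparated f n δ (E : Set X) ∧
      Real.exp (n * b) < expSum f φ n E := by
  by_contra hcon
  refine absurd (pressureAt_le_of_eventually (f := f) (φ := φ) (C := C) (δ := δ) (b := b) ?_)
    (not_le.2 h)
  filter_upwards [not_frequently.1 hcon] with n hn E h1 h2
  by_contra h3
  exact hn ⟨E, h1, h2, not_le.1 h3⟩

theorem le_pressureAt_of_frequently {f : X → X} {φ : X → ℝ} {C : Set (X × ℕ)} {δ b : ℝ}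
    (h : ∃ᶠ n : ℕ in atTop, ∃ E : Finset X, (E : Set X) ⊆ slice C n ∧
      IsSeparated f n δ (E : Set X) ∧ Real.exp (n * b) < expSum f φ n E) :
    b ≤ pressureAt f φ C δ 0 := by
  by_contra hcon
  obtain ⟨n, ⟨E, h1, h2, h3⟩, h4⟩ :=
    (h.and_eventually (eventually_expSum_le (not_le.1 hcon))).exists
  exact absurd (h4 E h1 h2) (not_le.2 h3)

theorem pressureAt_le_of_forall {f : X → X} {φ : X → ℝ} {C : Set (X × ℕ)} {δ b A : ℝ}
    (h : ∀ n : ℕ, ∀ E : Finset X, (E : Set X) ⊆ slice C n → IsSeparated f n δ (E : Set X) →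
      expSum f φ n E ≤ A * Real.exp (n * b)) : pressureAt f φ C δ 0 ≤ b := by
  by_contra hcon
  obtain ⟨b', hb1, hb2⟩ := EReal.lt_iff_exists_real_btwn.1 (not_le.1 hcon)
  have hb1' : b < b' := by exact_mod_cast hb1
  have hlim : Tendsto (fun n : ℕ => Real.exp (n * (b' - b))) atTop atTop :=
    Real.tendsto_exp_atTop.comp (tendsto_natCast_atTop_atTop.atTop_mul_const (sub_pos.2 hb1'))
  obtain ⟨n, ⟨E, hEC, hE, hlt⟩, hn⟩ := ((frequently_exists_expSum_gt hb2).and_eventually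
    (hlim.eventually_ge_atTop A)).exists
  have h1 := h n E hEC hE
  have h2 : Real.exp (n * b') = Real.exp (n * (b' - b)) * Real.exp (n * b) := by
    rw [← Real.exp_add]; congr 1; ring
  have h3 : A * Real.exp (n * b) ≤ Real.exp (n * (b' - b)) * Real.exp (n * b) := by gcongr
  linarith

theorem iterate_mem_bowenBall {f : X → X} {n m : ℕ} {k : ℕ} {x y : X} {r : ℝ}
    (h : y ∈ bowenBall f n x r) (hk : k + m ≤ n) : f^[k] y ∈ bowenBall f m (f^[k] x) r := by
  intro j hj
  rw [← Function.iterate_add_apply, ← Function.iterate_add_apply]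
  exact h _ (by omega)

end Basic

section Compact

variable {X : Type*} [MetricSpace X] [CompactSpace X]

theorem exists_abs_le {φ : X → ℝ} (hφ : Continuous φ) : ∃ B, 0 ≤ B ∧ ∀ x, |φ x| ≤ B := by
  obtain ⟨B, hB⟩ := isCompact_univ.exists_bound_of_continuousOn hφ.continuousOn
  refine ⟨max B 0, le_max_right _ _, fun x => (hB x trivial).trans (le_max_left _ _)⟩

/-- The values of the ball sums dominate the Birkhoff sums, as `x` lies in its own Bowen ball. -/
theorem pressureAt_zero_le {f : X → X} {φ : X → ℝ} (hφ : Continuous φ) (C : Set (X × ℕ))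
    (δ : ℝ) {ε : ℝ} (hε : 0 < ε) : pressureAt f φ C δ 0 ≤ pressureAt f φ C δ ε := by
  obtain ⟨B, -, hB⟩ := exists_abs_le hφ
  refine limsup_le_limsup (Eventually.of_forall fun n => ?_)
  refine EReal.div_le_div_right_of_nonneg (by positivity) (ENNReal.log_monotone ?_)
  refine iSup_mono fun E => iSup_mono fun hE => Finset.sum_le_sum fun x _ => ?_
  refine ENNReal.ofReal_le_ofReal (Real.exp_le_exp.2 ?_)
  rw [ballSum, ballSum, if_neg (lt_irrefl _), if_pos hε]
  refine le_csSup ⟨n * B, ?_⟩ ⟨x, fun k _ => by simpa using hε, rfl⟩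
  rintro _ ⟨y, -, rfl⟩
  exact (le_abs_self _).trans (abs_birkhoffSum_le hB n y)

/-- A finite labelling of `X` with cells of diameter at most `ρ`. -/
theorem exists_finite_cells (X : Type*) [MetricSpace X] [CompactSpace X] {ρ : ℝ} (hρ : 0 < ρ) :
    ∃ (l : ℕ) (c : X → Fin l), ∀ x y, c x = c y → dist x y ≤ ρ := by
  obtain ⟨t, -, ht, hX⟩ := finite_cover_balls_of_compact (isCompact_univ (X := X)) (half_pos hρ)
  have hX' : ∀ x : X, ∃ y : t, dist x (y : X) < ρ / 2 := fun x => by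
    obtain ⟨y, hy, hxy⟩ := Set.mem_iUnion₂.1 (hX (Set.mem_univ x))
    exact ⟨⟨y, hy⟩, hxy⟩
  choose c hc using hX'
  have := ht.fintype
  refine ⟨_, fun x => Fintype.equivFin t (c x), fun x y hxy => ?_⟩
  have hxy' : c x = c y := (Fintype.equivFin t).injective hxy
  have h1 := hc x
  have h2 := hc y
  rw [hxy'] at h1
  rw [dist_comm] at h2
  linarith [dist_triangle x (c y : X) y]

/-- For each length, the weighted sizes of separated sets are bounded. -/
theorem exists_expSum_le {f : X → X} {φ : X → ℝ} (hφ : Continuous φ) {δ : ℝ} (hδ : 0 < δ)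
    (n : ℕ) : ∃ A, ∀ E : Finset X, IsSeparated f n δ (E : Set X) → expSum f φ n E ≤ A := by
  obtain ⟨B, -, hB⟩ := exists_abs_le hφ
  obtain ⟨l, c, hc⟩ := exists_finite_cells X hδ
  refine ⟨(l ^ n : ℕ) * Real.exp (n * B), fun E hE => (expSum_le_card hB n E).trans ?_⟩
  gcongr
  exact card_le_of_isSeparated hc hE

/-- The separated sets of bounded length satisfy a common exponential bound. -/
theorem exists_expSum_le_of_lt {f : X → X} {φ : X → ℝ} (hφ : Continuous φ) {δ : ℝ} (hδ : 0 < δ)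
    (b : ℝ) (n₀ : ℕ) : ∃ A, 0 < A ∧ ∀ n < n₀, ∀ E : Finset X, IsSeparated f n δ (E : Set X) →
      expSum f φ n E ≤ A * Real.exp (n * b) := by
  choose A hA using exists_expSum_le (f := f) hφ hδ
  have hA0 : ∀ n, 0 ≤ A n := fun n => by simpa [expSum] using hA n ∅ (by simp [IsSeparated])
  have hpos : ∀ i ∈ Finset.range n₀, 0 ≤ A i * Real.exp (-(i * b)) := fun i _ =>
    mul_nonneg (hA0 i) (Real.exp_pos _).le
  refine ⟨1 + ∑ i ∈ Finset.range n₀, A i * Real.exp (-(i * b)),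
    by linarith [Finset.sum_nonneg hpos], fun n hn E hE => ?_⟩
  have := Finset.single_le_sum hpos (Finset.mem_range.2 hn)
  calc expSum f φ n E ≤ A n * Real.exp (-(n * b)) * Real.exp (n * b) := by
        rw [mul_assoc, ← Real.exp_add]; simpa using hA n E hE
    _ ≤ _ := by gcongr; linarith

/-- Turns eventual exponential bounds into bounds for all lengths, at the price of a constant. -/
theorem exists_forall_expSum_le {f : X → X} {φ : X → ℝ} (hφ : Continuous φ) {C : Set (X × ℕ)}
    {δ b : ℝ} (hδ : 0 < δ) (h : pressureAt f φ C δ 0 < b) :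
    ∃ A, 0 < A ∧ ∀ n : ℕ, ∀ E : Finset X, (E : Set X) ⊆ slice C n →
      IsSeparated f n δ (E : Set X) → expSum f φ n E ≤ A * Real.exp (n * b) := by
  obtain ⟨n₀, hn₀⟩ := eventually_atTop.1 (eventually_expSum_le h)
  obtain ⟨A, hA0, hA⟩ := exists_expSum_le_of_lt (f := f) hφ hδ b n₀
  refine ⟨max A 1, lt_max_of_lt_left hA0, fun n E h1 h2 => ?_⟩
  rcases lt_or_ge n n₀ with hn | hn
  · exact (hA n hn E h2).trans (by gcongr; exact le_max_left _ _)
  · exact (hn₀ n hn E h1 h2).trans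
      (le_mul_of_one_le_left (Real.exp_pos _).le (le_max_right _ _))

/-- A maximal separated set chosen greedily by decreasing values of the Birkhoff sums: each point
of `Y` is `ρ`-shadowed by a point of `E` whose Birkhoff sum is not smaller, up to `1`. -/
theorem exists_greedy_separated {f : X → X} {φ : X → ℝ} (hφ : Continuous φ) {ρ : ℝ} (hρ : 0 < ρ)
    (n : ℕ) (Y : Set X) :
    ∃ E : Finset X, (E : Set X) ⊆ Y ∧ IsSeparated f n ρ (E : Set X) ∧
      ∀ y ∈ Y, ∃ x ∈ E, (∀ k < n, dist (f^[k] x) (f^[k] y) ≤ ρ) ∧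
        birkhoffSum f φ n y ≤ birkhoffSum f φ n x + 1 := by
  classical
  obtain ⟨B, -, hB⟩ := exists_abs_le hφ
  obtain ⟨l, c, hc⟩ := exists_finite_cells X hρ
  -- Exhaust the superlevel sets of the Birkhoff sum, one unit at a time.
  have key : ∀ j : ℕ, ∃ E : Finset X, (E : Set X) ⊆ {y ∈ Y | n * B - j ≤ birkhoffSum f φ n y} ∧
      IsSeparated f n ρ (E : Set X) ∧ ∀ y ∈ Y, n * B - j ≤ birkhoffSum f φ n y →
        ∃ x ∈ E, (∀ k < n, dist (f^[k] x) (f^[k] y) ≤ ρ) ∧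
          birkhoffSum f φ n y ≤ birkhoffSum f φ n x + 1 := by
    -- Each separated subset of a superlevel set extends to a maximal one.
    have ext : ∀ (j : ℕ) (E₀ : Finset X),
        (E₀ : Set X) ⊆ {y ∈ Y | n * B - j ≤ birkhoffSum f φ n y} →
        IsSeparated f n ρ (E₀ : Set X) → ∃ E : Finset X, E₀ ⊆ E ∧
          (E : Set X) ⊆ {y ∈ Y | n * B - j ≤ birkhoffSum f φ n y} ∧
          IsSeparated f n ρ (E : Set X) ∧ ∀ y ∈ Y, n * B - j ≤ birkhoffSum f φ n y →
            ∃ x ∈ E, ∀ k < n, dist (f^[k] x) (f^[k] y) ≤ ρ := by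
      intro j E₀ h₁ h₂
      let T : Set ℕ := {i | ∃ E : Finset X, E₀ ⊆ E ∧
          (E : Set X) ⊆ {y ∈ Y | n * B - j ≤ birkhoffSum f φ n y} ∧
          IsSeparated f n ρ (E : Set X) ∧ E.card = i}
      have hT : BddAbove T := ⟨l ^ n, by
        rintro i ⟨E, -, -, hE, rfl⟩; exact card_le_of_isSeparated hc hE⟩
      have hne : T.Nonempty := ⟨E₀.card, E₀, subset_rfl, h₁, h₂, rfl⟩
      obtain ⟨E, hE₀, hEY, hE, hcard⟩ := Nat.sSup_mem hne hT
      refine ⟨E, hE₀, hEY, hE, fun y hy hyj => ?_⟩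
      by_contra hcon
      push Not at hcon
      have hyE : y ∉ E := fun hyE => by
        obtain ⟨k, -, hk⟩ := hcon y hyE
        simp at hk
        linarith
      have : E.card + 1 ∈ T := by
        refine ⟨insert y E, hE₀.trans (Finset.subset_insert _ _), ?_, ?_,
          Finset.card_insert_of_notMem hyE⟩
        · rw [Finset.coe_insert]
          exact Set.insert_subset ⟨hy, hyj⟩ hEY
        · rw [Finset.coe_insert]
          rintro a (rfl | ha) b (rfl | hb) hab
          · exact absurd rfl hab
          · obtain ⟨k, hk, hd⟩ := hcon b hb
            exact ⟨k, hk, by rwa [dist_comm]⟩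
          · exact hcon a ha
          · exact hE a ha b hb hab
      have := le_csSup hT this
      omega
    intro j
    induction j with
    | zero =>
      obtain ⟨E, -, h1, h2, h3⟩ := ext 0 ∅ (by simp) (by simp [IsSeparated])
      refine ⟨E, h1, h2, fun y hy hyj => ?_⟩
      obtain ⟨x, hx, hxy⟩ := h3 y hy hyj
      refine ⟨x, hx, hxy, ?_⟩
      have := (h1 hx).2
      have := (le_abs_self _).trans (abs_birkhoffSum_le (f := f) hB n y)
      simp at *
      linarith
    | succ j ih =>
      obtain ⟨E₀, h1, h2, h3⟩ := ih
      obtain ⟨E, h4, h5, h6, h7⟩ := ext (j + 1) E₀ (h1.trans fun y hy => ⟨hy.1, by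
        have := hy.2; push_cast; linarith⟩) h2
      refine ⟨E, h5, h6, fun y hy hyj => ?_⟩
      rcases le_or_gt (n * B - j) (birkhoffSum f φ n y) with h | h
      · obtain ⟨x, hx, hxy⟩ := h3 y hy h
        exact ⟨x, h4 hx, hxy⟩
      · obtain ⟨x, hx, hxy⟩ := h7 y hy hyj
        refine ⟨x, hx, hxy, ?_⟩
        have := (h5 hx).2
        push_cast at this
        linarith
  obtain ⟨j, hj⟩ := exists_nat_ge (n * B + n * B)
  obtain ⟨E, h1, h2, h3⟩ := key j
  refine ⟨E, fun x hx => (h1 hx).1, h2, fun y hy => h3 y hy ?_⟩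
  have := neg_le_of_abs_le (abs_birkhoffSum_le (f := f) hB n y)
  linarith

end Compact

/-! ### Counting along a CT-decomposition -/

section Cells

universe u

variable {X : Type u} [MetricSpace X]

/-- `Y` splits into finitely many cells of `d_n`-diameter at most `ρ`, and the numbers `exp (s i)`,
with `s i` an upper bound for `Φ(·, n)` on the `i`-th cell, add up to at most `w`. Unlike the
weighted sizes of separated sets, these bounds are submultiplicative under concatenation without
loss in the scale `ρ`. -/
def CellBound (f : X → X) (φ : X → ℝ) (ρ : ℝ) (n : ℕ) (Y : Set X) (w : ℝ) : Prop :=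
  ∃ (ι : Type u) (_ : Fintype ι) (c : X → ι) (s : ι → ℝ),
    (∀ x ∈ Y, ∀ y ∈ Y, c x = c y → ∀ k < n, dist (f^[k] x) (f^[k] y) ≤ ρ) ∧
    (∀ x ∈ Y, birkhoffSum f φ n x ≤ s (c x)) ∧ ∑ i, Real.exp (s i) ≤ w

variable {f : X → X} {φ : X → ℝ} {ρ : ℝ} {n : ℕ} {Y Y' : Set X} {w w' : ℝ}

theorem CellBound.mono (h : CellBound f φ ρ n Y w) (hY : Y' ⊆ Y) (hw : w ≤ w') :
    CellBound f φ ρ n Y' w' := by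
  obtain ⟨ι, _, c, s, h1, h2, h3⟩ := h
  exact ⟨ι, _, c, s, fun x hx y hy => h1 x (hY hx) y (hY hy), fun x hx => h2 x (hY hx),
    h3.trans hw⟩

theorem CellBound.union (h : CellBound f φ ρ n Y w) (h' : CellBound f φ ρ n Y' w') :
    CellBound f φ ρ n (Y ∪ Y') (w + w') := by
  classical
  obtain ⟨ι, _, c, s, h1, h2, h3⟩ := h
  obtain ⟨ι', _, c', s', h1', h2', h3'⟩ := h'
  refine ⟨ι ⊕ ι', inferInstance, fun x => if x ∈ Y then Sum.inl (c x) else Sum.inr (c' x),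
    Sum.elim s s', ?_, ?_, ?_⟩
  · intro x hx y hy hxy
    by_cases hxY : x ∈ Y <;> by_cases hyY : y ∈ Y <;> simp only [hxY, hyY, if_true, if_false,
      Sum.inl.injEq, Sum.inr.injEq, reduceCtorEq] at hxy
    · exact h1 x hxY y hyY hxy
    · exact h1' x (hx.resolve_left hxY) y (hy.resolve_left hyY) hxy
  · intro x hx
    by_cases hxY : x ∈ Y
    · simpa [hxY] using h2 x hxY
    · simpa [hxY] using h2' x (hx.resolve_left hxY)
  · rw [Fintype.sum_sum_type]
    exact add_le_add h3 h3'

theorem CellBound.biUnion {J : Type*} (t : Finset J) {Z : J → Set X} {v : J → ℝ}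
    (h : ∀ j ∈ t, CellBound f φ ρ n (Z j) (v j)) (h₀ : CellBound f φ ρ n Y w) :
    CellBound f φ ρ n (Y ∪ ⋃ j ∈ t, Z j) (w + ∑ j ∈ t, v j) := by
  classical
  induction t using Finset.induction_on with
  | empty => simpa using h₀
  | insert a t ha ih =>
    rw [Finset.sum_insert ha, Finset.set_biUnion_insert]
    refine ((h a (Finset.mem_insert_self a t)).union
      (ih fun j hj => h j (Finset.mem_insert_of_mem hj))).mono ?_ (by linarith)
    intro x hx
    simp only [Set.mem_union] at hx ⊢
    tauto

theorem CellBound.concat {m : ℕ} (hw : 0 ≤ w) (h : CellBound f φ ρ m Y w)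
    (h' : CellBound f φ ρ n Y' w') :
    CellBound f φ ρ (m + n) (Y ∩ f^[m] ⁻¹' Y') (w * w') := by
  obtain ⟨ι, _, c, s, h1, h2, h3⟩ := h
  obtain ⟨ι', _, c', s', h1', h2', h3'⟩ := h'
  refine ⟨ι × ι', inferInstance, fun x => (c x, c' (f^[m] x)), fun i => s i.1 + s' i.2, ?_, ?_, ?_⟩
  · intro x hx y hy hxy k hk
    obtain ⟨hxy1, hxy2⟩ := Prod.mk.injEq .. ▸ hxy
    rcases lt_or_ge k m with hkm | hkm
    · exact h1 x hx.1 y hy.1 hxy1 k hkm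
    · have := h1' _ hx.2 _ hy.2 hxy2 (k - m) (by omega)
      rwa [← Function.iterate_add_apply, ← Function.iterate_add_apply, Nat.sub_add_cancel hkm]
        at this
  · intro x hx
    rw [birkhoffSum_add]
    exact add_le_add (h2 x hx.1) (h2' _ hx.2)
  · simp_rw [Real.exp_add, Fintype.sum_prod_type, ← Finset.mul_sum, ← Finset.sum_mul]
    exact mul_le_mul h3 h3' (Finset.sum_nonneg fun _ _ => (Real.exp_pos _).le) hw

theorem CellBound.expSum_le (h : CellBound f φ ρ n Y w) {E : Finset X} (hE : (E : Set X) ⊆ Y)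
    (hsep : IsSeparated f n ρ (E : Set X)) : expSum f φ n E ≤ w := by
  classical
  obtain ⟨ι, _, c, s, h1, h2, h3⟩ := h
  have hinj : Set.InjOn c E := fun x hx y hy hxy => by
    by_contra hne
    obtain ⟨k, hk, hd⟩ := hsep x hx y hy hne
    exact absurd (h1 x (hE hx) y (hE hy) hxy k hk) (not_le.2 hd)
  calc expSum f φ n E ≤ ∑ x ∈ E, Real.exp (s (c x)) :=
        Finset.sum_le_sum fun x hx => Real.exp_le_exp.2 (h2 x (hE hx))
    _ = ∑ i ∈ E.image c, Real.exp (s i) :=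
        (Finset.sum_image (f := fun i => Real.exp (s i)) hinj).symm
    _ ≤ ∑ i, Real.exp (s i) :=
        Finset.sum_le_univ_sum_of_nonneg fun _ => (Real.exp_pos _).le
    _ ≤ w := h3

/-- Cells obtained from a greedy separated set, of twice the scale. -/
theorem cellBound_of_forall_expSum_le [CompactSpace X] (hφ : Continuous φ) (hρ : 0 < ρ)
    (hw : 0 < w) (h : ∀ E : Finset X, (E : Set X) ⊆ Y → IsSeparated f n ρ (E : Set X) →
      expSum f φ n E ≤ w) :
    CellBound f φ (2 * ρ) n Y (Real.exp 1 * w) := by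
  classical
  obtain ⟨E, hEY, hE, hcov⟩ := exists_greedy_separated (f := f) hφ hρ n Y
  rcases Y.eq_empty_or_nonempty with rfl | ⟨y₀, hy₀⟩
  · refine ⟨PUnit, inferInstance, fun _ => PUnit.unit, fun _ => Real.log w, by simp, by simp, ?_⟩
    simpa [Real.exp_log hw] using le_mul_of_one_le_left hw.le (Real.one_le_exp zero_le_one)
  obtain ⟨x₀, hx₀, -⟩ := hcov y₀ hy₀
  choose! a ha using hcov
  refine ⟨E, inferInstance, fun y => if hy : y ∈ Y then ⟨a y, (ha y hy).1⟩ else ⟨x₀, hx₀⟩,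
    fun x => birkhoffSum f φ n x + 1, ?_, ?_, ?_⟩
  · intro x hx y hy hxy k hk
    simp only [hx, hy, dif_pos, Subtype.mk.injEq] at hxy
    have h1 := (ha x hx).2.1 k hk
    have h2 := (ha y hy).2.1 k hk
    rw [hxy, dist_comm] at h1
    linarith [dist_triangle (f^[k] x) (f^[k] (a y)) (f^[k] y)]
  · intro x hx
    simpa only [hx, dif_pos] using (ha x hx).2.2
  · rw [Finset.sum_coe_sort E fun x => Real.exp (birkhoffSum f φ n x + 1)]
    simp_rw [Real.exp_add, ← Finset.sum_mul]
    rw [mul_comm]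
    exact mul_le_mul_of_nonneg_left (h E hEY hE) (Real.exp_pos _).le

/-- If the segments outside `D` and the prefixes and suffixes of a CT-decomposition grow slower
than `exp (n b)`, then already the segments with short prefix and suffix carry every growth rate
`β > b` that the whole space has. Otherwise the bounds `w n` for the whole space satisfy
`w n ≤ A exp (n β) + ∑_{p + s > M} B exp ((p + s) b) w (n - p - s)` with `B` independent of `M`,
and this renewal inequality forces `w n = O(exp (n β))`. -/
theorem exists_le_pressureAt_goodUpTo [CompactSpace X] (hφ : Continuous φ)
    (hρ : 0 < ρ) {D P G S : Set (X × ℕ)} {p g s : X → ℕ → ℕ}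
    (hdec : IsCTDecomposition f D P G S p g s) {b β : ℝ} (hbβ : b < β)
    (hD : pressureAt f φ Dᶜ ρ 0 < b) (hPS : pressureAt f φ (P ∪ S) ρ 0 < b)
    (hβ : β < pressureAt f φ Set.univ (2 * ρ) 0) :
    ∃ M : ℕ, β ≤ pressureAt f φ (goodUpTo D p s M) ρ 0 := by
  classical
  by_contra hcon
  push Not at hcon
  obtain ⟨A₁, hA₁, hD'⟩ := exists_forall_expSum_le hφ hρ hD
  obtain ⟨A₂, hA₂, hPS'⟩ := exists_forall_expSum_le hφ hρ hPS
  set e := Real.exp 1 with he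
  have he0 : 0 < e := Real.exp_pos _
  -- `t ^ 2` is the ratio of the two growth rates.
  set t := Real.exp (-(β - b) / 2) with ht
  have ht0 : 0 < t := Real.exp_pos _
  have ht1 : t < 1 := by rw [ht, Real.exp_lt_one_iff]; linarith
  have ht2 : ∀ k : ℕ, Real.exp (k * b) = t ^ k * t ^ k * Real.exp (k * β) := fun k => by
    rw [ht, ← Real.exp_nat_mul, ← Real.exp_add, ← Real.exp_add]; congr 1; ring
  set K := (e * A₂) * (e * A₂) * ((1 - t)⁻¹ * (1 - t)⁻¹) with hK
  have hK0 : 0 ≤ K := by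
    have : 0 ≤ (1 - t)⁻¹ := inv_nonneg.2 (by linarith)
    positivity
  obtain ⟨M, hM⟩ : ∃ M : ℕ, K * t ^ M ≤ 1 / 2 := by
    have h0 : Tendsto (fun M : ℕ => K * t ^ M) atTop (𝓝 (K * 0)) :=
      (tendsto_pow_atTop_nhds_zero_of_lt_one ht0.le ht1).const_mul K
    rw [mul_zero] at h0
    exact (h0.eventually (eventually_le_nhds (by norm_num))).exists
  obtain ⟨A₃, hA₃, hG'⟩ := exists_forall_expSum_le hφ hρ (hcon M)
  set A := e * (A₁ + A₃) with hA
  have hA0 : 0 < A := by positivity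
  have hcD : ∀ n, CellBound f φ (2 * ρ) n (slice Dᶜ n) (e * (A₁ * Real.exp (n * b))) := fun n =>
    cellBound_of_forall_expSum_le hφ hρ (by positivity) (hD' n)
  have hcPS : ∀ n, CellBound f φ (2 * ρ) n (slice (P ∪ S) n) (e * (A₂ * Real.exp (n * b))) :=
    fun n => cellBound_of_forall_expSum_le hφ hρ (by positivity) (hPS' n)
  have hcG : ∀ n, CellBound f φ (2 * ρ) n (slice (goodUpTo D p s M) n)
      (e * (A₃ * Real.exp (n * β))) := fun n =>
    cellBound_of_forall_expSum_le hφ hρ (by positivity) (hG' n)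
  have key : ∀ n : ℕ, CellBound f φ (2 * ρ) n Set.univ (2 * A * Real.exp (n * β)) := by
    intro n
    induction n using Nat.strong_induction_on with
    | _ n ih =>
    let T : Finset (ℕ × ℕ) := ((Finset.range (n + 1)) ×ˢ (Finset.range (n + 1))).filter
      fun q => M < q.1 + q.2 ∧ q.1 + q.2 ≤ n
    let Z : ℕ × ℕ → Set X := fun q => {x | (x, n) ∈ D ∧ p x n = q.1 ∧ s x n = q.2}
    have hZ : ∀ q ∈ T, CellBound f φ (2 * ρ) n (Z q)
        ((e * (A₂ * Real.exp (q.1 * b))) * ((2 * A * Real.exp ((n - q.1 - q.2 : ℕ) * β)) *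
          (e * (A₂ * Real.exp (q.2 * b))))) := by
      rintro ⟨i, j⟩ hq
      obtain ⟨-, hq1, hq2⟩ := Finset.mem_filter.1 hq
      dsimp only at hq1 hq2 ⊢
      have h1 := (ih (n - i - j) (by omega)).concat (by positivity) (hcPS j)
      have h2 := (hcPS i).concat (by positivity) h1
      have hn : i + (n - i - j + j) = n := by omega
      rw [hn] at h2
      refine h2.mono ?_ le_rfl
      rintro x ⟨hxD, hxp, hxs⟩
      obtain ⟨hP, -, hS, hsum⟩ := hdec x n hxD
      dsimp only at hxp hxs
      rw [hxs] at hS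
      rw [hxp] at hP hS
      have hg : g x n = n - i - j := by omega
      refine ⟨Or.inl hP, trivial, Or.inr ?_⟩
      rwa [← Function.iterate_add_apply, add_comm, ← hg]
    have hU := CellBound.biUnion T hZ ((hcD n).union (hcG n))
    refine hU.mono ?_ ?_
    · intro x _
      by_cases hxD : (x, n) ∈ D
      · obtain ⟨-, -, -, hsum⟩ := hdec x n hxD
        by_cases hxM : p x n ≤ M ∧ s x n ≤ M
        · exact Or.inl (Or.inr ⟨hxD, hxM.1, hxM.2⟩)
        · refine Or.inr (Set.mem_biUnion (x := (p x n, s x n)) ?_ ⟨hxD, rfl, rfl⟩)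
          simp only [T, Finset.coe_filter, Finset.mem_product, Finset.mem_range, Set.mem_ofPred_eq]
          omega
      · exact Or.inl (Or.inl hxD)
    · have hterm : ∀ q ∈ T, (e * (A₂ * Real.exp (q.1 * b))) *
          ((2 * A * Real.exp ((n - q.1 - q.2 : ℕ) * β)) * (e * (A₂ * Real.exp (q.2 * b)))) ≤
          2 * A * Real.exp (n * β) * ((e * A₂) * (e * A₂) * t ^ M) * (t ^ q.1 * t ^ q.2) := by
        rintro ⟨i, j⟩ hq
        obtain ⟨-, hq1, hq2⟩ := Finset.mem_filter.1 hq
        dsimp only at hq1 hq2 ⊢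
        have hexp : Real.exp (n * β) = Real.exp (i * β) * Real.exp ((n - i - j : ℕ) * β) *
            Real.exp (j * β) := by
          rw [← Real.exp_add, ← Real.exp_add, Nat.cast_sub (by omega), Nat.cast_sub (by omega)]
          congr 1; ring
        have htM : t ^ i * t ^ j ≤ t ^ M := by
          rw [← pow_add]; exact pow_le_pow_of_le_one ht0.le ht1.le hq1.le
        rw [ht2 i, ht2 j, hexp]
        calc _ = 2 * A * (Real.exp (i * β) * Real.exp ((n - i - j : ℕ) * β) * Real.exp (j * β)) *
              ((e * A₂) * (e * A₂) * (t ^ i * t ^ j)) * (t ^ i * t ^ j) := by ring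
          _ ≤ _ := by gcongr
      have hgeom : ∑ q ∈ T, t ^ q.1 * t ^ q.2 ≤ (1 - t)⁻¹ * (1 - t)⁻¹ := by
        calc ∑ q ∈ T, t ^ q.1 * t ^ q.2
            ≤ ∑ q ∈ (Finset.range (n + 1)) ×ˢ (Finset.range (n + 1)), t ^ q.1 * t ^ q.2 :=
              Finset.sum_le_sum_of_subset_of_nonneg (Finset.filter_subset _ _)
                fun _ _ _ => by positivity
          _ = (∑ i ∈ Finset.range (n + 1), t ^ i) * ∑ j ∈ Finset.range (n + 1), t ^ j := by
              rw [Finset.sum_mul_sum, Finset.sum_product]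
          _ ≤ _ := by
              have : ∑ i ∈ Finset.range (n + 1), t ^ i ≤ (1 - t)⁻¹ := by
                rw [← tsum_geometric_of_lt_one ht0.le ht1]
                exact (summable_geometric_of_lt_one ht0.le ht1).sum_le_tsum _
                  fun _ _ => by positivity
              have h0 : 0 ≤ ∑ i ∈ Finset.range (n + 1), t ^ i :=
                Finset.sum_nonneg fun _ _ => by positivity
              exact mul_le_mul this this h0 (h0.trans this)
      have hsum : ∑ q ∈ T, (e * (A₂ * Real.exp (q.1 * b))) *
          ((2 * A * Real.exp ((n - q.1 - q.2 : ℕ) * β)) * (e * (A₂ * Real.exp (q.2 * b)))) ≤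
          2 * A * Real.exp (n * β) * (K * t ^ M) := by
        refine (Finset.sum_le_sum hterm).trans ?_
        rw [← Finset.mul_sum]
        calc _ ≤ 2 * A * Real.exp (n * β) * ((e * A₂) * (e * A₂) * t ^ M) *
              ((1 - t)⁻¹ * (1 - t)⁻¹) := by gcongr
          _ = _ := by rw [hK]; ring
      have hbn : Real.exp (n * b) ≤ Real.exp (n * β) := by gcongr
      have h1 : e * (A₁ * Real.exp (n * b)) ≤ e * (A₁ * Real.exp (n * β)) := by gcongr
      have h2 : 2 * A * Real.exp (n * β) * (K * t ^ M) ≤ 2 * A * Real.exp (n * β) * (1 / 2) := by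
        gcongr
      have h3 : A * Real.exp (n * β) =
          e * (A₁ * Real.exp (n * β)) + e * (A₃ * Real.exp (n * β)) := by rw [hA]; ring
      linarith
  exact absurd (pressureAt_le_of_forall fun n E _ hE =>
    (key n).expSum_le (Set.subset_univ _) hE) (not_le.2 hβ)

end Cells

/-! ### Invariant sets built by gluing -/

section Glue

/-- Weights not exceeding `c`, of total at least `c`, have a partial sum between `c` and `2 * c`. -/
theorem exists_subset_sum_mem_Icc {X : Type*} {w : X → ℝ} {c : ℝ}
    (hw : ∀ x, w x ≤ c) {E : Finset X} (hE : c ≤ ∑ x ∈ E, w x) (hc : 0 ≤ c) :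
    ∃ F ⊆ E, c ≤ ∑ x ∈ F, w x ∧ ∑ x ∈ F, w x ≤ 2 * c := by
  classical
  induction E using Finset.induction_on with
  | empty => exact ⟨∅, subset_rfl, hE, by simpa using hc⟩
  | insert a s ha ih =>
    by_cases h : c ≤ ∑ x ∈ s, w x
    · obtain ⟨F, hF, h'⟩ := ih h
      exact ⟨F, hF.trans (Finset.subset_insert _ _), h'⟩
    · refine ⟨insert a s, subset_rfl, hE, ?_⟩
      rw [Finset.sum_insert ha]
      linarith [hw a]

variable {X : Type*} [MetricSpace X] {f : X → X} {φ : X → ℝ}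

/-- The points whose orbits follow the first `n` iterates of points of `E`, one after the other,
with gaps shorter than `τ`. -/
def gluedSet (f : X → X) (δ : ℝ) (τ n : ℕ) (E : Finset X) : Set X :=
  {z | ∃ (x : ℕ → X) (r : ℕ → ℕ), (∀ k, x k ∈ E) ∧ (∀ k, r k < τ) ∧ Traces f δ x (fun _ => n) r z}

theorem startTime_succ' (m r : ℕ → ℕ) (k : ℕ) :
    startTime m r (k + 1) =
      m 0 + r 0 + startTime (fun i => m (i + 1)) (fun i => r (i + 1)) k := by
  rw [startTime, Finset.sum_range_succ', add_comm, startTime]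

theorem exists_iterate_mem_gluedSet {δ : ℝ} {τ n : ℕ} {E : Finset X} {z : X}
    (hz : z ∈ gluedSet f δ τ n E) :
    ∃ x ∈ E, ∃ r < τ, (∀ j < n, dist (f^[j] z) (f^[j] x) ≤ δ) ∧
      f^[n + r] z ∈ gluedSet f δ τ n E := by
  obtain ⟨x, r, hx, hr, hz⟩ := hz
  refine ⟨x 0, hx 0, r 0, hr 0, fun j hj => by simpa [startTime] using hz 0 j hj,
    fun k => x (k + 1), fun k => r (k + 1), fun k => hx _, fun k => hr _, fun k j hj => ?_⟩
  rw [← Function.iterate_add_apply]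
  have := hz (k + 1) j hj
  rw [startTime_succ'] at this
  convert this using 3
  omega

/-- The closure of the forward orbit of the glued points. -/
def gluedClosure (f : X → X) (δ : ℝ) (τ n : ℕ) (E : Finset X) : Set X :=
  closure (⋃ i < n + τ, f^[i] '' gluedSet f δ τ n E)

theorem mapsTo_gluedClosure (hf : Continuous f) (δ : ℝ) (τ : ℕ) {n : ℕ} (hn : 0 < n)
    (E : Finset X) : Set.MapsTo f (gluedClosure f δ τ n E) (gluedClosure f δ τ n E) := by
  refine Set.MapsTo.closure ?_ hf
  intro y hy
  obtain ⟨i, hi, z, hz, rfl⟩ := Set.mem_iUnion₂.1 hy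
  rw [← Function.iterate_succ_apply' f i z]
  rcases lt_or_ge (i + 1) (n + τ) with h | h
  · exact Set.mem_iUnion₂.2 ⟨_, h, z, hz, rfl⟩
  · obtain ⟨x, -, r, hr, -, hz'⟩ := exists_iterate_mem_gluedSet hz
    refine Set.mem_iUnion₂.2 ⟨i + 1 - (n + r), by omega, _, hz', ?_⟩
    rw [← Function.iterate_add_apply]
    congr 2
    omega

theorem le_birkhoffSum_startTime {x : ℕ → X} {r : ℕ → ℕ} {n τ : ℕ} {z : X} {δ B V : ℝ}
    (hB : ∀ x, |φ x| ≤ B) (hr : ∀ k, r k < τ) (hz : Traces f δ x (fun _ => n) r z)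
    (hV : ∀ k, ∀ z, (∀ j < n, dist (f^[j] z) (f^[j] (x k)) ≤ δ) →
      |birkhoffSum f φ n (x k) - birkhoffSum f φ n z| ≤ V) (K : ℕ) :
    ∑ k ∈ Finset.range K, birkhoffSum f φ n (x k) - K * (V + τ * B) ≤
      birkhoffSum f φ (startTime (fun _ => n) r K) z := by
  induction K with
  | zero => simp [startTime]
  | succ K ih =>
    have hst : startTime (fun _ => n) r (K + 1) = startTime (fun _ => n) r K + (n + r K) := by
      simp [startTime, Finset.sum_range_succ]
    rw [Finset.sum_range_succ, hst, birkhoffSum_add, birkhoffSum_add]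
    have h1 := (abs_le.1 (hV K (f^[startTime (fun _ => n) r K] z) fun j hj => by
      rw [← Function.iterate_add_apply, add_comm]; exact hz K j hj)).2
    have h2 := (abs_le.1 (abs_birkhoffSum_le (f := f) hB (r K)
      (f^[n] (f^[startTime (fun _ => n) r K] z)))).1
    have hB0 : 0 ≤ B := (abs_nonneg _).trans (hB z)
    have h3 : (r K : ℝ) * B ≤ τ * B := by gcongr; exact (hr K).le
    push_cast
    linarith

/-- Lower bound for the pressure of the glued points: among the `K`-fold concatenations, one pattern
of gaps carries a proportion at least `τ ^ (-K)` of the total weight `(∑_E exp Φ) ^ K`. -/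
theorem le_pressureAt_gluedSet {δ : ℝ} (hδ : 0 ≤ δ) {τ n : ℕ} (hn : 0 < n) {E : Finset X}
    {V B β : ℝ} (hB : ∀ x, |φ x| ≤ B) (hE0 : E.Nonempty)
    (hE : IsSeparated f n (4 * δ) (E : Set X))
    (hglue : ∀ x : ℕ → X, (∀ k, x k ∈ E) → ∃ (r : ℕ → ℕ) (z : X), (∀ k, r k < τ) ∧
      Traces f δ x (fun _ => n) r z)
    (hV : ∀ x ∈ E, ∀ z, (∀ j < n, dist (f^[j] z) (f^[j] x) ≤ δ) →
      |birkhoffSum f φ n x - birkhoffSum f φ n z| ≤ V)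
    (hβ : ∀ r < τ, τ * Real.exp (V + τ * B) * Real.exp ((n + r) * β) < expSum f φ n E)
    {C : Set (X × ℕ)} (hC : ∀ z ∈ gluedSet f δ τ n E, ∀ N, (z, N) ∈ C) :
    β ≤ pressureAt f φ C (2 * δ) 0 := by
  classical
  refine le_pressureAt_of_frequently (frequently_atTop.2 fun K₀ => ?_)
  obtain ⟨e₀, he₀⟩ := hE0
  set K := K₀ + 1 with hK
  let x : (Fin K → E) → ℕ → X := fun w k => if h : k < K then w ⟨k, h⟩ else e₀
  have hxE : ∀ w k, x w k ∈ E := fun w k => by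
    by_cases h : k < K
    · simp only [x, h, dif_pos]; exact (w ⟨k, h⟩).2
    · simpa only [x, h, dif_neg, not_false_eq_true] using he₀
  choose r z hr hz using fun w => hglue (x w) (hxE w)
  have hτ : 0 < τ := (Nat.zero_le _).trans_lt (hr (fun _ => ⟨e₀, he₀⟩) 0)
  have hτ' : (0 : ℝ) < τ := by exact_mod_cast hτ
  set W := expSum f φ n E with hW
  have htot : ∑ w : Fin K → E, Real.exp (∑ k ∈ Finset.range K, birkhoffSum f φ n (x w k)) =
      W ^ K := by
    have h1 : ∀ w : Fin K → E, Real.exp (∑ k ∈ Finset.range K, birkhoffSum f φ n (x w k)) =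
        ∏ k : Fin K, Real.exp (birkhoffSum f φ n (w k)) := fun w => by
      rw [Real.exp_sum, Finset.prod_range]
      simp [x]
    simp_rw [h1]
    rw [hW, expSum, ← Finset.sum_coe_sort E fun x => Real.exp (birkhoffSum f φ n x),
      Fintype.sum_pow]
  have : Nonempty (Fin K → Fin τ) := ⟨fun _ => ⟨0, hτ⟩⟩
  obtain ⟨R, hR⟩ := Fintype.exists_le_sum_fiber_of_nsmul_le_sum
    (f := fun (w : Fin K → E) (k : Fin K) => (⟨r w k, hr w k⟩ : Fin τ))
    (w := fun w => Real.exp (∑ k ∈ Finset.range K, birkhoffSum f φ n (x w k)))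
    (b := (W / τ) ^ K) (by
      rw [htot, nsmul_eq_mul, div_pow]
      simp only [Fintype.card_pi_const, Fintype.card_fin, Nat.cast_pow]
      rw [mul_div_cancel₀ _ (by positivity)])
  set F : Finset (Fin K → E) := {w | (fun k : Fin K => (⟨r w k, hr w k⟩ : Fin τ)) = R} with hF
  have hFR : ∀ w ∈ F, ∀ k (hk : k < K), r w k = R ⟨k, hk⟩ := fun w hw k hk => by
    have := congr_fun (Finset.mem_filter.1 hw).2 ⟨k, hk⟩
    exact congr_arg Fin.val this
  -- The common starting times of the concatenations with gaps `R`.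
  set R' : ℕ → ℕ := fun k => if hk : k < K then R ⟨k, hk⟩ else 0 with hR'
  have hst : ∀ w ∈ F, ∀ k ≤ K, startTime (fun _ => n) (r w) k = startTime (fun _ => n) R' k :=
    fun w hw k hk => Finset.sum_congr rfl fun i hi => by
      have hi' : i < K := (Finset.mem_range.1 hi).trans_le hk
      simp only [R', hi', dif_pos, hFR w hw i hi']
  set N := startTime (fun _ => n) R' K with hN
  have hNK : K₀ ≤ N := by
    have : K ≤ N := by
      calc K = ∑ i ∈ Finset.range K, 1 := by simp
        _ ≤ N := Finset.sum_le_sum fun i _ => by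
            show 1 ≤ n + R' i
            omega
    omega
  have hsep : ∀ w ∈ F, ∀ w' ∈ F, w ≠ w' →
      ∃ j < N, 2 * δ < dist (f^[j] (z w)) (f^[j] (z w')) := by
    intro w hw w' hw' hne
    obtain ⟨k, hk⟩ := Function.ne_iff.1 hne
    obtain ⟨j, hj, hd⟩ := hE _ (w k).2 _ (w' k).2 (Subtype.coe_injective.ne hk)
    have h1 := hz w k j hj
    have h2 := hz w' k j hj
    rw [hst w hw k k.2.le] at h1
    rw [hst w' hw' k k.2.le] at h2
    simp only [x, k.2, dif_pos, Fin.eta] at h1 h2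
    refine ⟨startTime (fun _ => n) R' k + j, ?_, ?_⟩
    · have : startTime (fun _ => n) R' (k + 1) ≤ N :=
        Finset.sum_le_sum_of_subset (Finset.range_mono k.2)
      rw [startTime, Finset.sum_range_succ, ← startTime] at this
      omega
    · rw [dist_comm] at h1
      have := dist_triangle4 (f^[j] (w k : X)) (f^[startTime (fun _ => n) R' k + j] (z w))
        (f^[startTime (fun _ => n) R' k + j] (z w')) (f^[j] (w' k : X))
      linarith
  have hinj : Set.InjOn z F := fun w hw w' hw' h => by
    by_contra hne
    obtain ⟨j, -, hd⟩ := hsep w hw w' hw' hne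
    rw [h, dist_self] at hd
    linarith
  refine ⟨N, hNK, F.image z, ?_, ?_, ?_⟩
  · intro y hy
    obtain ⟨w, -, rfl⟩ := Finset.mem_image.1 (Finset.mem_coe.1 hy)
    exact hC _ ⟨x w, r w, hxE w, hr w, hz w⟩ N
  · intro y hy y' hy' hne
    obtain ⟨w, hw, rfl⟩ := Finset.mem_image.1 (Finset.mem_coe.1 hy)
    obtain ⟨w', hw', rfl⟩ := Finset.mem_image.1 (Finset.mem_coe.1 hy')
    exact hsep w hw w' hw' fun h => hne (by rw [h])
  · have hQ : 0 < Real.exp (V + τ * B) := Real.exp_pos _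
    have hexp : Real.exp (N * β) < (W / τ) ^ K / Real.exp (V + τ * B) ^ K := by
      have e1 : (N : ℝ) * β = ∑ k ∈ Finset.range K, ((n + R' k) * β) := by
        rw [hN, startTime, ← Finset.sum_mul]; push_cast; rfl
      rw [e1, Real.exp_sum, ← div_pow]
      have h1 : ∀ k ∈ Finset.range K,
          Real.exp ((n + R' k) * β) < W / τ / Real.exp (V + τ * B) := by
        intro k hk
        have hk' := Finset.mem_range.1 hk
        have := hβ (R ⟨k, hk'⟩) (R ⟨k, hk'⟩).2
        simp only [R', hk', dif_pos]
        rw [div_div, lt_div_iff₀ (by positivity)]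
        linarith
      have h2 := Finset.prod_lt_prod_of_nonempty (fun k _ => Real.exp_pos _) h1
        (Finset.nonempty_range_iff.2 (by omega))
      rwa [Finset.prod_const, Finset.card_range] at h2
    refine hexp.trans_le ?_
    rw [expSum, Finset.sum_image hinj, div_le_iff₀ (by positivity)]
    refine hR.trans ?_
    rw [Finset.sum_mul]
    refine Finset.sum_le_sum fun w hw => ?_
    rw [← Real.exp_nat_mul, ← Real.exp_add, Real.exp_le_exp, hN, ← hst w hw K le_rfl]
    have := le_birkhoffSum_startTime hB (hr w) (hz w) (fun k => hV _ (hxE w k)) K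
    linarith

variable [CompactSpace X]

/-- Since `n ↦ sup Φ(·, n)` is subadditive, the lower limit in `P^*(φ)` bounds all long Birkhoff
sums. -/
theorem eventually_birkhoffSum_le (hφ : Continuous φ) {α : ℝ} (hα : lowerThreshold f φ < α) :
    ∀ᶠ n : ℕ in atTop, ∀ x, birkhoffSum f φ n x ≤ n * α := by
  obtain ⟨B, hB0, hB⟩ := exists_abs_le hφ
  obtain ⟨a, ha1, ha2⟩ := EReal.lt_iff_exists_real_btwn.1 hα
  have haα : a < α := by exact_mod_cast ha2
  obtain ⟨q, hq, hq0⟩ := ((frequently_lt_of_liminf_lt (h := ha1)).and_eventually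
    (eventually_gt_atTop 0)).exists
  have hq0' : (0 : ℝ) < q := by exact_mod_cast hq0
  have hqx : ∀ x, birkhoffSum f φ q x ≤ q * a := fun x => by
    have h := (le_iSup (fun x : X => ((birkhoffSum f φ q x / q : ℝ) : EReal)) x).trans hq.le
    have h' : birkhoffSum f φ q x / q ≤ a := by exact_mod_cast h
    rwa [div_le_iff₀ hq0', mul_comm] at h'
  have hmul : ∀ (k : ℕ) (x : X), birkhoffSum f φ (k * q) x ≤ (k * q : ℕ) * a := by
    intro k
    induction k with
    | zero => simp
    | succ k ih =>
      intro x
      rw [Nat.succ_mul, birkhoffSum_add]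
      have := ih x
      have := hqx (f^[k * q] x)
      push_cast at *
      linarith
  obtain ⟨n₀, hn₀⟩ := exists_nat_ge (q * (|a| + B) / (α - a))
  filter_upwards [eventually_ge_atTop n₀] with n hn x
  have hn' : (n₀ : ℝ) ≤ n := by exact_mod_cast hn
  have h1 : q * (|a| + B) ≤ n * (α - a) := by
    rw [div_le_iff₀ (by linarith)] at hn₀
    exact hn₀.trans (by gcongr)
  have hmod : ((n % q : ℕ) : ℝ) ≤ q := by exact_mod_cast (Nat.mod_lt n hq0).le
  have hdiv : ((n / q * q : ℕ) : ℝ) = n - (n % q : ℕ) := by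
    have := Nat.div_add_mod' n q
    have : ((n / q * q + n % q : ℕ) : ℝ) = n := by exact_mod_cast this
    push_cast at this ⊢
    linarith
  have h2 : birkhoffSum f φ n x ≤ (n / q * q : ℕ) * a + (n % q : ℕ) * B := by
    conv_lhs => rw [← Nat.div_add_mod' n q, birkhoffSum_add]
    exact add_le_add (hmul _ _) ((le_abs_self _).trans (abs_birkhoffSum_le hB _ _))
  rw [hdiv] at h2
  have h3 : ((n % q : ℕ) : ℝ) * (B - a) ≤ q * (|a| + B) := by
    calc ((n % q : ℕ) : ℝ) * (B - a) ≤ (n % q : ℕ) * (|a| + B) := by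
          gcongr; linarith [neg_abs_le a]
      _ ≤ _ := by gcongr
  linarith

/-- Upper bound for the pressure of the glued points. The hypothesis says that a step of the
renewal, which takes the weight of `E`, the number of gaps, the number of itineraries during the
gap and the distortion into account, costs no more than the growth rate `β` allows. -/
theorem exists_expSum_gluedSet_le (hφ : Continuous φ) {δ : ℝ} (hδ : 0 < δ) {τ n l : ℕ}
    (hn : 0 < n) {c : X → Fin l} (hc : ∀ x y, c x = c y → dist x y ≤ 2 * δ) {E : Finset X}
    {V B β : ℝ} (hB : ∀ x, |φ x| ≤ B)
    (hV : ∀ x ∈ E, ∀ z, (∀ j < n, dist (f^[j] z) (f^[j] x) ≤ δ) →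
      |birkhoffSum f φ n x - birkhoffSum f φ n z| ≤ V)
    (hβ : ∀ r < τ, τ * l ^ τ * Real.exp (V + τ * B) * expSum f φ n E ≤ Real.exp ((n + r) * β)) :
    ∃ A, 0 < A ∧ ∀ N : ℕ, ∀ F : Finset X, (F : Set X) ⊆ gluedSet f δ τ n E →
      IsSeparated f N (2 * δ) (F : Set X) → expSum f φ N F ≤ A * Real.exp (N * β) := by
  classical
  obtain ⟨A, hA0, hA⟩ := exists_expSum_le_of_lt (f := f) hφ (by positivity : 0 < 2 * δ) β (n + τ)
  refine ⟨A, hA0, fun N => ?_⟩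
  induction N using Nat.strong_induction_on with
  | _ N ih =>
  intro F hFZ hF
  rcases lt_or_ge N (n + τ) with hN | hN
  · exact hA N hN F hF
  choose! x hxE r hr htr hnext using
    fun z (hz : z ∈ F) => exists_iterate_mem_gluedSet (hFZ hz)
  rcases F.eq_empty_or_nonempty with rfl | ⟨z₀, hz₀⟩
  · simp only [expSum, Finset.sum_empty]; positivity
  have hτ : 0 < τ := (Nat.zero_le _).trans_lt (hr z₀ hz₀)
  have : Nonempty E := ⟨⟨x z₀, hxE z₀ hz₀⟩⟩
  -- Points with the same first segment, gap and itinerary during the gap get separated later.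
  let lab : X → E × Fin τ × (Fin τ → Fin l) := fun z =>
    if hz : z ∈ F then (⟨x z, hxE z hz⟩, ⟨r z, hr z hz⟩, fun j => c (f^[n + j] z))
    else (Classical.arbitrary _, ⟨0, hτ⟩, fun _ => c z)
  have hfib : ∀ i : E × Fin τ × (Fin τ → Fin l),
      ∑ z ∈ F with lab z = i, Real.exp (birkhoffSum f φ N z) ≤
        Real.exp (birkhoffSum f φ n i.1) *
          (Real.exp (V + τ * B) * (A * Real.exp ((N - (n + i.2.1) : ℕ) * β))) := by
    rintro ⟨⟨x₁, hx₁⟩, ⟨r₁, hr₁⟩, k₁⟩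
    dsimp only
    set F' : Finset X := {z ∈ F | lab z = (⟨x₁, hx₁⟩, ⟨r₁, hr₁⟩, k₁)} with hF'
    have hlab : ∀ z ∈ F', z ∈ F ∧ x z = x₁ ∧ r z = r₁ ∧
        ∀ j (hj : j < τ), c (f^[n + j] z) = k₁ ⟨j, hj⟩ := by
      intro z hz
      obtain ⟨hzF, hzl⟩ := Finset.mem_filter.1 hz
      simp only [lab, hzF, dif_pos, Prod.mk.injEq, Subtype.mk.injEq, Fin.mk.injEq] at hzl
      exact ⟨hzF, hzl.1, hzl.2.1, fun j hj => congr_fun hzl.2.2 ⟨j, hj⟩⟩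
    have hsep : ∀ z ∈ F', ∀ z' ∈ F', z ≠ z' → ∃ k < N - (n + r₁),
        2 * δ < dist (f^[k] (f^[n + r₁] z)) (f^[k] (f^[n + r₁] z')) := by
      intro z hz z' hz' hne
      obtain ⟨hzF, hzx, hzr, hzk⟩ := hlab z hz
      obtain ⟨hzF', hzx', hzr', hzk'⟩ := hlab z' hz'
      obtain ⟨k, hk, hd⟩ := hF z hzF z' hzF' hne
      have h1 : n ≤ k := by
        by_contra hkn
        have a1 := htr z hzF k (by omega)
        have a2 := htr z' hzF' k (by omega)
        rw [hzx] at a1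
        rw [hzx', dist_comm] at a2
        linarith [dist_triangle (f^[k] z) (f^[k] x₁) (f^[k] z')]
      have h2 : n + r₁ ≤ k := by
        by_contra hkn
        have a1 := hzk (k - n) (by omega)
        have a2 := hzk' (k - n) (by omega)
        rw [Nat.add_sub_cancel' h1] at a1 a2
        exact absurd (hc _ _ (a1.trans a2.symm)) (not_le.2 hd)
      refine ⟨k - (n + r₁), by omega, ?_⟩
      rwa [← Function.iterate_add_apply, ← Function.iterate_add_apply, Nat.sub_add_cancel h2]
    have hinj : Set.InjOn f^[n + r₁] F' := fun z hz z' hz' hzz => by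
      by_contra hne
      obtain ⟨k, -, hd⟩ := hsep z hz z' hz' hne
      rw [hzz, dist_self] at hd
      linarith
    have hIH := ih (N - (n + r₁)) (by omega) (F'.image f^[n + r₁])
      (by
        intro y hy
        obtain ⟨z, hz, rfl⟩ := Finset.mem_image.1 (Finset.mem_coe.1 hy)
        obtain ⟨hzF, -, hzr, -⟩ := hlab z hz
        rw [← hzr]
        exact hnext z hzF)
      (by
        intro y hy y' hy' hne
        obtain ⟨z, hz, rfl⟩ := Finset.mem_image.1 (Finset.mem_coe.1 hy)
        obtain ⟨z', hz', rfl⟩ := Finset.mem_image.1 (Finset.mem_coe.1 hy')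
        exact hsep z hz z' hz' fun h => hne (by rw [h]))
    rw [expSum, Finset.sum_image hinj] at hIH
    have hpt : ∀ z ∈ F', Real.exp (birkhoffSum f φ N z) ≤ Real.exp (birkhoffSum f φ n x₁) *
        Real.exp (V + τ * B) * Real.exp (birkhoffSum f φ (N - (n + r₁)) (f^[n + r₁] z)) := by
      intro z hz
      obtain ⟨hzF, hzx, -, -⟩ := hlab z hz
      rw [← Real.exp_add, ← Real.exp_add, Real.exp_le_exp]
      have e1 : N = n + r₁ + (N - (n + r₁)) := by omega
      conv_lhs => rw [e1]
      rw [birkhoffSum_add, birkhoffSum_add]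
      have a1 := (abs_le.1 (hV x₁ hx₁ z (hzx ▸ htr z hzF))).1
      have a2 := (abs_le.1 (abs_birkhoffSum_le (f := f) hB r₁ (f^[n] z))).2
      have hB0 : 0 ≤ B := (abs_nonneg _).trans (hB z)
      have a3 : (r₁ : ℝ) * B ≤ τ * B := by gcongr
      linarith
    refine (Finset.sum_le_sum hpt).trans ?_
    rw [← Finset.mul_sum, mul_assoc]
    gcongr
  have hstep : ∀ r : Fin τ, l ^ τ * (expSum f φ n E *
      (Real.exp (V + τ * B) * (A * Real.exp ((N - (n + r) : ℕ) * β)))) ≤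
      (τ : ℝ)⁻¹ * (A * Real.exp (N * β)) := by
    intro r
    have h := hβ r r.2
    have hτ' : (0 : ℝ) < τ := by exact_mod_cast hτ
    have hexp : Real.exp (N * β) =
        Real.exp ((n + (r : ℕ)) * β) * Real.exp ((N - (n + r) : ℕ) * β) := by
      rw [← Real.exp_add, Nat.cast_sub (by omega)]
      congr 1; push_cast; ring
    rw [hexp, inv_mul_eq_div, le_div_iff₀ hτ']
    calc _ = τ * l ^ τ * Real.exp (V + τ * B) * expSum f φ n E *
          (A * Real.exp ((N - (n + r) : ℕ) * β)) := by ring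
      _ ≤ Real.exp ((n + (r : ℕ)) * β) * (A * Real.exp ((N - (n + r) : ℕ) * β)) := by gcongr
      _ = _ := by ring
  have hτ' : (τ : ℝ) ≠ 0 := by exact_mod_cast hτ.ne'
  calc expSum f φ N F
      = ∑ i, ∑ z ∈ F with lab z = i, Real.exp (birkhoffSum f φ N z) :=
        (Finset.sum_fiberwise F lab _).symm
    _ ≤ ∑ i : E × Fin τ × (Fin τ → Fin l), Real.exp (birkhoffSum f φ n i.1) *
          (Real.exp (V + τ * B) * (A * Real.exp ((N - (n + i.2.1) : ℕ) * β))) :=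
        Finset.sum_le_sum fun i _ => hfib i
    _ = ∑ r : Fin τ, l ^ τ * (expSum f φ n E *
          (Real.exp (V + τ * B) * (A * Real.exp ((N - (n + r) : ℕ) * β)))) := by
        simp only [Fintype.sum_prod_type]
        rw [Finset.sum_comm]
        refine Finset.sum_congr rfl fun r _ => ?_
        rw [Finset.sum_comm, Finset.sum_const, ← Finset.sum_mul, nsmul_eq_mul,
          Finset.sum_coe_sort E fun x => Real.exp (birkhoffSum f φ n x)]
        simp [expSum]
    _ ≤ ∑ _r : Fin τ, (τ : ℝ)⁻¹ * (A * Real.exp (N * β)) :=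
        Finset.sum_le_sum fun r _ => hstep r
    _ = A * Real.exp (N * β) := by simp [hτ']

theorem exists_expSum_gluedClosure_le (hf : Continuous f) (hφ : Continuous φ) {δ : ℝ} (hδ : 0 < δ)
    {τ n : ℕ} {E : Finset X} {A β : ℝ}
    (hA : ∀ N : ℕ, ∀ F : Finset X, (F : Set X) ⊆ gluedSet f δ τ n E →
      IsSeparated f N (2 * δ) (F : Set X) → expSum f φ N F ≤ A * Real.exp (N * β)) :
    ∃ A', ∀ N : ℕ, ∀ F : Finset X, (F : Set X) ⊆ gluedClosure f δ τ n E →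
      IsSeparated f N (2 * δ) (F : Set X) → expSum f φ N F ≤ A' * Real.exp (N * β) := by
  classical
  obtain ⟨B, hB0, hB⟩ := exists_abs_le hφ
  have hcont : ∀ N : ℕ, Continuous (birkhoffSum f φ N) := fun N =>
    continuous_finsetSum _ fun k _ => hφ.comp (hf.iterate k)
  -- First a bound before taking the closure.
  have hopen : ∀ N : ℕ, ∀ F : Finset X, (F : Set X) ⊆ ⋃ i < n + τ, f^[i] '' gluedSet f δ τ n E →
      IsSeparated f N (2 * δ) (F : Set X) → expSum f φ N F ≤
        (∑ i ∈ Finset.range (n + τ), Real.exp (i * B) * (A * Real.exp (i * β))) *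
          Real.exp (N * β) := by
    intro N F hF hsep
    have hF' : ∀ y ∈ F, ∃ i ∈ Finset.range (n + τ), ∃ z ∈ gluedSet f δ τ n E, f^[i] z = y := by
      intro y hy
      obtain ⟨i, hi, z, hz, rfl⟩ := Set.mem_iUnion₂.1 (hF hy)
      exact ⟨i, Finset.mem_range.2 hi, z, hz, rfl⟩
    choose! i hi z hz hzy using hF'
    rw [expSum, ← Finset.sum_fiberwise_of_maps_to hi, Finset.sum_mul]
    refine Finset.sum_le_sum fun k hk => ?_
    set F' : Finset X := {y ∈ F | i y = k} with hF'
    have hmem : ∀ y ∈ F', y ∈ F ∧ f^[k] (z y) = y := fun y hy => by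
      obtain ⟨h1, rfl⟩ := Finset.mem_filter.1 hy
      exact ⟨h1, hzy y h1⟩
    have hinj : Set.InjOn z F' := fun y hy y' hy' h => by
      rw [← (hmem y hy).2, ← (hmem y' hy').2, h]
    have h := hA (k + N) (F'.image z)
      (by
        intro w hw
        obtain ⟨y, hy, rfl⟩ := Finset.mem_image.1 (Finset.mem_coe.1 hw)
        exact hz y (hmem y hy).1)
      (by
        intro w hw w' hw' hne
        obtain ⟨y, hy, rfl⟩ := Finset.mem_image.1 (Finset.mem_coe.1 hw)
        obtain ⟨y', hy', rfl⟩ := Finset.mem_image.1 (Finset.mem_coe.1 hw')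
        obtain ⟨j, hj, hd⟩ := hsep y (hmem y hy).1 y' (hmem y' hy').1 fun h => hne (by rw [h])
        refine ⟨j + k, by omega, ?_⟩
        rwa [Function.iterate_add_apply, Function.iterate_add_apply, (hmem y hy).2,
          (hmem y' hy').2])
    rw [expSum, Finset.sum_image hinj] at h
    have hpt : ∀ y ∈ F', Real.exp (birkhoffSum f φ N y) ≤
        Real.exp (k * B) * Real.exp (birkhoffSum f φ (k + N) (z y)) := by
      intro y hy
      rw [← Real.exp_add, Real.exp_le_exp, birkhoffSum_add, (hmem y hy).2]
      linarith [(abs_le.1 (abs_birkhoffSum_le (f := f) hB k (z y))).1]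
    refine (Finset.sum_le_sum hpt).trans ?_
    rw [← Finset.mul_sum]
    calc _ ≤ Real.exp (k * B) * (A * Real.exp ((k + N : ℕ) * β)) := by gcongr
      _ = _ := by push_cast; rw [add_mul, Real.exp_add]; ring
  refine ⟨Real.exp 1 * ∑ i ∈ Finset.range (n + τ), Real.exp (i * B) * (A * Real.exp (i * β)),
    fun N F hF hsep => ?_⟩
  -- Move the finitely many points slightly, keeping them separated.
  let U : Set (F → X) := {u | (∀ y y' : F, y ≠ y' → ∃ k < N,
      2 * δ < dist (f^[k] (u y)) (f^[k] (u y'))) ∧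
    ∀ y : F, birkhoffSum f φ N y < birkhoffSum f φ N (u y) + 1}
  have hU : IsOpen U := by
    have : U = (⋂ (y : F) (y' : F) (_ : y ≠ y'), ⋃ (k : ℕ) (_ : k < N),
        {u : F → X | 2 * δ < dist (f^[k] (u y)) (f^[k] (u y'))}) ∩
        ⋂ y : F, {u : F → X | birkhoffSum f φ N y < birkhoffSum f φ N (u y) + 1} := by
      ext u; simp [U]
    rw [this]
    refine IsOpen.inter ?_ ?_
    · refine isOpen_iInter_of_finite fun y => isOpen_iInter_of_finite fun y' =>
        isOpen_iInter_of_finite fun _ => isOpen_iUnion fun k => isOpen_iUnion fun _ => ?_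
      have := hf.iterate k
      exact isOpen_lt continuous_const (by fun_prop)
    · refine isOpen_iInter_of_finite fun y => ?_
      have := hcont N
      exact isOpen_lt continuous_const (by fun_prop)
  have hcl : (fun y : F => (y : X)) ∈ closure (Set.pi Set.univ fun _ : F =>
      ⋃ i < n + τ, f^[i] '' gluedSet f δ τ n E) := by
    rw [closure_pi_set]
    exact fun y _ => hF y.2
  obtain ⟨u, ⟨hu1, hu2⟩, hu3⟩ := mem_closure_iff.1 hcl U hU
    ⟨fun y y' hne => hsep y y.2 y' y'.2 (Subtype.coe_injective.ne hne), fun y => by simp⟩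
  have hinj : Function.Injective u := fun y y' h => by
    by_contra hne
    obtain ⟨k, -, hk⟩ := hu1 y y' hne
    rw [h, dist_self] at hk
    linarith
  have h := hopen N (Finset.univ.image u)
    (by
      intro w hw
      obtain ⟨y, -, rfl⟩ := Finset.mem_image.1 (Finset.mem_coe.1 hw)
      exact hu3 y trivial)
    (by
      intro w hw w' hw' hne
      obtain ⟨y, -, rfl⟩ := Finset.mem_image.1 (Finset.mem_coe.1 hw)
      obtain ⟨y', -, rfl⟩ := Finset.mem_image.1 (Finset.mem_coe.1 hw')
      exact hu1 y y' fun h => hne (by rw [h]))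
  rw [expSum, Finset.sum_image hinj.injOn] at h
  rw [expSum, ← Finset.sum_coe_sort F fun y => Real.exp (birkhoffSum f φ N y), mul_assoc]
  refine le_trans ?_ (mul_le_mul_of_nonneg_left h (Real.exp_pos _).le)
  rw [Finset.mul_sum]
  refine Finset.sum_le_sum fun y _ => ?_
  rw [← Real.exp_add, Real.exp_le_exp, add_comm]
  exact (hu2 y).le

/-- Gluing separated sets of segments of total weight close to `exp (n α)` yields a compact
forward invariant set of pressure close to `α`. -/
theorem exists_invariant_of_gluing (hf : Continuous f) (hφ : Continuous φ) {δ ρ r : ℝ} (hδ : 0 < δ)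
    (hρ : 4 * δ ≤ ρ) (hr : δ < r) {C : Set (X × ℕ)} (hGO : GluingOrbit f C δ)
    (hBP : BowenProp f φ C r) {α : ℝ} (hα : lowerThreshold f φ < α)
    (hα' : α < pressureAt f φ C ρ 0) {η : ℝ} (hη : 0 < η) :
    ∃ Λ : Set X, IsCompact Λ ∧ Set.MapsTo f Λ Λ ∧
      ((α - η : ℝ) : EReal) < setPressureAt f φ Λ (2 * δ) ∧
      setPressureAt f φ Λ (2 * δ) < ((α + η : ℝ) : EReal) := by
  obtain ⟨B, hB0, hB⟩ := exists_abs_le hφ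
  obtain ⟨N₀, τ, hτ, hglue⟩ := hGO
  obtain ⟨V, hV⟩ := hBP
  obtain ⟨l, c, hc⟩ := exists_finite_cells X (by positivity : 0 < 2 * δ)
  set L : ℝ := τ * l ^ τ * Real.exp (V + τ * B) with hL
  set L' : ℝ := τ * Real.exp (V + τ * B) with hL'
  -- `n` is so long that the constants are dominated by `exp (n η / 2)`.
  have hlarge : ∀ κ : ℝ, ∀ᶠ n : ℕ in atTop, κ ≤ Real.exp (n * (η / 2)) := fun κ =>
    (Real.tendsto_exp_atTop.comp
      (tendsto_natCast_atTop_atTop.atTop_mul_const (half_pos hη))).eventually_ge_atTop κ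
  obtain ⟨n, ⟨E₀, hE₀C, hE₀, hE₀α⟩, hsum, h1, h2, hnN, hn0⟩ :=
    ((frequently_exists_expSum_gt hα').and_eventually
      ((eventually_birkhoffSum_le hφ hα).and ((hlarge (2 * L * Real.exp (τ * |α + η / 2|))).and
        ((hlarge (2 * L' * Real.exp (τ * |α - η / 2|))).and
          ((eventually_ge_atTop N₀).and (eventually_gt_atTop 0)))))).exists
  obtain ⟨E, hEE₀, hEα, hEα'⟩ := exists_subset_sum_mem_Icc
    (w := fun x => Real.exp (birkhoffSum f φ n x)) (c := Real.exp (n * α))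
    (fun x => Real.exp_le_exp.2 (hsum x)) hE₀α.le (Real.exp_pos _).le
  rw [← expSum] at hEα hEα'
  have hEC : ∀ x ∈ E, (x, n) ∈ C := fun x hx => hE₀C (hEE₀ hx)
  have hVE : ∀ x ∈ E, ∀ z, (∀ j < n, dist (f^[j] z) (f^[j] x) ≤ δ) →
      |birkhoffSum f φ n x - birkhoffSum f φ n z| ≤ V := fun x hx z hz =>
    hV x n (hEC x hx) z fun j hj => by rw [dist_comm]; exact (hz j hj).trans_lt hr
  have hE0 : E.Nonempty := by
    rw [Finset.nonempty_iff_ne_empty]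
    rintro rfl
    simp only [expSum, Finset.sum_empty] at hEα
    exact absurd hEα (not_le.2 (Real.exp_pos _))
  have hup : ∀ r < τ, L * expSum f φ n E ≤ Real.exp ((n + r) * (α + η / 2)) := by
    intro r hr
    have a1 : -(τ * |α + η / 2|) ≤ r * (α + η / 2) := by
      have b1 : (r : ℝ) * |α + η / 2| ≤ τ * |α + η / 2| := by gcongr
      have b2 : (r : ℝ) * (-|α + η / 2|) ≤ r * (α + η / 2) := by gcongr; exact neg_abs_le _
      linarith
    calc L * expSum f φ n E ≤ L * (2 * Real.exp (n * α)) := by gcongr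
      _ = (2 * L * Real.exp (τ * |α + η / 2|)) *
          (Real.exp (n * α) * Real.exp (-(τ * |α + η / 2|))) := by
          rw [Real.exp_neg]; field_simp
      _ ≤ Real.exp (n * (η / 2)) * (Real.exp (n * α) * Real.exp (r * (α + η / 2))) := by gcongr
      _ = _ := by rw [← Real.exp_add, ← Real.exp_add]; congr 1; ring
  have hlow : ∀ r < τ, L' * Real.exp ((n + r) * (α - η / 2)) < expSum f φ n E := by
    intro r hr
    have a1 : r * (α - η / 2) ≤ τ * |α - η / 2| := by
      have b1 : (r : ℝ) * |α - η / 2| ≤ τ * |α - η / 2| := by gcongr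
      have b2 : (r : ℝ) * (α - η / 2) ≤ r * |α - η / 2| := by gcongr; exact le_abs_self _
      linarith
    refine lt_of_lt_of_le ?_ hEα
    have a2 : 0 < Real.exp (n * α) := Real.exp_pos _
    calc L' * Real.exp ((n + r) * (α - η / 2))
        = L' * Real.exp (r * (α - η / 2)) * (Real.exp (n * α) * Real.exp (-(n * (η / 2)))) := by
          rw [show (n + r) * (α - η / 2) = r * (α - η / 2) + (n * α + -(n * (η / 2))) by ring,
            Real.exp_add, Real.exp_add]
          ring
      _ ≤ L' * Real.exp (τ * |α - η / 2|) *
          (Real.exp (n * α) * Real.exp (-(n * (η / 2)))) := by gcongr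
      _ = (2 * L' * Real.exp (τ * |α - η / 2|)) *
          (Real.exp (n * α) * Real.exp (-(n * (η / 2)))) / 2 := by ring
      _ ≤ Real.exp (n * (η / 2)) * (Real.exp (n * α) * Real.exp (-(n * (η / 2)))) / 2 := by
          gcongr
      _ = Real.exp (n * α) / 2 := by rw [Real.exp_neg]; field_simp
      _ < Real.exp (n * α) := by linarith
  refine ⟨gluedClosure f δ τ n E, isClosed_closure.isCompact, mapsTo_gluedClosure hf δ τ hn0 E,
    ?_, ?_⟩
  · refine lt_of_lt_of_le (b := ((α - η / 2 : ℝ) : EReal)) (by norm_cast; linarith) ?_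
    refine le_pressureAt_gluedSet hδ.le hn0 hB hE0
      ((hE₀.mono (Finset.coe_subset.2 hEE₀)).anti hρ)
      (fun x hx => hglue x (fun _ => n) fun k => ⟨hEC _ (hx k), hnN⟩) hVE hlow ?_
    intro z hz N
    exact ⟨subset_closure (Set.mem_iUnion₂.2 ⟨0, by omega, z, hz, rfl⟩), trivial⟩
  · refine lt_of_le_of_lt (b := ((α + η / 2 : ℝ) : EReal)) ?_ (by norm_cast; linarith)
    obtain ⟨A, -, hA⟩ := exists_expSum_gluedSet_le hφ hδ hn0 hc hB hVE hup
    obtain ⟨A', hA'⟩ := exists_expSum_gluedClosure_le hf hφ hδ hA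
    refine pressureAt_le_of_forall fun N F hF hsep => hA' N F (fun y hy => (hF hy).1) hsep

end Glue

/-! ### Shannon entropy of finite partitions -/

section Shannon

/-- Gibbs' inequality. -/
theorem sum_negMulLog_le {ι : Type*} [Fintype ι] {p q : ι → ℝ} (hp : ∀ i, 0 ≤ p i)
    (hq : ∀ i, 0 ≤ q i) (hpq : ∀ i, q i = 0 → p i = 0) (hsum : ∑ i, q i ≤ ∑ i, p i) :
    ∑ i, Real.negMulLog (p i) ≤ ∑ i, -(p i * Real.log (q i)) := by
  have h : ∀ i, Real.negMulLog (p i) ≤ -(p i * Real.log (q i)) + (q i - p i) := by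
    intro i
    rcases (hp i).eq_or_lt with h0 | h0
    · rw [← h0]; simpa using hq i
    · have hq0 : 0 < q i := (hq i).lt_of_ne fun h => h0.ne' (hpq i h.symm)
      have h1 := Real.log_le_sub_one_of_pos (div_pos hq0 h0)
      rw [Real.log_div hq0.ne' h0.ne'] at h1
      have h2 : p i * (Real.log (q i) - Real.log (p i)) ≤ p i * (q i / p i - 1) := by gcongr
      have h3 : p i * (q i / p i - 1) = q i - p i := by field_simp
      rw [Real.negMulLog]
      linarith
  refine (Finset.sum_le_sum fun i _ => h i).trans ?_
  rw [Finset.sum_add_distrib, Finset.sum_sub_distrib]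
  linarith

/-- The finite variational principle: `H(p) + ∑ p s ≤ log ∑ exp s`. -/
theorem sum_negMulLog_add_le_log_sum_exp {ι : Type*} [Fintype ι] {p s : ι → ℝ}
    (hp : ∀ i, 0 ≤ p i) (hsum : ∑ i, p i = 1) :
    ∑ i, Real.negMulLog (p i) + ∑ i, p i * s i ≤ Real.log (∑ i, Real.exp (s i)) := by
  have hne : (Finset.univ : Finset ι).Nonempty := by
    rw [Finset.nonempty_iff_ne_empty]
    intro h
    rw [h] at hsum
    simp at hsum
  have hZ : 0 < ∑ i, Real.exp (s i) := Finset.sum_pos (fun i _ => Real.exp_pos _) hne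
  have h := sum_negMulLog_le (q := fun i => Real.exp (s i) / ∑ j, Real.exp (s j)) hp
    (fun i => by positivity) (fun i hi => absurd hi (by positivity))
    (by rw [← Finset.sum_div, div_self hZ.ne', hsum])
  have h2 : ∀ i, -(p i * Real.log (Real.exp (s i) / ∑ j, Real.exp (s j))) =
      p i * Real.log (∑ j, Real.exp (s j)) - p i * s i := fun i => by
    rw [Real.log_div (Real.exp_pos _).ne' hZ.ne', Real.log_exp]; ring
  simp_rw [h2] at h
  rw [Finset.sum_sub_distrib, ← Finset.sum_mul, hsum, one_mul] at h
  linarith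

theorem negMulLog_sum_le {ι : Type*} {s : Finset ι} {p : ι → ℝ} (hp : ∀ i ∈ s, 0 ≤ p i) :
    Real.negMulLog (∑ i ∈ s, p i) ≤ ∑ i ∈ s, Real.negMulLog (p i) := by
  simp only [Real.negMulLog, neg_mul, Finset.sum_mul, Finset.sum_neg_distrib]
  refine neg_le_neg (Finset.sum_le_sum fun i hi => ?_)
  rcases (hp i hi).eq_or_lt with h0 | h0
  · rw [← h0]; simp
  · gcongr
    exact Finset.single_le_sum hp hi

variable {X : Type*} [MeasurableSpace X] {ι κ : Type*}

theorem measurableSet_pi_fiber {J : Type*} [Countable J] {ξ : J → X → ι}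
    (hξ : ∀ j i, MeasurableSet (ξ j ⁻¹' {i})) (i : J → ι) :
    MeasurableSet ((fun x j => ξ j x) ⁻¹' {i}) := by
  have : (fun x j => ξ j x) ⁻¹' {i} = ⋂ j, ξ j ⁻¹' {i j} := by
    ext x; simp [funext_iff]
  rw [this]
  exact MeasurableSet.iInter fun j => hξ j _

theorem measurableSet_prodMk_fiber {ξ : X → ι} {ζ : X → κ} (hξ : ∀ i, MeasurableSet (ξ ⁻¹' {i}))
    (hζ : ∀ i, MeasurableSet (ζ ⁻¹' {i})) (i : ι × κ) :
    MeasurableSet ((fun x => (ξ x, ζ x)) ⁻¹' {i}) := by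
  have : (fun x => (ξ x, ζ x)) ⁻¹' {i} = ξ ⁻¹' {i.1} ∩ ζ ⁻¹' {i.2} := by
    ext x; simp [Prod.ext_iff]
  rw [this]
  exact (hξ _).inter (hζ _)

theorem measurableSet_iterate_fiber {f : X → X} (hf : Measurable f) {ξ : X → ι}
    (hξ : ∀ i, MeasurableSet (ξ ⁻¹' {i})) (k : ℕ) (i : ι) :
    MeasurableSet ((fun x => ξ (f^[k] x)) ⁻¹' {i}) := (hf.iterate k) (hξ i)

/-- The labels of the first `n` points of an orbit; its level sets form the partition
`ξ ∨ f⁻¹ξ ∨ ⋯ ∨ f^{-(n-1)}ξ`. -/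
def itinerary {X ι : Type*} (f : X → X) (ξ : X → ι) (n : ℕ) (x : X) : Fin n → ι :=
  fun k => ξ (f^[k] x)

theorem measurableSet_itinerary_fiber {f : X → X} (hf : Measurable f) {ξ : X → ι}
    (hξ : ∀ i, MeasurableSet (ξ ⁻¹' {i})) (n : ℕ) (i : Fin n → ι) :
    MeasurableSet (itinerary f ξ n ⁻¹' {i}) :=
  measurableSet_pi_fiber (fun (k : Fin n) => measurableSet_iterate_fiber hf hξ k) i

variable [Fintype ι]

theorem measureReal_comp_fiber [DecidableEq κ] (μ : Measure X) [IsFiniteMeasure μ] {ξ : X → ι}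
    (hξ : ∀ i, MeasurableSet (ξ ⁻¹' {i})) (g : ι → κ) (k : κ) :
    μ.real ((fun x => g (ξ x)) ⁻¹' {k}) = ∑ i with g i = k, μ.real (ξ ⁻¹' {i}) := by
  rw [← measureReal_biUnion_finset]
  · congr 1
    ext x; simp
  · intro i _ j _ hij
    exact Disjoint.preimage ξ (by simpa using hij)
  · exact fun i _ => hξ i

variable [Fintype κ]

theorem shannonEntropy_nonneg (μ : Measure X) [IsProbabilityMeasure μ] (ξ : X → ι) :
    0 ≤ shannonEntropy μ ξ :=
  Finset.sum_nonneg fun _ _ => Real.negMulLog_nonneg measureReal_nonneg measureReal_le_one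

theorem sum_measureReal_fiber (μ : Measure X) [IsProbabilityMeasure μ] {ξ : X → ι}
    (hξ : ∀ i, MeasurableSet (ξ ⁻¹' {i})) : ∑ i, μ.real (ξ ⁻¹' {i}) = 1 := by
  have h := measureReal_comp_fiber μ hξ (fun _ => ()) ()
  simpa using h.symm

theorem shannonEntropy_comp_le (μ : Measure X) [IsProbabilityMeasure μ] {ξ : X → ι}
    (hξ : ∀ i, MeasurableSet (ξ ⁻¹' {i})) (g : ι → κ) :
    shannonEntropy μ (fun x => g (ξ x)) ≤ shannonEntropy μ ξ := by
  classical
  unfold shannonEntropy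
  calc _ = ∑ k, Real.negMulLog (∑ i with g i = k, μ.real (ξ ⁻¹' {i})) := by
        simp_rw [measureReal_comp_fiber μ hξ g]
    _ ≤ ∑ k, ∑ i with g i = k, Real.negMulLog (μ.real (ξ ⁻¹' {i})) :=
        Finset.sum_le_sum fun k _ => negMulLog_sum_le fun _ _ => measureReal_nonneg
    _ = _ := Finset.sum_fiberwise _ _ _

/-- Entropy does not increase when passing to a coarser partition. -/
theorem shannonEntropy_le_of_factor (μ : Measure X) [IsProbabilityMeasure μ] {ξ : X → ι}
    {ζ : X → κ} (hξ : ∀ i, MeasurableSet (ξ ⁻¹' {i})) (h : ∀ x y, ξ x = ξ y → ζ x = ζ y) :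
    shannonEntropy μ ζ ≤ shannonEntropy μ ξ := by
  have : Nonempty X := by
    by_contra hne
    have := not_nonempty_iff.1 hne
    exact IsProbabilityMeasure.ne_zero μ (Measure.eq_zero_of_isEmpty μ)
  obtain ⟨g, hg⟩ : ∃ g : ι → κ, ∀ x, ζ x = g (ξ x) :=
    ⟨fun i => ζ (Function.invFun ξ i), fun x => h _ _ (Function.invFun_eq ⟨x, rfl⟩).symm⟩
  rw [funext hg]
  exact shannonEntropy_comp_le μ hξ g

theorem shannonEntropy_prodMk_le (μ : Measure X) [IsProbabilityMeasure μ] {ξ : X → ι}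
    {ζ : X → κ} (hξ : ∀ i, MeasurableSet (ξ ⁻¹' {i})) (hζ : ∀ i, MeasurableSet (ζ ⁻¹' {i})) :
    shannonEntropy μ (fun x => (ξ x, ζ x)) ≤ shannonEntropy μ ξ + shannonEntropy μ ζ := by
  classical
  have hm := measurableSet_prodMk_fiber hξ hζ
  obtain ⟨r, hr⟩ : ∃ r : ι × κ → ℝ, ∀ i, μ.real ((fun x => (ξ x, ζ x)) ⁻¹' {i}) = r i :=
    ⟨_, fun _ => rfl⟩
  have h1 : ∀ i, μ.real (ξ ⁻¹' {i}) = ∑ k, r (i, k) := fun i => by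
    have := measureReal_comp_fiber μ hm Prod.fst i
    simp_rw [hr] at this
    rw [this, Finset.sum_filter, Fintype.sum_prod_type, Finset.sum_comm]
    simp
  have h2 : ∀ k, μ.real (ζ ⁻¹' {k}) = ∑ i, r (i, k) := fun k => by
    have := measureReal_comp_fiber μ hm Prod.snd k
    simp_rw [hr] at this
    rw [this, Finset.sum_filter, Fintype.sum_prod_type]
    simp
  have hr0 : ∀ i, 0 ≤ r i := fun i => by rw [← hr i]; exact measureReal_nonneg
  have hle1 : ∀ i k, r (i, k) ≤ μ.real (ξ ⁻¹' {i}) := fun i k => by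
    rw [h1 i]
    exact Finset.single_le_sum (f := fun k => r (i, k)) (fun k _ => hr0 (i, k)) (Finset.mem_univ k)
  have hle2 : ∀ i k, r (i, k) ≤ μ.real (ζ ⁻¹' {k}) := fun i k => by
    rw [h2 k]
    exact Finset.single_le_sum (f := fun i => r (i, k)) (fun i _ => hr0 (i, k)) (Finset.mem_univ i)
  have hG := sum_negMulLog_le (p := r)
    (q := fun i => μ.real (ξ ⁻¹' {i.1}) * μ.real (ζ ⁻¹' {i.2})) hr0
    (fun i => by positivity) (fun i hi => by
      rcases mul_eq_zero.1 hi with h | h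
      · exact le_antisymm ((hle1 i.1 i.2).trans_eq h) (hr0 i)
      · exact le_antisymm ((hle2 i.1 i.2).trans_eq h) (hr0 i))
    (by
      have hsum := sum_measureReal_fiber μ hm
      simp_rw [hr] at hsum
      rw [hsum, Fintype.sum_prod_type]
      simp_rw [← Finset.mul_sum]
      rw [sum_measureReal_fiber μ hζ]
      simp [sum_measureReal_fiber μ hξ])
  unfold shannonEntropy
  simp_rw [hr]
  refine hG.trans (le_of_eq ?_)
  have hterm : ∀ i k, -(r (i, k) * Real.log (μ.real (ξ ⁻¹' {i}) * μ.real (ζ ⁻¹' {k}))) =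
      -(r (i, k) * Real.log (μ.real (ξ ⁻¹' {i}))) -
        r (i, k) * Real.log (μ.real (ζ ⁻¹' {k})) := by
    intro i k
    by_cases h : r (i, k) = 0
    · simp [h]
    · have h0 := (hr0 (i, k)).lt_of_ne' h
      rw [Real.log_mul (h0.trans_le (hle1 i k)).ne' (h0.trans_le (hle2 i k)).ne']
      ring
  rw [Fintype.sum_prod_type]
  simp_rw [hterm, Finset.sum_sub_distrib]
  rw [sub_eq_add_neg]
  congr 1
  · refine Finset.sum_congr rfl fun i _ => ?_
    rw [Finset.sum_neg_distrib, ← Finset.sum_mul, ← h1, Real.negMulLog, neg_mul]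
  · rw [Finset.sum_comm, ← Finset.sum_neg_distrib]
    refine Finset.sum_congr rfl fun k _ => ?_
    rw [← Finset.sum_mul, ← h2, Real.negMulLog, neg_mul]

/-- Subadditivity: a partition determined by finitely many others has at most their total
entropy. -/
theorem shannonEntropy_le_sum {J : Type*} (μ : Measure X) [IsProbabilityMeasure μ] (s : Finset J)
    {ξ : J → X → ι} (hξ : ∀ j ∈ s, ∀ i, MeasurableSet (ξ j ⁻¹' {i})) {ζ : X → κ}
    (h : ∀ x y, (∀ j ∈ s, ξ j x = ξ j y) → ζ x = ζ y) :
    shannonEntropy μ ζ ≤ ∑ j ∈ s, shannonEntropy μ (ξ j) := by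
  classical
  have key : ∀ t ⊆ s,
      shannonEntropy μ (fun x (j : t) => ξ j x) ≤ ∑ j ∈ t, shannonEntropy μ (ξ j) := by
    intro t
    induction t using Finset.induction_on with
    | empty =>
      intro _
      simp only [Finset.sum_empty, shannonEntropy]
      refine (Finset.sum_nonpos fun i _ => ?_)
      have : (fun x (j : (∅ : Finset J)) => ξ j x) ⁻¹' {i} = Set.univ := by
        ext x
        simp only [Set.mem_preimage, Set.mem_singleton_iff, Set.mem_univ, iff_true]
        exact Subsingleton.elim _ _
      rw [this]
      simp
    | insert a t ha ih =>
      intro hs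
      have hms : ∀ j : t, ∀ i, MeasurableSet (ξ j ⁻¹' {i}) := fun j =>
        hξ j (hs (Finset.mem_insert_of_mem j.2))
      have hma := hξ a (hs (Finset.mem_insert_self a t))
      rw [Finset.sum_insert ha]
      refine le_trans ?_ (add_le_add_right (ih ((Finset.subset_insert a t).trans hs)) _)
      refine le_trans ?_ (shannonEntropy_prodMk_le μ hma (measurableSet_pi_fiber hms))
      refine shannonEntropy_le_of_factor μ
        (measurableSet_prodMk_fiber hma (measurableSet_pi_fiber hms)) fun x y hxy => ?_
      obtain ⟨h1, h2⟩ := Prod.mk.injEq .. ▸ hxy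
      ext ⟨j, hj⟩
      rcases Finset.mem_insert.1 hj with rfl | hj
      · exact h1
      · exact congr_fun h2 ⟨j, hj⟩
  refine le_trans ?_ (key s subset_rfl)
  exact shannonEntropy_le_of_factor μ (measurableSet_pi_fiber fun j : s => hξ j j.2)
    fun x y hxy => h x y fun j hj => congr_fun hxy ⟨j, hj⟩

theorem shannonEntropy_le_log_card (μ : Measure X) [IsProbabilityMeasure μ] {ξ : X → ι}
    (hξ : ∀ i, MeasurableSet (ξ ⁻¹' {i})) : shannonEntropy μ ξ ≤ Real.log (Fintype.card ι) := by
  have h := sum_negMulLog_add_le_log_sum_exp (p := fun i => μ.real (ξ ⁻¹' {i})) (s := fun _ => 0)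
    (fun i => measureReal_nonneg) (sum_measureReal_fiber μ hξ)
  simpa [shannonEntropy] using h

/-- Concavity of the entropy in the measure. -/
theorem sum_shannonEntropy_le {J : Type*} {s : Finset J} {w : J → ℝ} (hw : ∀ j ∈ s, 0 ≤ w j)
    (hw1 : ∑ j ∈ s, w j = 1) {μ : J → Measure X} {ν : Measure X} {ξ : X → ι}
    (hν : ∀ i, ν.real (ξ ⁻¹' {i}) = ∑ j ∈ s, w j * (μ j).real (ξ ⁻¹' {i})) :
    ∑ j ∈ s, w j * shannonEntropy (μ j) ξ ≤ shannonEntropy ν ξ := by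
  unfold shannonEntropy
  simp_rw [Finset.mul_sum]
  rw [Finset.sum_comm]
  refine Finset.sum_le_sum fun i _ => ?_
  rw [hν]
  simpa using Real.concaveOn_negMulLog.le_map_sum hw hw1
    (p := fun j => (μ j).real (ξ ⁻¹' {i})) fun _ _ => measureReal_nonneg

theorem shannonEntropy_map (μ : Measure X) {f : X → X} (hf : Measurable f) {ξ : X → ι}
    (hξ : ∀ i, MeasurableSet (ξ ⁻¹' {i})) :
    shannonEntropy (μ.map f) ξ = shannonEntropy μ (fun x => ξ (f x)) := by
  unfold shannonEntropy
  refine Finset.sum_congr rfl fun i _ => ?_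
  rw [map_measureReal_apply hf (hξ i)]
  rfl

theorem shannonEntropy_comp_preserving {μ : Measure X} {f : X → X} (hf : MeasurePreserving f μ μ)
    {ξ : X → ι} (hξ : ∀ i, MeasurableSet (ξ ⁻¹' {i})) :
    shannonEntropy μ (fun x => ξ (f x)) = shannonEntropy μ ξ := by
  rw [← shannonEntropy_map μ hf.measurable hξ, hf.map_eq]

theorem itinerary_eq_iff {X ι : Type*} {f : X → X} {ξ : X → ι} {n : ℕ} {x y : X} :
    itinerary f ξ n x = itinerary f ξ n y ↔ ∀ k < n, ξ (f^[k] x) = ξ (f^[k] y) :=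
  ⟨fun h k hk => congr_fun h ⟨k, hk⟩, fun h => funext fun k => h k k.2⟩

theorem subadditive_entropy_itinerary {μ : Measure X} [IsProbabilityMeasure μ] {f : X → X}
    (hf : MeasurePreserving f μ μ) {ξ : X → ι} (hξ : ∀ i, MeasurableSet (ξ ⁻¹' {i})) :
    Subadditive fun n => shannonEntropy μ (itinerary f ξ n) := by
  intro a b
  beta_reduce
  have hm := fun n => measurableSet_itinerary_fiber hf.measurable hξ n
  have hmb : ∀ i, MeasurableSet ((fun x => itinerary f ξ b (f^[a] x)) ⁻¹' {i}) :=
    measurableSet_iterate_fiber hf.measurable (hm b) a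
  rw [← shannonEntropy_comp_preserving (hf.iterate a) (hm b)]
  refine le_trans ?_ (shannonEntropy_prodMk_le μ (hm a) hmb)
  refine shannonEntropy_le_of_factor μ (measurableSet_prodMk_fiber (hm a) hmb) fun x y hxy => ?_
  obtain ⟨h1, h2⟩ := Prod.mk.injEq .. ▸ hxy
  rw [itinerary_eq_iff] at h1 h2 ⊢
  intro k hk
  rcases lt_or_ge k a with h | h
  · exact h1 k h
  · have := h2 (k - a) (by omega)
    rwa [← Function.iterate_add_apply, ← Function.iterate_add_apply, Nat.sub_add_cancel h] at this

/-- Cutting an itinerary of length `n` into blocks of length `q`, with all `q` possible offsets. -/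
theorem mul_shannonEntropy_itinerary_le (σ : Measure X) [IsProbabilityMeasure σ] {f : X → X}
    (hf : Measurable f) {ξ : X → ι} (hξ : ∀ i, MeasurableSet (ξ ⁻¹' {i})) {q : ℕ} (hq : 0 < q)
    (n : ℕ) :
    q * shannonEntropy σ (itinerary f ξ n) ≤ q * (q * Real.log (Fintype.card ι)) +
      ∑ k ∈ Finset.range n, shannonEntropy σ (fun x => itinerary f ξ q (f^[k] x)) := by
  classical
  have hblock : ∀ a ∈ Finset.range q, shannonEntropy σ (itinerary f ξ n) ≤
      q * Real.log (Fintype.card ι) + ∑ k ∈ Finset.range n with k % q = a,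
        shannonEntropy σ (fun x => itinerary f ξ q (f^[k] x)) := by
    intro a ha
    rw [Finset.mem_range] at ha
    have hm1 : ∀ i, MeasurableSet (itinerary f ξ a ⁻¹' {i}) :=
      measurableSet_itinerary_fiber hf hξ a
    have hm2 : ∀ k i, MeasurableSet ((fun x => itinerary f ξ q (f^[k] x)) ⁻¹' {i}) :=
      measurableSet_iterate_fiber hf (measurableSet_itinerary_fiber hf hξ q)
    set T := (Finset.range n).filter fun k => k % q = a with hT
    have hm3 : ∀ i, MeasurableSet ((fun x (k : T) => itinerary f ξ q (f^[k] x)) ⁻¹' {i}) :=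
      measurableSet_pi_fiber fun k : T => hm2 k
    have h1 : shannonEntropy σ (itinerary f ξ a) ≤ q * Real.log (Fintype.card ι) := by
      refine (shannonEntropy_le_log_card σ hm1).trans ?_
      simp only [Fintype.card_pi_const, Nat.cast_pow, Real.log_pow]
      have : 0 ≤ Real.log (Fintype.card ι) := Real.log_natCast_nonneg _
      gcongr
    have h2 := shannonEntropy_le_sum σ T (ξ := fun k x => itinerary f ξ q (f^[k] x))
      (ζ := fun x (k : T) => itinerary f ξ q (f^[k] x)) (fun k _ => hm2 k)
      fun x y hxy => funext fun k => hxy k k.2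
    refine le_trans ?_ (add_le_add h1 h2)
    refine le_trans ?_ (shannonEntropy_prodMk_le σ hm1 hm3)
    refine shannonEntropy_le_of_factor σ (measurableSet_prodMk_fiber hm1 hm3) fun x y hxy => ?_
    obtain ⟨e1, e2⟩ := Prod.mk.injEq .. ▸ hxy
    rw [itinerary_eq_iff] at e1 ⊢
    intro k hk
    rcases lt_or_ge k a with h | h
    · exact e1 k h
    · -- `k` lies in the block that starts at the last time congruent to `a` not after `k`.
      have hmod : (k - a) % q < q := Nat.mod_lt _ hq
      have hle : (k - a) % q ≤ k - a := Nat.mod_le _ _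
      have hst : k - (k - a) % q ∈ T := by
        rw [hT, Finset.mem_filter, Finset.mem_range]
        refine ⟨by omega, ?_⟩
        have : k - (k - a) % q = a + q * ((k - a) / q) := by
          have := Nat.mod_add_div (k - a) q
          omega
        rw [this, Nat.add_mul_mod_self_left, Nat.mod_eq_of_lt ha]
      have := itinerary_eq_iff.1 (congr_fun e2 ⟨_, hst⟩) ((k - a) % q) hmod
      rw [← Function.iterate_add_apply, ← Function.iterate_add_apply] at this
      have e3 : (k - a) % q + (k - (k - a) % q) = k := by omega
      simpa only [e3] using this
  have h := Finset.sum_le_sum hblock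
  rw [Finset.sum_add_distrib, Finset.sum_const, Finset.sum_const, Finset.card_range, nsmul_eq_mul,
    nsmul_eq_mul] at h
  rwa [Finset.sum_fiberwise_of_maps_to (fun k _ => Finset.mem_range.2 (Nat.mod_lt k hq))] at h

end Shannon

/-! ### Invariant measures of large pressure -/

section Mixture

variable {X J : Type*} [MeasurableSpace X]

/-- The mixture of the measures `μ j` with real weights `w j`. -/
noncomputable def mixture (s : Finset J) (w : J → ℝ) (μ : J → Measure X) : Measure X :=
  ∑ j ∈ s, ENNReal.ofReal (w j) • μ j

variable {s : Finset J} {w : J → ℝ} {μ : J → Measure X}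

theorem isProbabilityMeasure_mixture (hw : ∀ j ∈ s, 0 ≤ w j) (hw1 : ∑ j ∈ s, w j = 1)
    [∀ j, IsProbabilityMeasure (μ j)] : IsProbabilityMeasure (mixture s w μ) := by
  constructor
  simp only [mixture, Measure.finsetSum_apply, Measure.smul_apply, measure_univ, smul_eq_mul,
    mul_one]
  rw [← ENNReal.ofReal_sum_of_nonneg hw, hw1, ENNReal.ofReal_one]

theorem mixture_real_apply (hw : ∀ j ∈ s, 0 ≤ w j) [∀ j, IsFiniteMeasure (μ j)] (A : Set X) :
    (mixture s w μ).real A = ∑ j ∈ s, w j * (μ j).real A := by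
  simp only [mixture, Measure.real, Measure.finsetSum_apply, Measure.smul_apply, smul_eq_mul]
  rw [ENNReal.toReal_sum fun j _ => ENNReal.mul_ne_top ENNReal.ofReal_ne_top (measure_ne_top _ _)]
  refine Finset.sum_congr rfl fun j hj => ?_
  rw [ENNReal.toReal_mul, ENNReal.toReal_ofReal (hw j hj)]

theorem integral_mixture (hw : ∀ j ∈ s, 0 ≤ w j) {g : X → ℝ} (hg : ∀ j, Integrable g (μ j)) :
    ∫ x, g x ∂(mixture s w μ) = ∑ j ∈ s, w j * ∫ x, g x ∂(μ j) := by
  rw [mixture, integral_finsetSum_measure fun j _ => (hg j).smul_measure ENNReal.ofReal_ne_top]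
  refine Finset.sum_congr rfl fun j hj => ?_
  rw [integral_smul_measure, ENNReal.toReal_ofReal (hw j hj), smul_eq_mul]

end Mixture

section NullFrontier

variable {X : Type*} [TopologicalSpace X] [MeasurableSpace X] {μ : Measure X}

theorem measure_frontier_inter_eq_zero {A A' : Set X} (h : μ (frontier A) = 0)
    (h' : μ (frontier A') = 0) : μ (frontier (A ∩ A')) = 0 :=
  measure_mono_null ((frontier_inter_subset A A').trans
    (Set.union_subset_union Set.inter_subset_left Set.inter_subset_right)) (measure_union_null h h')

theorem measure_frontier_biInter_eq_zero {J : Type*} (s : Finset J) {A : J → Set X}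
    (h : ∀ j ∈ s, μ (frontier (A j)) = 0) : μ (frontier (⋂ j ∈ s, A j)) = 0 := by
  classical
  induction s using Finset.induction_on with
  | empty => simp
  | insert a t _ ih =>
    rw [Finset.set_biInter_insert]
    exact measure_frontier_inter_eq_zero (h a (Finset.mem_insert_self a t))
      (ih fun j hj => h j (Finset.mem_insert_of_mem hj))

theorem measure_frontier_pi_fiber_eq_zero {J ι : Type*} [Fintype J] {ξ : J → X → ι}
    (h : ∀ j i, μ (frontier (ξ j ⁻¹' {i})) = 0) (i : J → ι) :
    μ (frontier ((fun x j => ξ j x) ⁻¹' {i})) = 0 := by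
  have : (fun x j => ξ j x) ⁻¹' {i} = ⋂ j ∈ Finset.univ, ξ j ⁻¹' {i j} := by
    ext x; simp [funext_iff]
  rw [this]
  exact measure_frontier_biInter_eq_zero _ fun j _ => h j (i j)

theorem measure_frontier_preimage_eq_zero [OpensMeasurableSpace X] {f : X → X} (hf : Continuous f)
    (hμ : MeasurePreserving f μ μ) {A : Set X} (h : μ (frontier A) = 0) :
    μ (frontier (f ⁻¹' A)) = 0 := by
  refine measure_mono_null (hf.frontier_preimage_subset A) ?_
  rwa [hμ.measure_preimage isClosed_frontier.measurableSet.nullMeasurableSet]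

end NullFrontier

section Misiurewicz

variable {X : Type*} [MetricSpace X] [CompactSpace X] [MeasurableSpace X] [BorelSpace X]

theorem integrable_of_continuous {μ : Measure X} [IsFiniteMeasure μ] {g : X → ℝ}
    (hg : Continuous g) : Integrable g μ :=
  hg.integrable_of_hasCompactSupport (HasCompactSupport.of_compactSpace g)

/-- A finite partition into sets of small diameter, with boundaries of measure zero. -/
theorem exists_partition_null_frontier (μ : Measure X) [IsFiniteMeasure μ] {δ : ℝ} (hδ : 0 < δ) :
    ∃ (m : ℕ) (ξ : X → Fin m), (∀ i, MeasurableSet (ξ ⁻¹' {i})) ∧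
      (∀ i, μ (frontier (ξ ⁻¹' {i})) = 0) ∧ ∀ x y, ξ x = ξ y → dist x y ≤ δ := by
  classical
  have h : ∀ x : X, ∃ r ∈ Set.Ioo 0 (δ / 2), μ (frontier (Metric.ball x r)) = 0 := fun x => by
    obtain ⟨r, hr, h⟩ := exists_null_frontier_thickening μ {x} (half_pos hδ)
    exact ⟨r, hr, by rwa [Metric.thickening_singleton] at h⟩
  choose r hr hfr using h
  obtain ⟨t, ht⟩ := isCompact_univ.elim_finite_subcover (fun x => Metric.ball x (r x))
    (fun x => Metric.isOpen_ball)
    (fun x _ => Set.mem_iUnion.2 ⟨x, Metric.mem_ball_self (hr x).1⟩)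
  -- Label a point by the set of balls that contain it.
  let b : t → X → Bool := fun c x => decide (x ∈ Metric.ball (c : X) (r c))
  have hb : ∀ c i, b c ⁻¹' {i} = Metric.ball (c : X) (r c) ∨
      b c ⁻¹' {i} = (Metric.ball (c : X) (r c))ᶜ := by
    intro c i
    cases i
    · right; ext x; simp [b]
    · left; ext x; simp [b]
  have hpre : ∀ i, (fun x => Fintype.equivFin (t → Bool) (fun c => b c x)) ⁻¹' {i} =
      (fun x c => b c x) ⁻¹' {(Fintype.equivFin (t → Bool)).symm i} := by
    intro i
    ext x
    simp [Equiv.eq_symm_apply]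
  refine ⟨Fintype.card (t → Bool), fun x => Fintype.equivFin (t → Bool) (fun c => b c x),
    fun i => ?_, fun i => ?_, fun x y hxy => ?_⟩
  · rw [hpre]
    refine measurableSet_pi_fiber (fun c i => ?_) _
    rcases hb c i with h | h <;> rw [h]
    · exact measurableSet_ball
    · exact measurableSet_ball.compl
  · rw [hpre]
    refine measure_frontier_pi_fiber_eq_zero (fun c i => ?_) _
    rcases hb c i with h | h <;> rw [h]
    · exact hfr c
    · rw [frontier_compl]; exact hfr c
  · have hxy' := (Fintype.equivFin (t → Bool)).injective hxy
    obtain ⟨c, hct, hxc⟩ := Set.mem_iUnion₂.1 (ht (Set.mem_univ x))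
    have h1 := congr_fun hxy' ⟨c, hct⟩
    simp only [b, decide_eq_decide] at h1
    have hyc := h1.1 hxc
    have := (hr c).2
    rw [Metric.mem_ball] at hxc hyc
    linarith [dist_triangle_right x y c]

/-- **Misiurewicz's construction**: a limit of averages along orbits of measures on separated sets
is an invariant measure, and its pressure with respect to a partition finer than the separation
scale, with boundaries of measure zero, is not smaller than the growth rate of the weights. -/
theorem exists_invariant_measure_of_lt_pressureAt {f : X → X} (hf : Continuous f) {φ : X → ℝ}
    (hφ : Continuous φ) {δ β : ℝ} (hδ : 0 < δ) (hβ : β < pressureAt f φ Set.univ δ 0) :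
    ∃ μ : Measure X, IsProbabilityMeasure μ ∧ MeasurePreserving f μ μ ∧
      ∃ (m : ℕ) (ξ : X → Fin m), (∀ i, MeasurableSet (ξ ⁻¹' {i})) ∧
        ∀ q : ℕ, 0 < q → q * β ≤ shannonEntropy μ (itinerary f ξ q) + q * ∫ x, φ x ∂μ := by
  classical
  have hcont : ∀ n : ℕ, Continuous (birkhoffSum f φ n) := fun n =>
    continuous_finsetSum _ fun k _ => hφ.comp (hf.iterate k)
  choose n hn E _ hE hEβ using fun j : ℕ => (frequently_atTop.1 (frequently_exists_expSum_gt hβ))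
    (j + 1)
  have hn0 : ∀ j, (0 : ℝ) < n j := fun j => by
    have := hn j
    exact_mod_cast (by omega : 0 < n j)
  set Z : ℕ → ℝ := fun j => expSum f φ (n j) (E j) with hZ
  have hZ0 : ∀ j, 0 < Z j := fun j => (Real.exp_pos _).trans (hEβ j)
  set w : ℕ → X → ℝ := fun j x => Real.exp (birkhoffSum f φ (n j) x) / Z j with hw
  have hw0 : ∀ j, ∀ x ∈ E j, 0 ≤ w j x := fun j x _ => div_nonneg (Real.exp_pos _).le (hZ0 j).le
  have hw1 : ∀ j, ∑ x ∈ E j, w j x = 1 := fun j => by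
    rw [← Finset.sum_div, ← expSum, div_self (hZ0 j).ne']
  let σ : ℕ → Measure X := fun j => mixture (E j) (w j) Measure.dirac
  have hσ : ∀ j, IsProbabilityMeasure (σ j) := fun j =>
    isProbabilityMeasure_mixture (hw0 j) (hw1 j)
  have hmap : ∀ j k, IsProbabilityMeasure ((σ j).map f^[k]) := fun j k =>
    Measure.isProbabilityMeasure_map (hf.iterate k).measurable.aemeasurable
  have hv0 : ∀ j, ∀ k ∈ Finset.range (n j), (0 : ℝ) ≤ (n j : ℝ)⁻¹ := fun j _ _ =>
    inv_nonneg.2 (hn0 j).le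
  have hv1 : ∀ j, ∑ k ∈ Finset.range (n j), (n j : ℝ)⁻¹ = 1 := fun j => by
    have := (hn0 j).ne'
    simp [this]
  let μ : ℕ → Measure X := fun j =>
    mixture (Finset.range (n j)) (fun _ => (n j : ℝ)⁻¹) fun k => (σ j).map f^[k]
  have hμ : ∀ j, IsProbabilityMeasure (μ j) := fun j =>
    isProbabilityMeasure_mixture (hv0 j) (hv1 j)
  have hμint : ∀ j, ∀ g : X → ℝ, Continuous g → ∫ x, g x ∂(μ j) =
      (n j : ℝ)⁻¹ * ∑ k ∈ Finset.range (n j), ∫ x, g (f^[k] x) ∂(σ j) := by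
    intro j g hg
    rw [integral_mixture (hv0 j) fun k => integrable_of_continuous hg, Finset.mul_sum]
    refine Finset.sum_congr rfl fun k _ => ?_
    rw [integral_map (hf.iterate k).measurable.aemeasurable hg.aestronglyMeasurable]
  -- A limit point along an ultrafilter.
  let U : Ultrafilter ℕ := Ultrafilter.of atTop
  have hU : (U : Filter ℕ) ≤ atTop := Ultrafilter.of_le _
  let P : ℕ → ProbabilityMeasure X := fun j => ⟨μ j, hμ j⟩
  obtain ⟨ν, hν⟩ : ∃ ν : ProbabilityMeasure X, Tendsto P U (𝓝 ν) :=
    ⟨_, (U.map P).le_nhds_lim⟩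
  have hnlim : Tendsto (fun j => (n j : ℝ)⁻¹) U (𝓝 0) := by
    refine Tendsto.mono_left ?_ hU
    refine tendsto_inv_atTop_zero.comp (tendsto_natCast_atTop_atTop.comp ?_)
    exact tendsto_atTop_mono (fun j => (Nat.le_succ j).trans (hn j)) tendsto_id
  have hνint : ∀ g : X → ℝ, Continuous g →
      Tendsto (fun j => ∫ x, g x ∂(μ j)) U (𝓝 (∫ x, g x ∂(ν : Measure X))) := fun g hg =>
    ProbabilityMeasure.tendsto_iff_forall_integral_tendsto.1 hν
      (BoundedContinuousFunction.mkOfCompact ⟨g, hg⟩)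
  have hinv : MeasurePreserving f (ν : Measure X) ν := by
    refine ⟨hf.measurable, ?_⟩
    have : IsProbabilityMeasure ((ν : Measure X).map f) :=
      Measure.isProbabilityMeasure_map hf.measurable.aemeasurable
    refine ext_of_forall_integral_eq_of_IsFiniteMeasure fun g => ?_
    rw [integral_map hf.measurable.aemeasurable g.continuous.aestronglyMeasurable]
    have h1 := (hνint _ (g.continuous.comp hf)).sub (hνint _ g.continuous)
    -- The two averages differ by two terms only.
    have h2 : ∀ j, |∫ x, g (f x) ∂(μ j) - ∫ x, g x ∂(μ j)| ≤ (n j : ℝ)⁻¹ * (2 * ‖g‖) := by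
      intro j
      rw [hμint j (fun x => g (f x)) (g.continuous.comp hf), hμint j _ g.continuous, ← mul_sub,
        ← Finset.sum_sub_distrib, abs_mul, abs_of_pos (inv_pos.2 (hn0 j))]
      simp_rw [← Function.iterate_succ_apply']
      rw [Finset.sum_range_sub fun k => ∫ x, g (f^[k] x) ∂(σ j)]
      have hbd : ∀ k, |∫ x, g (f^[k] x) ∂(σ j)| ≤ ‖g‖ := fun k => by
        have := norm_integral_le_of_norm_le_const (μ := σ j)
          (Eventually.of_forall fun x => g.norm_coe_le_norm (f^[k] x))
        simpa using this
      gcongr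
      refine (abs_sub _ _).trans ?_
      linarith [hbd (n j), hbd 0]
    have h3 : Tendsto (fun j => (n j : ℝ)⁻¹ * (2 * ‖g‖)) U (𝓝 0) := by
      simpa using hnlim.mul_const (2 * ‖g‖)
    have h4 := squeeze_zero_norm (f := fun j => ∫ x, g (f x) ∂(μ j) - ∫ x, g x ∂(μ j)) h2 h3
    exact sub_eq_zero.1 (tendsto_nhds_unique h1 h4)
  obtain ⟨m, ξ, hξm, hξf, hξd⟩ := exists_partition_null_frontier (ν : Measure X) hδ
  refine ⟨ν, inferInstance, hinv, m, ξ, hξm, fun q hq => ?_⟩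
  have hq0 : (0 : ℝ) < q := by exact_mod_cast hq
  have hcell := measurableSet_itinerary_fiber hf.measurable hξm
  -- The measures on the separated sets realize the growth rate.
  have hlow : ∀ j, n j * β ≤ shannonEntropy (σ j) (itinerary f ξ (n j)) +
      ∫ x, birkhoffSum f φ (n j) x ∂(σ j) := by
    intro j
    have hinj : Set.InjOn (itinerary f ξ (n j)) (E j) := fun x hx y hy hxy => by
      by_contra hne
      obtain ⟨k, hk, hd⟩ := hE j x hx y hy hne
      exact absurd (hξd _ _ (itinerary_eq_iff.1 hxy k hk)) (not_le.2 hd)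
    have h1 : ∀ x ∈ E j, (σ j).real (itinerary f ξ (n j) ⁻¹' {itinerary f ξ (n j) x}) =
        w j x := by
      intro x hx
      rw [mixture_real_apply (hw0 j), Finset.sum_eq_single x]
      · simp [Measure.real, hcell]
      · intro y hy hyx
        have : itinerary f ξ (n j) y ≠ itinerary f ξ (n j) x := fun h => hyx (hinj hy hx h)
        simp [Measure.real, hcell, this]
      · exact fun h => absurd hx h
    have h2 : ∑ x ∈ E j, Real.negMulLog (w j x) ≤
        shannonEntropy (σ j) (itinerary f ξ (n j)) := by
      calc ∑ x ∈ E j, Real.negMulLog (w j x)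
          = ∑ x ∈ E j, Real.negMulLog
              ((σ j).real (itinerary f ξ (n j) ⁻¹' {itinerary f ξ (n j) x})) :=
            Finset.sum_congr rfl fun x hx => by rw [h1 x hx]
        _ = ∑ i ∈ (E j).image (itinerary f ξ (n j)), Real.negMulLog
              ((σ j).real (itinerary f ξ (n j) ⁻¹' {i})) :=
            (Finset.sum_image (f := fun i => Real.negMulLog
              ((σ j).real (itinerary f ξ (n j) ⁻¹' {i}))) hinj).symm
        _ ≤ _ := Finset.sum_le_univ_sum_of_nonneg fun i =>
            Real.negMulLog_nonneg measureReal_nonneg measureReal_le_one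
    have h3 : ∫ x, birkhoffSum f φ (n j) x ∂(σ j) =
        ∑ x ∈ E j, w j x * birkhoffSum f φ (n j) x := by
      rw [integral_mixture (hw0 j) fun x => integrable_of_continuous (hcont _)]
      simp
    have h4 : ∑ x ∈ E j, Real.negMulLog (w j x) + ∑ x ∈ E j, w j x * birkhoffSum f φ (n j) x =
        Real.log (Z j) := by
      rw [← Finset.sum_add_distrib]
      calc _ = ∑ x ∈ E j, w j x * Real.log (Z j) := by
            refine Finset.sum_congr rfl fun x hx => ?_
            rw [Real.negMulLog]
            simp only [hw]
            rw [Real.log_div (Real.exp_pos _).ne' (hZ0 j).ne', Real.log_exp]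
            ring
        _ = _ := by rw [← Finset.sum_mul, hw1, one_mul]
    have h5 : n j * β ≤ Real.log (Z j) := by
      rw [Real.le_log_iff_exp_le (hZ0 j)]; exact (hEβ j).le
    linarith
  have hφint : ∀ j, ∫ x, birkhoffSum f φ (n j) x ∂(σ j) = n j * ∫ x, φ x ∂(μ j) := by
    intro j
    rw [hμint j φ hφ, mul_inv_cancel_left₀ (hn0 j).ne']
    simp only [birkhoffSum]
    rw [integral_finsetSum]
    exact fun k _ => integrable_of_continuous (hφ.comp (hf.iterate k))
  have hconc : ∀ j, ∑ k ∈ Finset.range (n j),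
      shannonEntropy (σ j) (fun x => itinerary f ξ q (f^[k] x)) ≤
        n j * shannonEntropy (μ j) (itinerary f ξ q) := by
    intro j
    have h1 := sum_shannonEntropy_le (hv0 j) (hv1 j) (ν := μ j)
      (μ := fun k => (σ j).map f^[k]) (ξ := itinerary f ξ q)
      fun i => mixture_real_apply (hv0 j) _
    rw [← Finset.mul_sum, inv_mul_le_iff₀ (hn0 j)] at h1
    refine le_trans (le_of_eq (Finset.sum_congr rfl fun k _ => ?_)) h1
    rw [shannonEntropy_map _ (hf.iterate k).measurable (hcell q)]
  have hmain : ∀ j, q * β ≤ (n j : ℝ)⁻¹ * (q * (q * Real.log m)) +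
      shannonEntropy (μ j) (itinerary f ξ q) + q * ∫ x, φ x ∂(μ j) := by
    intro j
    have h1 := mul_shannonEntropy_itinerary_le (σ j) hf.measurable hξm hq (n j)
    have h2 := mul_le_mul_of_nonneg_left (hlow j) hq0.le
    have h3 := hconc j
    rw [hφint j] at h2
    rw [Fintype.card_fin] at h1
    have h4 : (n j : ℝ) * (q * β) ≤ n j * ((n j : ℝ)⁻¹ * (q * (q * Real.log m)) +
        shannonEntropy (μ j) (itinerary f ξ q) + q * ∫ x, φ x ∂(μ j)) := by
      rw [mul_add, mul_add, mul_inv_cancel_left₀ (hn0 j).ne']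
      linarith
    exact le_of_mul_le_mul_left h4 (hn0 j)
  have hHlim : Tendsto (fun j => shannonEntropy (μ j) (itinerary f ξ q)) U
      (𝓝 (shannonEntropy (ν : Measure X) (itinerary f ξ q))) := by
    refine tendsto_finsetSum _ fun i _ => (Real.continuous_negMulLog.tendsto _).comp ?_
    have hfr : (ν : Measure X) (frontier (itinerary f ξ q ⁻¹' {i})) = 0 :=
      measure_frontier_pi_fiber_eq_zero (ξ := fun (k : Fin q) x => ξ (f^[k] x)) (fun k i =>
        measure_frontier_preimage_eq_zero (hf.iterate k) (hinv.iterate k) (hξf i)) i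
    exact (ENNReal.tendsto_toReal (measure_ne_top _ _)).comp
      (ProbabilityMeasure.tendsto_measure_of_null_frontier_of_tendsto' hν hfr)
  have hlim := ((hnlim.mul_const (q * (q * Real.log m))).add hHlim).add
    ((hνint φ hφ).const_mul (q : ℝ))
  rw [zero_mul, zero_add] at hlim
  exact ge_of_tendsto' hlim hmain

end Misiurewicz

/-! ### Ergodic decomposition -/

section Decomposition

open ProbabilityTheory

variable {X : Type*} {m : MeasurableSpace X} [mX : MeasurableSpace X]

theorem measurable_birkhoffAverage_indicator {T : X → X} (hT : Measurable T) {C : Set X}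
    (hC : MeasurableSet C) (n : ℕ) :
    Measurable (birkhoffAverage ℝ T (C.indicator fun _ => (1 : ℝ)) n) := by
  have h : Measurable fun x => ∑ i ∈ Finset.range n, C.indicator (fun _ => (1 : ℝ)) (T^[i] x) :=
    Finset.measurable_fun_sum _ fun i _ => (measurable_const.indicator hC).comp (hT.iterate i)
  exact h.const_smul ((n : ℝ)⁻¹)

/-- Along a subsequence, the averages of an indicator function converge almost everywhere: the mean
ergodic theorem in `L²`. -/
theorem exists_subseq_tendsto_birkhoffAverage {μ : Measure X} [IsProbabilityMeasure μ] {T : X → X}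
    (hT : MeasurePreserving T μ μ) {C : Set X} (hC : MeasurableSet C) :
    ∃ ns : ℕ → ℕ, StrictMono ns ∧ ∀ᵐ x ∂μ, ∃ a, Tendsto (fun k =>
      birkhoffAverage ℝ T (C.indicator fun _ => (1 : ℝ)) (ns k) x) atTop (𝓝 a) := by
  obtain ⟨U, hU, hUT⟩ : ∃ U : Lp ℝ 2 μ →L[ℝ] Lp ℝ 2 μ, ‖U‖ ≤ 1 ∧
      ∀ v, (U v : X → ℝ) =ᵐ[μ] v ∘ T :=
    ⟨(Lp.compMeasurePreservingₗᵢ ℝ T hT).toContinuousLinearMap,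
      LinearIsometry.norm_toContinuousLinearMap_le _,
      fun v => Lp.coeFn_compMeasurePreserving v hT⟩
  obtain ⟨v, hv⟩ : ∃ v : Lp ℝ 2 μ, (v : X → ℝ) =ᵐ[μ] C.indicator fun _ => (1 : ℝ) :=
    ⟨_, indicatorConstLp_coeFn (hs := hC) (hμs := measure_ne_top μ C)⟩
  have hlim := U.tendsto_birkhoffAverage_orthogonalProjection hU v
  have hiter : ∀ k : ℕ, (U^[k] v : X → ℝ) =ᵐ[μ]
      fun x => C.indicator (fun _ => (1 : ℝ)) (T^[k] x) := by
    intro k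
    induction k with
    | zero => exact hv
    | succ k ih =>
      rw [Function.iterate_succ_apply']
      refine (hUT (U^[k] v)).trans ?_
      filter_upwards [hT.quasiMeasurePreserving.ae ih] with x hx
      rw [Function.comp_apply, hx, Function.iterate_succ_apply]
  have hsum : ∀ n : ℕ, ((birkhoffSum U _root_.id n v : Lp ℝ 2 μ) : X → ℝ) =ᵐ[μ]
      birkhoffSum T (C.indicator fun _ => (1 : ℝ)) n := by
    intro n
    induction n with
    | zero => simpa [birkhoffSum_zero'] using Lp.coeFn_zero ℝ 2 μ
    | succ n ih =>
      rw [birkhoffSum_succ]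
      filter_upwards [Lp.coeFn_add (birkhoffSum U _root_.id n v) (_root_.id (U^[n] v)), ih,
        hiter n] with x h1 h2 h3
      rw [h1, Pi.add_apply, h2, birkhoffSum_succ, ← h3]
      rfl
  have havg : ∀ n : ℕ, ((birkhoffAverage ℝ U _root_.id n v : Lp ℝ 2 μ) : X → ℝ) =ᵐ[μ]
      birkhoffAverage ℝ T (C.indicator fun _ => (1 : ℝ)) n := by
    intro n
    filter_upwards [Lp.coeFn_smul ((n : ℝ)⁻¹) (birkhoffSum U _root_.id n v), hsum n] with x h1 h2
    rw [birkhoffAverage, h1, Pi.smul_apply, h2, birkhoffAverage]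
  obtain ⟨ns, hns, hae⟩ := (tendstoInMeasure_of_tendsto_Lp hlim).exists_seq_tendsto_ae
  refine ⟨ns, hns, ?_⟩
  filter_upwards [hae, ae_all_iff.2 havg] with x h1 h2
  exact ⟨_, h1.congr fun k => h2 (ns k)⟩

variable [StandardBorelSpace X] {μ : Measure X} [IsProbabilityMeasure μ]

/-- A function measurable with respect to `m` is almost surely constant for the conditional
measures given `m`. -/
theorem ae_condExpKernel_eq (hm : m ≤ mX) {g : X → ℝ}
    (hg : Measurable[m] g) : ∀ᵐ x ∂μ, ∀ᵐ y ∂(condExpKernel μ m x), g y = g x := by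
  have hL : ∀ q : ℚ, MeasurableSet[m] {x | g x ≤ q} := fun q => hg measurableSet_Iic
  have h1 : ∀ q : ℚ, ∀ᵐ x ∂μ, (condExpKernel μ m x).real {x | g x ≤ q} =
      {x | g x ≤ q}.indicator (fun _ => (1 : ℝ)) x := by
    intro q
    have h2 := condExpKernel_ae_eq_condExp (μ := μ) hm (hm _ (hL q))
    rw [condExp_of_stronglyMeasurable hm (stronglyMeasurable_const.indicator (hL q))
      ((integrable_const 1).indicator (hm _ (hL q)))] at h2
    exact h2
  filter_upwards [ae_all_iff.2 h1] with x hx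
  have h2 : ∀ q : ℚ, ∀ᵐ y ∂(condExpKernel μ m x), g y ≤ q ↔ g x ≤ q := by
    intro q
    have hq := hx q
    by_cases hxq : g x ≤ q
    · rw [Set.indicator_of_mem (by exact hxq)] at hq
      have : (condExpKernel μ m x) {x | g x ≤ q}ᶜ = 0 := by
        rw [← measureReal_eq_zero_iff, probReal_compl_eq_one_sub (hm _ (hL q)), hq, sub_self]
      filter_upwards [compl_mem_ae_iff.2 this] with y hy
      simp only [compl_compl] at hy
      exact ⟨fun _ => hxq, fun _ => hy⟩
    · rw [Set.indicator_of_notMem (by exact hxq), measureReal_eq_zero_iff] at hq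
      filter_upwards [compl_mem_ae_iff.2 hq] with y hy
      exact ⟨fun h => absurd h hy, fun h => absurd h hxq⟩
  filter_upwards [ae_all_iff.2 h2] with y hy
  refine le_antisymm ?_ ?_
  · by_contra h
    obtain ⟨q, hq1, hq2⟩ := exists_rat_btwn (not_le.1 h)
    exact absurd ((hy q).2 hq1.le) (not_le.2 hq2)
  · by_contra h
    obtain ⟨q, hq1, hq2⟩ := exists_rat_btwn (not_le.1 h)
    exact absurd ((hy q).1 hq1.le) (not_le.2 hq2)

theorem setIntegral_condExpKernel_real (hm : m ≤ mX) {A B : Set X}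
    (hA : MeasurableSet A) (hB : MeasurableSet[m] B) :
    ∫ x in B, (condExpKernel μ m x).real A ∂μ = μ.real (B ∩ A) := by
  rw [setIntegral_congr_ae (hm _ hB) ((condExpKernel_ae_eq_condExp (μ := μ) hm hA).mono
    fun x hx _ => hx), setIntegral_condExp hm ((integrable_const 1).indicator hA) hB,
    integral_indicator_const _ hA, measureReal_restrict_apply hA]
  simp [Set.inter_comm]

theorem integral_integral_condExpKernel (hm : m ≤ mX) {g : X → ℝ}
    (hg : Integrable g μ) : ∫ x, ∫ y, g y ∂(condExpKernel μ m x) ∂μ = ∫ x, g x ∂μ := by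
  rw [← integral_congr_ae (condExp_ae_eq_integral_condExpKernel hm hg), integral_condExp hm]

/-- A countable `π`-system that generates the σ-algebra. -/
theorem exists_countable_isPiSystem (X : Type*) [mX : MeasurableSpace X]
    [MeasurableSpace.CountablyGenerated X] :
    ∃ 𝒞 : Set (Set X), 𝒞.Countable ∧ IsPiSystem 𝒞 ∧ mX = MeasurableSpace.generateFrom 𝒞 ∧
      ∀ C ∈ 𝒞, MeasurableSet C := by
  have hgen : mX = MeasurableSpace.generateFrom
      (generateSetAlgebra (MeasurableSpace.countableGeneratingSet X)) := by
    rw [generateFrom_generateSetAlgebra_eq, MeasurableSpace.generateFrom_countableGeneratingSet]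
  refine ⟨_, countable_generateSetAlgebra (MeasurableSpace.countable_countableGeneratingSet),
    fun s hs t ht _ => isSetAlgebra_generateSetAlgebra.inter_mem hs ht, hgen, fun C hC => ?_⟩
  rw [hgen]
  exact MeasurableSpace.measurableSet_generateFrom hC

variable {T : X → X}

/-- The conditional measures given the invariant σ-algebra are invariant. -/
theorem ae_measurePreserving_condExpKernel (hT : MeasurePreserving T μ μ) :
    ∀ᵐ x ∂μ, MeasurePreserving T (condExpKernel μ (MeasurableSpace.invariants T) x)
      (condExpKernel μ (MeasurableSpace.invariants T) x) := by
  have hm : MeasurableSpace.invariants T ≤ mX := MeasurableSpace.invariants_le T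
  obtain ⟨𝒞, hcount, hpi, hgen, hmeas⟩ := exists_countable_isPiSystem X
  have h1 : ∀ C ∈ 𝒞, ∀ᵐ x ∂μ, (condExpKernel μ (MeasurableSpace.invariants T) x).real (T ⁻¹' C) =
      (condExpKernel μ (MeasurableSpace.invariants T) x).real C := by
    intro C hC
    have hC' := hmeas C hC
    refine EventuallyEq.trans ?_ (condExpKernel_ae_eq_condExp (μ := μ) hm hC').symm
    refine ae_eq_condExp_of_forall_setIntegral_eq hm ((integrable_const 1).indicator hC')
      (fun s _ _ => (integrable_toReal_condExpKernel (hT.measurable hC')).integrableOn) ?_ ?_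
    · intro s hs _
      rw [setIntegral_condExpKernel_real hm (hT.measurable hC') hs,
        integral_indicator_const _ hC', measureReal_restrict_apply hC']
      have h2 : s ∩ T ⁻¹' C = T ⁻¹' (s ∩ C) := by rw [Set.preimage_inter, hs.2]
      rw [h2, hT.measureReal_preimage ((hs.1.inter hC').nullMeasurableSet), Set.inter_comm]
      simp
    · exact (measurable_condExpKernel (hT.measurable hC')).ennreal_toReal.stronglyMeasurable
        |>.aestronglyMeasurable
  filter_upwards [(ae_ball_iff hcount).2 h1] with x hx
  refine ⟨hT.measurable, ?_⟩
  have : IsProbabilityMeasure ((condExpKernel μ (MeasurableSpace.invariants T) x).map T) :=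
    Measure.isProbabilityMeasure_map hT.measurable.aemeasurable
  refine ext_of_generate_finite 𝒞 hgen hpi (fun C hC => ?_) (by simp)
  rw [Measure.map_apply hT.measurable (hmeas C hC)]
  exact (measureReal_eq_measureReal_iff).1 (hx C hC)

/-- The conditional measures given the invariant σ-algebra are ergodic: almost surely, averages of
indicator functions of sets in a countable generating system converge to constants, so that
invariant sets are independent of all these sets, hence of themselves. -/
theorem ae_ergodic_condExpKernel (hT : MeasurePreserving T μ μ) :
    ∀ᵐ x ∂μ, Ergodic T (condExpKernel μ (MeasurableSpace.invariants T) x) := by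
  classical
  have hm : MeasurableSpace.invariants T ≤ mX := MeasurableSpace.invariants_le T
  obtain ⟨𝒞, hcount, hpi, hgen, hmeas⟩ := exists_countable_isPiSystem X
  have h1 : ∀ C ∈ 𝒞, ∃ ns : ℕ → ℕ, StrictMono ns ∧ ∀ᵐ x ∂μ, ∃ a : ℝ,
      ∀ᵐ y ∂(condExpKernel μ (MeasurableSpace.invariants T) x), Tendsto (fun k =>
        birkhoffAverage ℝ T (C.indicator fun _ => (1 : ℝ)) (ns k) y) atTop (𝓝 a) := by
    intro C hC
    obtain ⟨ns, hns, hae⟩ := exists_subseq_tendsto_birkhoffAverage hT (hmeas C hC)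
    refine ⟨ns, hns, ?_⟩
    set F : ℕ → X → ℝ := fun k =>
      birkhoffAverage ℝ T (C.indicator fun _ => (1 : ℝ)) (ns k) with hF
    have hFm : ∀ k, Measurable (F k) := fun k =>
      measurable_birkhoffAverage_indicator hT.measurable (hmeas C hC) _
    set D : Set X := {x | ∃ a, Tendsto (fun k => F k x) atTop (𝓝 a)} with hD
    have hDm : MeasurableSet D := measurableSet_exists_tendsto hFm
    set g : X → ℝ := fun x => if x ∈ D then limsup (fun k => F k x) atTop else 0 with hg
    have hgm : Measurable g :=
      Measurable.ite hDm (Measurable.limsup hFm) measurable_const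
    -- The limit is strictly invariant.
    have hdiff : ∀ x, Tendsto (fun k => F k (T x) - F k x) atTop (𝓝 0) := fun x => by
      refine (tendsto_birkhoffAverage_apply_sub_birkhoffAverage ℝ ?_).comp hns.tendsto_atTop
      refine (Metric.isBounded_Icc (0 : ℝ) 1).subset ?_
      rintro _ ⟨k, rfl⟩
      by_cases h : T^[k] x ∈ C <;> simp [h]
    have hTx : ∀ x a, Tendsto (fun k => F k (T x)) atTop (𝓝 a) ↔
        Tendsto (fun k => F k x) atTop (𝓝 a) := by
      intro x a
      constructor <;> intro h
      · simpa using h.sub (hdiff x)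
      · simpa using h.add (hdiff x)
    have hgT : ∀ x, g (T x) = g x := by
      intro x
      have hDx : T x ∈ D ↔ x ∈ D := exists_congr fun a => hTx x a
      by_cases hx : x ∈ D
      · obtain ⟨a, ha⟩ := hx
        have h1 : T x ∈ D := ⟨a, (hTx x a).2 ha⟩
        have h2 : x ∈ D := ⟨a, ha⟩
        simp only [hg, h1, h2, if_true]
        rw [ha.limsup_eq, ((hTx x a).2 ha).limsup_eq]
      · simp only [hg, hDx, hx, if_false]
    have hgI : Measurable[MeasurableSpace.invariants T] g :=
      MeasurableSpace.measurable_invariants_dom.2 ⟨hgm, fun s _ => by ext x; simp [hgT]⟩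
    have hDI : ∀ᵐ x ∂μ, ∀ᵐ y ∂(condExpKernel μ (MeasurableSpace.invariants T) x), y ∈ D := by
      have h2 : ∫ x, (condExpKernel μ (MeasurableSpace.invariants T) x).real Dᶜ ∂μ = 0 := by
        have := setIntegral_condExpKernel_real (μ := μ) hm hDm.compl MeasurableSet.univ
        rw [setIntegral_univ, Set.univ_inter] at this
        rw [this, measureReal_eq_zero_iff]
        exact hae
      rw [integral_eq_zero_iff_of_nonneg (fun x => measureReal_nonneg)
        (integrable_toReal_condExpKernel hDm.compl)] at h2
      filter_upwards [h2] with x hx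
      exact (measureReal_eq_zero_iff).1 hx
    filter_upwards [hDI, ae_condExpKernel_eq (μ := μ) hm hgI] with x hx1 hx2
    refine ⟨g x, ?_⟩
    filter_upwards [hx1, hx2] with y hy1 hy2
    rw [← hy2]
    simp only [hg, hy1, if_true]
    obtain ⟨a, ha⟩ := hy1
    rw [ha.limsup_eq]
    exact ha
  choose! ns hns hlim using h1
  filter_upwards [(ae_ball_iff hcount).2 hlim, ae_measurePreserving_condExpKernel hT] with x hx hinv
  set ν := condExpKernel μ (MeasurableSpace.invariants T) x with hν
  refine ⟨hinv, ⟨fun B hB hTB => ?_⟩⟩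
  have hBk : ∀ k : ℕ, T^[k] ⁻¹' B = B := fun k => by
    induction k with
    | zero => rfl
    | succ k ih => rw [Function.iterate_succ, Set.preimage_comp, ih, hTB]
  -- An invariant set is independent of each set of the generating system.
  have hind : ∀ C ∈ 𝒞, ν.real (B ∩ C) = ν.real B * ν.real C := by
    intro C hC
    obtain ⟨a, ha⟩ := hx C hC
    have key : ∀ B' : Set X, MeasurableSet B' → (∀ k : ℕ, T^[k] ⁻¹' B' = B') →
        ν.real (B' ∩ C) = ν.real B' * a := by
      intro B' hB' hTB'
      have hterm : ∀ k : ℕ, ∫ y in B', C.indicator (fun _ => (1 : ℝ)) (T^[k] y) ∂ν =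
          ν.real (B' ∩ C) := by
        intro k
        have e1 : (fun y => C.indicator (fun _ => (1 : ℝ)) (T^[k] y)) =
            (T^[k] ⁻¹' C).indicator fun _ => 1 := by ext y; simp [Set.indicator]
        have hCk : MeasurableSet (T^[k] ⁻¹' C) := (hT.measurable.iterate k) (hmeas C hC)
        rw [e1, integral_indicator_const _ hCk, measureReal_restrict_apply hCk]
        have e2 : T^[k] ⁻¹' C ∩ B' = T^[k] ⁻¹' (B' ∩ C) := by
          rw [Set.preimage_inter, hTB', Set.inter_comm]
        rw [e2, (hinv.iterate k).measureReal_preimage (hB'.inter (hmeas C hC)).nullMeasurableSet]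
        simp
      have havg : ∀ n : ℕ, 0 < n →
          ∫ y in B', birkhoffAverage ℝ T (C.indicator fun _ => (1 : ℝ)) n y ∂ν =
            ν.real (B' ∩ C) := by
        intro n hn
        simp only [birkhoffAverage, birkhoffSum, smul_eq_mul]
        rw [integral_const_mul, integral_finsetSum]
        · simp_rw [hterm]
          have : (n : ℝ) ≠ 0 := by exact_mod_cast hn.ne'
          simp [this]
        · intro k _
          refine Integrable.of_bound (C := 1) ?_ (Eventually.of_forall fun y => ?_)
          · exact ((measurable_const.indicator (hmeas C hC)).comp
              (hT.measurable.iterate k)).aestronglyMeasurable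
          · by_cases h : T^[k] y ∈ C <;> simp [h]
      have hDCT : Tendsto (fun k => ∫ y in B',
          birkhoffAverage ℝ T (C.indicator fun _ => (1 : ℝ)) (ns C k) y ∂ν) atTop
          (𝓝 (∫ _ in B', a ∂ν)) := by
        refine tendsto_integral_of_dominated_convergence (fun _ => 1) (fun k => ?_)
          (integrable_const _) (fun k => Eventually.of_forall fun y => ?_)
          (ae_restrict_of_ae ha)
        · exact (measurable_birkhoffAverage_indicator hT.measurable (hmeas C hC)
            _).aestronglyMeasurable
        · simp only [birkhoffAverage, birkhoffSum, smul_eq_mul]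
          have h0 : ∀ i, 0 ≤ C.indicator (fun _ => (1 : ℝ)) (T^[i] y) := fun i =>
            Set.indicator_nonneg (fun _ _ => zero_le_one) _
          have h1 : ∑ i ∈ Finset.range (ns C k), C.indicator (fun _ => (1 : ℝ)) (T^[i] y) ≤
              ns C k := by
            have := Finset.sum_le_card_nsmul (Finset.range (ns C k))
              (fun i => C.indicator (fun _ => (1 : ℝ)) (T^[i] y)) 1 fun i _ =>
                Set.indicator_le_self' (f := fun _ => (1 : ℝ)) (fun _ _ => zero_le_one) _
            simpa using this
          rw [Real.norm_of_nonneg (mul_nonneg (by positivity)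
            (Finset.sum_nonneg fun i _ => h0 i))]
          exact inv_mul_le_one_of_le₀ h1 (by positivity)
      rw [setIntegral_const, smul_eq_mul] at hDCT
      refine tendsto_nhds_unique (tendsto_const_nhds.congr' ?_) hDCT
      filter_upwards [eventually_gt_atTop 0] with k hk
      rw [havg _ (hk.trans_le (hns C hC).le_apply)]
    have h2 := key Set.univ MeasurableSet.univ fun _ => rfl
    rw [Set.univ_inter, probReal_univ, one_mul] at h2
    rw [key B hB hBk, h2]
  have hext : ν.restrict B = ν B • ν := by
    refine ext_of_generate_finite 𝒞 hgen hpi (fun C hC => ?_) (by simp)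
    rw [Measure.restrict_apply (hmeas C hC), Measure.smul_apply, smul_eq_mul, Set.inter_comm,
      ← ENNReal.toReal_eq_toReal_iff' (by finiteness) (by finiteness), ENNReal.toReal_mul]
    exact hind C hC
  have hself : ν B = ν B * ν B := by
    have := congr_arg (fun ρ : Measure X => ρ B) hext
    simpa [hB] using this
  rw [eventuallyConst_set']
  have hν1 : ν B = 0 ∨ ν B = 1 := by
    rcases eq_or_ne (ν B) 0 with h | h
    · exact Or.inl h
    · right
      have := (ENNReal.mul_right_inj h (measure_ne_top ν B)).1
        (hself.symm.trans (mul_one (ν B)).symm)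
      exact this
  rcases hν1 with h | h
  · exact Or.inl (ae_eq_empty.2 h)
  · right
    rw [ae_eq_univ, prob_compl_eq_zero_iff hB]
    exact h

end Decomposition

/-! ### Entropy and the ergodic decomposition -/

section FiniteValued

variable {X : Type*} [MeasurableSpace X] {κ : Type*} [Fintype κ]

theorem measurableSet_preimage_of_fibers {ζ : X → κ}
    (hζ : ∀ v, MeasurableSet (ζ ⁻¹' {v})) (s : Set κ) : MeasurableSet (ζ ⁻¹' s) := by
  have : ζ ⁻¹' s = ⋃ v ∈ s, ζ ⁻¹' {v} := by ext x; simp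
  rw [this]
  exact MeasurableSet.biUnion s.to_countable fun v _ => hζ v

theorem measurable_comp_of_fibers {E : Type*} [MeasurableSpace E] {ζ : X → κ}
    (hζ : ∀ v, MeasurableSet (ζ ⁻¹' {v})) (K : κ → E) : Measurable fun x => K (ζ x) := by
  intro s _
  exact measurableSet_preimage_of_fibers hζ (K ⁻¹' s)

theorem integral_comp_eq_sum (μ : Measure X) [IsFiniteMeasure μ] {ζ : X → κ}
    (hζ : ∀ v, MeasurableSet (ζ ⁻¹' {v})) (K : κ → ℝ) :
    ∫ x, K (ζ x) ∂μ = ∑ v, μ.real (ζ ⁻¹' {v}) * K v := by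
  let _ : MeasurableSpace κ := ⊤
  have hm : Measurable ζ := fun s _ => measurableSet_preimage_of_fibers hζ s
  rw [← integral_map (φ := ζ) (f := K) hm.aemeasurable
    (measurable_from_top.aestronglyMeasurable), integral_fintype]
  · refine Finset.sum_congr rfl fun v _ => ?_
    rw [map_measureReal_apply hm MeasurableSpace.measurableSet_top, smul_eq_mul]
  · have : IsFiniteMeasure (μ.map ζ) := inferInstance
    refine Integrable.of_bound (C := ∑ v, ‖K v‖) measurable_from_top.aestronglyMeasurable
      (Eventually.of_forall fun v => ?_)
    exact Finset.single_le_sum (f := fun v => ‖K v‖) (fun _ _ => norm_nonneg _) (Finset.mem_univ v)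

/-- The entropy of a partition is at most the entropy of a second partition plus the conditional
entropy of the first one given the second one. -/
theorem shannonEntropy_le_add_sum_cond {ι : Type*} [Fintype ι] (μ : Measure X)
    [IsProbabilityMeasure μ] {ξ : X → ι} {ζ : X → κ} (hξ : ∀ i, MeasurableSet (ξ ⁻¹' {i}))
    (hζ : ∀ v, MeasurableSet (ζ ⁻¹' {v})) :
    shannonEntropy μ ξ ≤ shannonEntropy μ ζ +
      ∑ v, μ.real (ζ ⁻¹' {v}) *
        shannonEntropy (ProbabilityTheory.cond μ (ζ ⁻¹' {v})) ξ := by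
  have h1 : shannonEntropy μ ξ ≤ shannonEntropy μ (fun x => (ζ x, ξ x)) :=
    shannonEntropy_le_of_factor μ (measurableSet_prodMk_fiber hζ hξ)
      fun x y h => (Prod.ext_iff.1 h).2
  refine h1.trans_eq ?_
  unfold shannonEntropy
  rw [Fintype.sum_prod_type, ← Finset.sum_add_distrib]
  refine Finset.sum_congr rfl fun v _ => ?_
  have h2 : ∀ i, μ.real ((fun x => (ζ x, ξ x)) ⁻¹' {(v, i)}) = μ.real (ζ ⁻¹' {v}) *
      (ProbabilityTheory.cond μ (ζ ⁻¹' {v})).real (ξ ⁻¹' {i}) := by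
    intro i
    have e : (fun x => (ζ x, ξ x)) ⁻¹' {(v, i)} = ζ ⁻¹' {v} ∩ ξ ⁻¹' {i} := by
      ext x; simp [Prod.ext_iff]
    rw [e, measureReal_def, measureReal_def, measureReal_def,
      ← ProbabilityTheory.cond_mul_eq_inter (hζ v), ENNReal.toReal_mul, mul_comm]
  simp_rw [h2, Real.negMulLog_mul]
  rw [Finset.sum_add_distrib, ← Finset.sum_mul, Finset.mul_sum]
  congr 1
  rcases eq_or_ne (μ.real (ζ ⁻¹' {v})) 0 with h0 | h0
  · simp [h0]
  · have : IsProbabilityMeasure (ProbabilityTheory.cond μ (ζ ⁻¹' {v})) :=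
      ProbabilityTheory.cond_isProbabilityMeasure fun h => h0 (by simp [measureReal_def, h])
    rw [sum_measureReal_fiber _ hξ, one_mul]

theorem measurePreserving_cond {μ : Measure X} {T : X → X} (hT : MeasurePreserving T μ μ)
    {A : Set X} (hA : MeasurableSet A) (hTA : T ⁻¹' A = A) :
    MeasurePreserving T (ProbabilityTheory.cond μ A) (ProbabilityTheory.cond μ A) := by
  refine ⟨hT.measurable, ?_⟩
  rw [ProbabilityTheory.cond, Measure.map_smul]
  congr 1
  have h := (hT.restrict_preimage hA).map_eq
  rwa [hTA] at h

end FiniteValued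

section Decomposition

open ProbabilityTheory

variable {X : Type*} {m : MeasurableSpace X} [mX : MeasurableSpace X] [StandardBorelSpace X]
  {μ : Measure X} [IsProbabilityMeasure μ]

theorem measurable_shannonEntropy_condExpKernel {ι : Type*} [Fintype ι]
    (hm : m ≤ mX) {ξ : X → ι} (hξ : ∀ i, MeasurableSet (ξ ⁻¹' {i})) :
    Measurable fun x => shannonEntropy (condExpKernel μ m x) ξ := by
  refine Finset.measurable_fun_sum _ fun i _ => ?_
  exact Real.continuous_negMulLog.measurable.comp
    (((measurable_condExpKernel (hξ i)).mono hm le_rfl).ennreal_toReal)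

/-- The entropy of an invariant measure is at most the average of the entropies of its conditional
measures given the invariant σ-algebra. The conditional measures are approximated by the normalized
restrictions of the measure to the elements of a finite invariant partition, on each of which the
conditional measures of the finitely many relevant sets are almost constant. -/
theorem mul_le_integral_shannonEntropy_condExpKernel {T : X → X} (hT : MeasurePreserving T μ μ)
    {ι : Type*} [Fintype ι] {ξ : X → ι} (hξ : ∀ i, MeasurableSet (ξ ⁻¹' {i})) {a : ℝ}
    (ha : ∀ q : ℕ, 0 < q → q * a ≤ shannonEntropy μ (itinerary T ξ q)) {N : ℕ} (hN : 0 < N) :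
    N * a ≤ ∫ x, shannonEntropy (condExpKernel μ (MeasurableSpace.invariants T) x)
      (itinerary T ξ N) ∂μ := by
  classical
  have hm : MeasurableSpace.invariants T ≤ mX := MeasurableSpace.invariants_le T
  have hcell := measurableSet_itinerary_fiber hT.measurable hξ N
  obtain ⟨W, hW⟩ : ∃ W : (Fin N → ι) → X → ℝ, ∀ c x, W c x =
      (condExpKernel μ (MeasurableSpace.invariants T) x).real (itinerary T ξ N ⁻¹' {c}) :=
    ⟨_, fun _ _ => rfl⟩
  have hW0 : ∀ c x, 0 ≤ W c x := fun c x => by rw [hW]; exact measureReal_nonneg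
  have hW1 : ∀ c x, W c x ≤ 1 := fun c x => by rw [hW]; exact measureReal_le_one
  have hWm : ∀ c, Measurable[MeasurableSpace.invariants T] (W c) := fun c => by
    rw [funext (hW c)]
    exact (measurable_condExpKernel (hcell c)).ennreal_toReal
  have hWi : ∀ c, Integrable (W c) μ := fun c => by
    rw [funext (hW c)]
    exact integrable_toReal_condExpKernel (hcell c)
  refine le_of_forall_pos_le_add fun η hη => ?_
  obtain ⟨η', hη', hcard⟩ : ∃ η' : ℝ, 0 < η' ∧ Fintype.card (Fin N → ι) * η' ≤ η :=
    ⟨η / (Fintype.card (Fin N → ι) + 1), by positivity, by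
      rw [mul_div_assoc', div_le_iff₀ (by positivity)]; nlinarith⟩
  have hUC := (isCompact_Icc (a := (0 : ℝ)) (b := 1)).uniformContinuousOn_of_continuous
    Real.continuous_negMulLog.continuousOn
  obtain ⟨θ, hθ, hUC⟩ := Metric.uniformContinuousOn_iff_le.1 hUC η' hη'
  obtain ⟨R, hR⟩ := exists_nat_gt (1 / θ)
  have hR0 : (0 : ℝ) < R := (by positivity : (0 : ℝ) < 1 / θ).trans hR
  have hRθ : 1 / (R : ℝ) ≤ θ := by
    rw [div_le_iff₀ hR0]; rw [div_lt_iff₀ hθ] at hR; linarith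
  -- The level partition, rounding the conditional measures of the cells down to multiples of `1/R`.
  obtain ⟨ζ, hζ⟩ : ∃ ζ : X → (Fin N → ι) → Fin (R + 1), ∀ x c, ((ζ x c : ℕ) : ℝ) ≤ R * W c x ∧
      R * W c x < (ζ x c : ℕ) + 1 ∧ (ζ x c : ℕ) = ⌊R * W c x⌋₊ := by
    refine ⟨fun x c => ⟨⌊R * W c x⌋₊, ?_⟩, fun x c => ⟨Nat.floor_le (mul_nonneg hR0.le (hW0 c x)),
      Nat.lt_floor_add_one _, rfl⟩⟩
    rw [Nat.lt_succ_iff]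
    exact Nat.floor_le_of_le (mul_le_of_le_one_right hR0.le (hW1 c x))
  have hζm : ∀ v, MeasurableSet[MeasurableSpace.invariants T] (ζ ⁻¹' {v}) := by
    intro v
    have e : ζ ⁻¹' {v} = ⋂ c, {x | ⌊R * W c x⌋₊ = (v c : ℕ)} := by
      ext x
      simp only [Set.mem_preimage, Set.mem_singleton_iff, funext_iff, Set.mem_iInter,
        Set.mem_ofPred_eq, Fin.ext_iff, (hζ _ _).2.2]
    rw [e]
    refine MeasurableSet.iInter fun c => ?_
    exact (Nat.measurable_floor.comp ((measurable_const_mul (R : ℝ)).comp (hWm c)))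
      (measurableSet_singleton (v c : ℕ))
  have hζm' : ∀ v, MeasurableSet (ζ ⁻¹' {v}) := fun v => hm _ (hζm v)
  have hprob : ∀ v, μ.real (ζ ⁻¹' {v}) ≠ 0 → IsProbabilityMeasure (cond μ (ζ ⁻¹' {v})) :=
    fun v h0 => cond_isProbabilityMeasure fun h => h0 (by simp [measureReal_def, h])
  -- It suffices to condition on the level partition.
  have hstep : N * a ≤ ∑ v, μ.real (ζ ⁻¹' {v}) *
      shannonEntropy (cond μ (ζ ⁻¹' {v})) (itinerary T ξ N) := by
    obtain ⟨C, hC⟩ : ∃ C : ℝ, ∀ j : ℕ, 0 < j → j * (N * a) ≤ C + j * ∑ v, μ.real (ζ ⁻¹' {v}) *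
        shannonEntropy (cond μ (ζ ⁻¹' {v})) (itinerary T ξ N) := by
      refine ⟨shannonEntropy μ ζ + ∑ v, μ.real (ζ ⁻¹' {v}) *
        shannonEntropy (cond μ (ζ ⁻¹' {v})) (itinerary T ξ 0), fun j hj => ?_⟩
      have h1 := ha (j * N) (Nat.mul_pos hj hN)
      have h2 := shannonEntropy_le_add_sum_cond μ
        (measurableSet_itinerary_fiber hT.measurable hξ (j * N)) hζm'
      have h3 : ∑ v, μ.real (ζ ⁻¹' {v}) *
          shannonEntropy (cond μ (ζ ⁻¹' {v})) (itinerary T ξ (j * N)) ≤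
          ∑ v, (j * (μ.real (ζ ⁻¹' {v}) *
            shannonEntropy (cond μ (ζ ⁻¹' {v})) (itinerary T ξ N)) + μ.real (ζ ⁻¹' {v}) *
            shannonEntropy (cond μ (ζ ⁻¹' {v})) (itinerary T ξ 0)) := by
        refine Finset.sum_le_sum fun v _ => ?_
        rcases eq_or_ne (μ.real (ζ ⁻¹' {v})) 0 with h0 | h0
        · simp [h0]
        · have := hprob v h0
          have h4 := (subadditive_entropy_itinerary
            (measurePreserving_cond hT (hζm' v) (hζm v).2) hξ).apply_mul_add_le j N 0
          rw [add_zero] at h4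
          have h5 := mul_le_mul_of_nonneg_left h4 (measureReal_nonneg (μ := μ) (s := ζ ⁻¹' {v}))
          linarith
      rw [Finset.sum_add_distrib, ← Finset.mul_sum] at h3
      push_cast at h1
      linarith
    by_contra! hlt
    obtain ⟨j, hj⟩ := exists_nat_gt (max 0 (C / (N * a - ∑ v, μ.real (ζ ⁻¹' {v}) *
      shannonEntropy (cond μ (ζ ⁻¹' {v})) (itinerary T ξ N))))
    have h1 := hC j (by exact_mod_cast (le_max_left _ _).trans_lt hj)
    have h2 := (le_max_right _ _).trans_lt hj
    rw [div_lt_iff₀ (by linarith)] at h2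
    linarith
  refine hstep.trans ?_
  rw [← integral_comp_eq_sum μ hζm'
    fun v => shannonEntropy (cond μ (ζ ⁻¹' {v})) (itinerary T ξ N)]
  have hHb : Integrable (fun x => shannonEntropy (condExpKernel μ (MeasurableSpace.invariants T) x)
      (itinerary T ξ N)) μ := by
    refine Integrable.of_bound (C := Real.log (Fintype.card (Fin N → ι)))
      (measurable_shannonEntropy_condExpKernel hm hcell).aestronglyMeasurable
      (Eventually.of_forall fun x => ?_)
    rw [Real.norm_of_nonneg (shannonEntropy_nonneg _ _)]
    exact shannonEntropy_le_log_card _ hcell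
  have hsplit : ∫ x, (shannonEntropy (condExpKernel μ (MeasurableSpace.invariants T) x)
      (itinerary T ξ N) + η) ∂μ = ∫ x, shannonEntropy
        (condExpKernel μ (MeasurableSpace.invariants T) x) (itinerary T ξ N) ∂μ + η := by
    rw [integral_add hHb (integrable_const _)]
    simp
  rw [← hsplit]
  refine integral_mono_ae ?_ (hHb.add (integrable_const _)) ?_
  · refine Integrable.of_bound (C := ∑ v, ‖shannonEntropy (cond μ (ζ ⁻¹' {v})) (itinerary T ξ N)‖)
      (measurable_comp_of_fibers hζm' fun v =>
        shannonEntropy (cond μ (ζ ⁻¹' {v})) (itinerary T ξ N)).aestronglyMeasurable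
      (Eventually.of_forall fun x => ?_)
    exact Finset.single_le_sum
      (f := fun v => ‖shannonEntropy (cond μ (ζ ⁻¹' {v})) (itinerary T ξ N)‖)
      (fun _ _ => norm_nonneg _) (Finset.mem_univ (ζ x))
  have hpos : ∀ᵐ x ∂μ, μ.real (ζ ⁻¹' {ζ x}) ≠ 0 := by
    have : ∀ v, ∀ᵐ x ∂μ, ζ x = v → μ.real (ζ ⁻¹' {v}) ≠ 0 := by
      intro v
      by_cases h0 : μ.real (ζ ⁻¹' {v}) = 0
      · have h1 := (measureReal_eq_zero_iff).1 h0
        filter_upwards [compl_mem_ae_iff.2 h1] with x hx hxv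
        exact absurd hxv hx
      · exact Eventually.of_forall fun x _ => h0
    filter_upwards [ae_all_iff.2 this] with x hx
    exact hx _ rfl
  filter_upwards [hpos] with x hx
  have hA : 0 < μ.real (ζ ⁻¹' {ζ x}) := measureReal_nonneg.lt_of_ne hx.symm
  have := hprob _ hx
  have hclose : ∀ c, |(cond μ (ζ ⁻¹' {ζ x})).real (itinerary T ξ N ⁻¹' {c}) - W c x| ≤ θ := by
    intro c
    have e1 : (cond μ (ζ ⁻¹' {ζ x})).real (itinerary T ξ N ⁻¹' {c}) * μ.real (ζ ⁻¹' {ζ x}) =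
        ∫ y in ζ ⁻¹' {ζ x}, W c y ∂μ := by
      simp_rw [hW]
      rw [setIntegral_condExpKernel_real hm (hcell c) (hζm _), measureReal_def, measureReal_def,
        measureReal_def, ← ENNReal.toReal_mul, cond_mul_eq_inter (hζm' _)]
    have hbd : ∀ y ∈ ζ ⁻¹' {ζ x}, |W c y - W c x| ≤ 1 / R := by
      intro y hy
      have hyx : ζ y c = ζ x c := congr_fun hy c
      have h1 := hζ y c
      have h2 := hζ x c
      rw [hyx] at h1
      rw [abs_le, ← neg_div, div_le_iff₀ hR0, le_div_iff₀ hR0]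
      constructor <;> nlinarith [h1.1, h1.2.1, h2.1, h2.2.1]
    have hup := setIntegral_mono_on (hWi c).integrableOn
      (integrable_const (W c x + 1 / R)).integrableOn (hζm' (ζ x))
      fun y hy => by have := (abs_le.1 (hbd y hy)).2; linarith
    have hlo := setIntegral_mono_on (integrable_const (W c x - 1 / R)).integrableOn
      (hWi c).integrableOn (hζm' (ζ x))
      fun y hy => by have := (abs_le.1 (hbd y hy)).1; linarith
    rw [setIntegral_const, smul_eq_mul, ← e1, mul_comm] at hup hlo
    have h1 := le_of_mul_le_mul_left (by linarith : μ.real (ζ ⁻¹' {ζ x}) *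
      (cond μ (ζ ⁻¹' {ζ x})).real (itinerary T ξ N ⁻¹' {c}) ≤
        μ.real (ζ ⁻¹' {ζ x}) * (W c x + 1 / R)) hA
    have h2 := le_of_mul_le_mul_left (by linarith : μ.real (ζ ⁻¹' {ζ x}) * (W c x - 1 / R) ≤
      μ.real (ζ ⁻¹' {ζ x}) * (cond μ (ζ ⁻¹' {ζ x})).real (itinerary T ξ N ⁻¹' {c})) hA
    rw [abs_le]
    constructor <;> linarith
  have hterm : ∀ c, Real.negMulLog ((cond μ (ζ ⁻¹' {ζ x})).real (itinerary T ξ N ⁻¹' {c})) ≤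
      Real.negMulLog (W c x) + η' := by
    intro c
    have h1 := hUC _ ⟨measureReal_nonneg, measureReal_le_one⟩ _ ⟨hW0 c x, hW1 c x⟩ (hclose c)
    have h2 := (abs_le.1 h1).2
    linarith
  have hfin := Finset.sum_le_sum fun c (_ : c ∈ Finset.univ) => hterm c
  rw [Finset.sum_add_distrib, Finset.sum_const, Finset.card_univ, nsmul_eq_mul] at hfin
  simp_rw [hW] at hfin
  exact hfin.trans (add_le_add le_rfl hcard)

end Decomposition

/-! ### Entropy of partitions into Bowen balls at an expansive scale -/

section Rates

variable {X : Type*} [MeasurableSpace X] {ι κ κ' : Type*} [Fintype ι] [Fintype κ] [Fintype κ']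

/-- A finite measurable cover has a measurable selection. -/
theorem exists_labelling {B : ι → Set X} (hB : ∀ i, MeasurableSet (B i))
    (hcov : ∀ x, ∃ i, x ∈ B i) :
    ∃ η : X → ι, (∀ i, MeasurableSet (η ⁻¹' {i})) ∧ ∀ x, x ∈ B (η x) := by
  classical
  obtain ⟨e⟩ : Nonempty (ι ≃ Fin (Fintype.card ι)) := ⟨Fintype.equivFin ι⟩
  have h : ∀ x, ∃ j : ℕ, ∃ i, (e i : ℕ) = j ∧ x ∈ B i := fun x =>
    let ⟨i, hi⟩ := hcov x
    ⟨_, i, rfl, hi⟩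
  choose η hη hηB using fun x => Nat.find_spec (h x)
  refine ⟨η, fun i => ?_, hηB⟩
  have e1 : η ⁻¹' {i} = B i ∩ ⋂ j, ⋂ (_ : e j < e i), (B j)ᶜ := by
    ext x
    simp only [Set.mem_preimage, Set.mem_singleton_iff, Set.mem_inter_iff, Set.mem_iInter,
      Set.mem_compl_iff]
    constructor
    · rintro rfl
      refine ⟨hηB x, fun j hj hxj => ?_⟩
      have := Nat.find_min' (h x) ⟨j, rfl, hxj⟩
      rw [← hη] at this
      exact absurd hj (not_lt.2 this)
    · rintro ⟨hxi, hmin⟩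
      have h1 := Nat.find_min' (h x) ⟨i, rfl, hxi⟩
      rw [← hη] at h1
      by_contra hne
      have h2 : e (η x) < e i := lt_of_le_of_ne h1 fun h => hne (e.injective h)
      exact hmin _ h2 (hηB x)
  rw [e1]
  exact (hB i).inter (MeasurableSet.iInter fun j => MeasurableSet.iInter fun _ => (hB j).compl)

variable {μ : Measure X} [IsProbabilityMeasure μ] {T : X → X}

theorem shannonEntropy_itinerary_le (hT : MeasurePreserving T μ μ) {η : X → ι}
    (hη : ∀ i, MeasurableSet (η ⁻¹' {i})) (n : ℕ) :
    shannonEntropy μ (itinerary T η n) ≤ n * shannonEntropy μ η := by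
  have h := shannonEntropy_le_sum μ (Finset.range n) (ξ := fun k x => η (T^[k] x))
    (fun k _ => measurableSet_iterate_fiber hT.measurable hη k) (ζ := itinerary T η n)
    fun x y h => itinerary_eq_iff.2 fun k hk => h k (Finset.mem_range.2 hk)
  refine h.trans_eq ?_
  simp_rw [fun k : ℕ => shannonEntropy_comp_preserving (hT.iterate k) hη]
  simp

/-- If a partition `ξ` is determined by the first `K` steps of the itinerary for `η` together with
an error term, then its entropy rate is controlled by the entropies of `η` and of the error. -/
theorem shannonEntropy_itinerary_le_of_determined (hT : MeasurePreserving T μ μ) {η : X → ι}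
    (hη : ∀ i, MeasurableSet (η ⁻¹' {i})) {err : X → κ} (herr : ∀ i, MeasurableSet (err ⁻¹' {i}))
    {ξ : X → κ'} {K : ℕ}
    (h : ∀ x y, itinerary T η K x = itinerary T η K y → err x = err y → ξ x = ξ y) (R : ℕ) :
    shannonEntropy μ (itinerary T ξ R) ≤
      (R + K) * shannonEntropy μ η + R * shannonEntropy μ err := by
  have hη' := measurableSet_itinerary_fiber hT.measurable hη (R + K)
  have herr' := measurableSet_itinerary_fiber hT.measurable herr R
  refine (shannonEntropy_le_of_factor μ (measurableSet_prodMk_fiber hη' herr')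
    fun x y hxy => ?_).trans ((shannonEntropy_prodMk_le μ hη' herr').trans (add_le_add ?_ ?_))
  · obtain ⟨h1, h2⟩ := Prod.ext_iff.1 hxy
    rw [itinerary_eq_iff] at h1 h2 ⊢
    refine fun k hk => h _ _ (itinerary_eq_iff.2 fun j hj => ?_) (h2 k hk)
    rw [← Function.iterate_add_apply, ← Function.iterate_add_apply]
    exact h1 _ (by omega)
  · exact_mod_cast shannonEntropy_itinerary_le hT hη (R + K)
  · exact shannonEntropy_itinerary_le hT herr R

/-- A map that takes one fixed value outside a set of small measure has small entropy. -/
theorem exists_shannonEntropy_le (κ : Type*) [Fintype κ] {b : ℝ} (hb : 0 < b) :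
    ∃ θ : ℝ, 0 < θ ∧ ∀ (ν : Measure X) [IsProbabilityMeasure ν] (err : X → κ) (i₀ : κ),
      (∀ i, MeasurableSet (err ⁻¹' {i})) → ν.real {x | err x ≠ i₀} ≤ θ →
        shannonEntropy ν err ≤ b := by
  classical
  obtain ⟨b', hb', hcard⟩ : ∃ b' : ℝ, 0 < b' ∧ Fintype.card κ * b' ≤ b :=
    ⟨b / (Fintype.card κ + 1), by positivity, by
      rw [mul_div_assoc', div_le_iff₀ (by positivity)]; nlinarith⟩
  obtain ⟨θ₀, hθ₀, h0⟩ := Metric.continuousAt_iff.1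
    (Real.continuous_negMulLog.continuousAt (x := 0)) b' hb'
  obtain ⟨θ₁, hθ₁, h1⟩ := Metric.continuousAt_iff.1
    (Real.continuous_negMulLog.continuousAt (x := 1)) b' hb'
  refine ⟨min θ₀ θ₁ / 2, by positivity, fun ν _ err i₀ herr hν => ?_⟩
  have hlt : ν.real {x | err x ≠ i₀} < min θ₀ θ₁ := hν.trans_lt (half_lt_self (by positivity))
  have hterm : ∀ i, Real.negMulLog (ν.real (err ⁻¹' {i})) ≤ b' := by
    intro i
    rcases eq_or_ne i i₀ with rfl | hi
    · have e : {x | err x ≠ i} = (err ⁻¹' {i})ᶜ := rfl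
      rw [e, probReal_compl_eq_one_sub (herr i)] at hlt
      have h2 := @h1 (ν.real (err ⁻¹' {i})) (by
        rw [Real.dist_eq, abs_sub_comm, abs_of_nonneg (sub_nonneg.2 measureReal_le_one)]
        exact hlt.trans_le (min_le_right _ _))
      rw [Real.dist_eq, Real.negMulLog_one, sub_zero] at h2
      exact (le_abs_self _).trans h2.le
    · have h3 : ν.real (err ⁻¹' {i}) ≤ ν.real {x | err x ≠ i₀} :=
        measureReal_mono fun x hx => by
          simp only [Set.mem_preimage, Set.mem_singleton_iff] at hx
          change err x ≠ i₀
          rwa [hx]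
      have h2 := @h0 (ν.real (err ⁻¹' {i})) (by
        rw [Real.dist_eq, sub_zero, abs_of_nonneg measureReal_nonneg]
        exact (h3.trans_lt hlt).trans_le (min_le_left _ _))
      rw [Real.dist_eq, Real.negMulLog_zero, sub_zero] at h2
      exact (le_abs_self _).trans h2.le
  calc shannonEntropy ν err ≤ ∑ _i : κ, b' := Finset.sum_le_sum fun i _ => hterm i
    _ = Fintype.card κ * b' := by simp
    _ ≤ b := hcard

end Rates

section Expansive

variable {X : Type*} [MetricSpace X] [CompactSpace X] [MeasurableSpace X] [BorelSpace X]

/-- Expansivity almost everywhere: a compact set of pairs off the diagonal contains, for most `x`,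
no pair `(x, y)` whose orbits stay close for a long time. -/
theorem tendsto_measure_close_pairs {f : X → X} (hf : Continuous f) {ν : Measure X}
    [IsFiniteMeasure ν] {ρ ε : ℝ} (hρ : ρ < ε) (hν : ν (nonExpansive f ε) = 0) {D : Set (X × X)}
    (hD : IsCompact D) (hoff : ∀ a ∈ D, a.1 ≠ a.2) :
    (∀ L : ℕ, IsClosed {x | ∃ y, (x, y) ∈ D ∧ ∀ k < L, dist (f^[k] x) (f^[k] y) ≤ ρ}) ∧
    Tendsto (fun L : ℕ => ν {x | ∃ y, (x, y) ∈ D ∧ ∀ k < L, dist (f^[k] x) (f^[k] y) ≤ ρ})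
      atTop (𝓝 0) := by
  set t : ℕ → Set (X × X) := fun L => D ∩ {a | ∀ k < L, dist (f^[k] a.1) (f^[k] a.2) ≤ ρ} with ht
  have htc : ∀ L, IsClosed (t L) := fun L => by
    refine hD.isClosed.inter ?_
    simp only [Set.ofPred_forall]
    exact isClosed_iInter fun k => isClosed_iInter fun _ => isClosed_le
      (((hf.iterate k).comp continuous_fst).dist ((hf.iterate k).comp continuous_snd))
      continuous_const
  have hproj : ∀ L : ℕ, {x | ∃ y, (x, y) ∈ D ∧ ∀ k < L, dist (f^[k] x) (f^[k] y) ≤ ρ} =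
      Prod.fst '' t L := fun L => by
    ext x
    constructor
    · rintro ⟨y, h1, h2⟩
      exact ⟨(x, y), ⟨h1, h2⟩, rfl⟩
    · rintro ⟨⟨x, y⟩, ⟨h1, h2⟩, rfl⟩
      exact ⟨y, h1, h2⟩
  have hclosed : ∀ L : ℕ,
      IsClosed {x | ∃ y, (x, y) ∈ D ∧ ∀ k < L, dist (f^[k] x) (f^[k] y) ≤ ρ} := fun L => by
    rw [hproj]
    exact ((htc L).isCompact.image continuous_fst).isClosed
  refine ⟨hclosed, ?_⟩
  have hanti : Antitone fun L : ℕ =>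
      {x | ∃ y, (x, y) ∈ D ∧ ∀ k < L, dist (f^[k] x) (f^[k] y) ≤ ρ} :=
    fun a b hab x ⟨y, h1, h2⟩ => ⟨y, h1, fun k hk => h2 k (hk.trans_le hab)⟩
  have hlim := tendsto_measure_iInter_atTop (μ := ν)
    (fun L => (hclosed L).measurableSet.nullMeasurableSet) hanti ⟨0, measure_ne_top _ _⟩
  have hnull : ν (⋂ L : ℕ, {x | ∃ y, (x, y) ∈ D ∧ ∀ k < L, dist (f^[k] x) (f^[k] y) ≤ ρ}) = 0 := by
    refine measure_mono_null (fun x hx => ?_) hν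
    rw [Set.mem_iInter] at hx
    obtain ⟨a, ha⟩ := IsCompact.nonempty_iInter_of_sequence_nonempty_isCompact_isClosed
      (fun L => t L ∩ Prod.fst ⁻¹' {x})
      (fun L a ha => ⟨⟨ha.1.1, fun k hk => ha.1.2 k (hk.trans (Nat.lt_succ_self L))⟩, ha.2⟩)
      (fun L => by
        obtain ⟨y, h1, h2⟩ := hx L
        exact ⟨(x, y), ⟨h1, h2⟩, rfl⟩)
      (((htc 0).inter (isClosed_singleton.preimage continuous_fst)).isCompact)
      (fun L => (htc L).inter (isClosed_singleton.preimage continuous_fst))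
    rw [Set.mem_iInter] at ha
    obtain ⟨x', y⟩ := a
    obtain rfl : x' = x := (ha 0).2
    have hy : y ∈ gammaSet f ε x' := fun n =>
      ((ha (n + 1)).1.2 n (Nat.lt_succ_self n)).trans_lt hρ
    intro hΓ
    rw [hΓ] at hy
    exact hoff _ (ha 0).1.1 (Eq.symm hy)
  rw [hnull] at hlim
  exact hlim

/-- A partition is determined, up to a small error, by long itineraries for a partition into sets
of small diameter in the metric `d_n`, if the measure does not charge the nonexpansive points. -/
theorem exists_error_of_small_cells {f : X → X} (hf : Continuous f) {ν : Measure X}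
    [IsProbabilityMeasure ν] {ρ ε : ℝ} (hρ : ρ < ε) (hν : ν (nonExpansive f ε) = 0) {n : ℕ}
    (hn : 0 < n) {ι κ : Type*} [Fintype ι] [Fintype κ] {η : X → ι}
    (hη : ∀ i, MeasurableSet (η ⁻¹' {i}))
    (hcell : ∀ x y, η x = η y → ∀ k < n, dist (f^[k] x) (f^[k] y) ≤ ρ)
    {ξ : X → κ} (hξ : ∀ i, MeasurableSet (ξ ⁻¹' {i})) {θ : ℝ} (hθ : 0 < θ) :
    ∃ (K : ℕ) (err : X → Option κ), (∀ i, MeasurableSet (err ⁻¹' {i})) ∧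
      ν.real {x | err x ≠ none} ≤ θ ∧
      ∀ x y, itinerary f^[n] η K x = itinerary f^[n] η K y → err x = err y → ξ x = ξ y := by
  classical
  obtain ⟨θ', hθ', hcard⟩ : ∃ θ' : ℝ, 0 < θ' ∧ (Fintype.card κ + 1) * θ' ≤ θ :=
    ⟨θ / (Fintype.card κ + 1), by positivity, by
      rw [mul_div_cancel₀]; positivity⟩
  have hC : ∀ v, ∃ C ⊆ ξ ⁻¹' {v}, IsCompact C ∧ ν (ξ ⁻¹' {v} \ C) < ENNReal.ofReal θ' := fun v =>
    (hξ v).exists_isCompact_sdiff_lt (measure_ne_top _ _) (ENNReal.ofReal_pos.2 hθ').ne'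
  choose C hCξ hCc hCν using hC
  have hCv : ∀ {v x}, x ∈ C v → ξ x = v := fun {v x} hx => hCξ v hx
  set D : Set (X × X) := ⋃ a : {a : κ × κ // a.1 ≠ a.2}, C a.1.1 ×ˢ C a.1.2 with hD
  have hDc : IsCompact D := isCompact_iUnion fun a => (hCc _).prod (hCc _)
  obtain ⟨hclosed, hlim⟩ := tendsto_measure_close_pairs hf hρ hν hDc (by
    rintro ⟨x, y⟩ ha
    simp only [hD, Set.mem_iUnion, Set.mem_prod] at ha
    obtain ⟨⟨⟨v, w⟩, hvw⟩, h1, h2⟩ := ha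
    rintro (rfl : x = y)
    exact hvw ((hCv h1).symm.trans (hCv h2)))
  obtain ⟨K, hK⟩ := (hlim.eventually (gt_mem_nhds (ENNReal.ofReal_pos.2 hθ'))).exists
  set B : Set X := {x | ∃ y, (x, y) ∈ D ∧ ∀ k < K, dist (f^[k] x) (f^[k] y) ≤ ρ} with hB
  have hfm : Measurable f^[n] := (hf.iterate n).measurable
  -- The label shared by all the good points of a cell.
  have hψ : ∃ ψ : (Fin K → ι) → Option κ, ∀ x v, x ∈ C v → x ∉ B →
      ψ (itinerary f^[n] η K x) = some v := by
    refine ⟨fun w => if h : ∃ a : X × κ, a.1 ∈ C a.2 ∧ a.1 ∉ B ∧ itinerary f^[n] η K a.1 = w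
      then some h.choose.2 else none, fun x v hx hxB => ?_⟩
    have h : ∃ a : X × κ, a.1 ∈ C a.2 ∧ a.1 ∉ B ∧
        itinerary f^[n] η K a.1 = itinerary f^[n] η K x := ⟨(x, v), hx, hxB, rfl⟩
    obtain ⟨h1, h2, h3⟩ := h.choose_spec
    refine (dif_pos h).trans (congr_arg some ?_)
    by_contra hne
    refine hxB ⟨h.choose.1, Set.mem_iUnion.2 ⟨⟨(v, h.choose.2), fun h => hne h.symm⟩, hx, h1⟩,
      fun k hk => ?_⟩
    rw [itinerary_eq_iff] at h3
    have h4 := h3 (k / n) ((Nat.div_le_self k n).trans_lt hk)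
    have h5 := hcell _ _ h4.symm (k % n) (Nat.mod_lt k hn)
    rw [← Function.iterate_mul, ← Function.iterate_add_apply, ← Function.iterate_add_apply,
      Nat.mod_add_div] at h5
    exact h5
  obtain ⟨ψ, hψ⟩ := hψ
  refine ⟨K, fun x => if ψ (itinerary f^[n] η K x) = some (ξ x) then none else some (ξ x),
    fun i => ?_, ?_, fun x y h1 h2 => ?_⟩
  · exact measurableSet_preimage_of_fibers (measurableSet_prodMk_fiber
      (measurableSet_itinerary_fiber hfm hη K) hξ)
      {a | (if ψ a.1 = some a.2 then none else some a.2) = i}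
  · have hsub : {x | (if ψ (itinerary f^[n] η K x) = some (ξ x) then none else some (ξ x)) ≠ none} ⊆
        B ∪ ⋃ v ∈ Finset.univ, (ξ ⁻¹' {v} \ C v) := by
      intro x hx
      by_contra hcon
      rw [Set.mem_union, not_or] at hcon
      have h1 : x ∈ C (ξ x) := by
        by_contra h
        exact hcon.2 (Set.mem_biUnion (Finset.mem_coe.2 (Finset.mem_univ (ξ x))) ⟨rfl, h⟩)
      exact hx (if_pos (hψ x _ h1 hcon.1))
    have hsmall : ∀ {s : Set X}, ν s < ENNReal.ofReal θ' → ν.real s ≤ θ' := fun h =>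
      ENNReal.toReal_le_of_le_ofReal hθ'.le h.le
    calc _ ≤ ν.real (B ∪ ⋃ v ∈ Finset.univ, (ξ ⁻¹' {v} \ C v)) := measureReal_mono hsub
      _ ≤ ν.real B + ∑ v, ν.real (ξ ⁻¹' {v} \ C v) := (measureReal_union_le _ _).trans
          (add_le_add le_rfl (measureReal_biUnion_finset_le _ _))
      _ ≤ θ' + ∑ _v : κ, θ' := add_le_add (hsmall hK) (Finset.sum_le_sum fun v _ => hsmall (hCν v))
      _ = (Fintype.card κ + 1) * θ' := by simp; ring
      _ ≤ θ := hcard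
  · dsimp only at h2
    rw [h1] at h2
    by_cases hx : ψ (itinerary f^[n] η K y) = some (ξ x) <;>
      by_cases hy : ψ (itinerary f^[n] η K y) = some (ξ y)
    · exact Option.some_injective _ (hx.symm.trans hy)
    · rw [if_pos hx, if_neg hy] at h2
      exact absurd h2 (by simp)
    · rw [if_neg hx, if_pos hy] at h2
      exact absurd h2 (by simp)
    · rw [if_neg hx, if_neg hy] at h2
      exact Option.some_injective _ h2

/-- If an invariant measure does not charge the nonexpansive points, then its pressure is bounded by
the topological pressure at a fixed scale. -/
theorem eventually_entropy_add_integral_lt {f : X → X} (hf : Continuous f) {φ : X → ℝ}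
    (hφ : Continuous φ) {ν : Measure X} [IsProbabilityMeasure ν] (hinv : MeasurePreserving f ν ν)
    {ρ ε : ℝ} (hρ : 0 < ρ) (hρε : 2 * ρ < ε) (hν : ν (nonExpansive f ε) = 0) {c : ℝ}
    (hc : pressureAt f φ Set.univ ρ 0 < c) {κ : Type*} [Fintype κ] {ξ : X → κ}
    (hξ : ∀ i, MeasurableSet (ξ ⁻¹' {i})) :
    ∀ᶠ N : ℕ in atTop, shannonEntropy ν (itinerary f ξ N) / N + ∫ x, φ x ∂ν < c := by
  classical
  obtain ⟨c', hc1, hc2⟩ := EReal.lt_iff_exists_real_btwn.1 hc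
  have hc2' : c' < c := by exact_mod_cast hc2
  obtain ⟨n, hn, hn0, hn3⟩ := ((eventually_expSum_le hc1).and ((eventually_gt_atTop 0).and
    ((tendsto_natCast_atTop_atTop.atTop_mul_const (sub_pos.2 hc2')).eventually_ge_atTop
      (3 : ℝ)))).exists
  obtain ⟨E, -, hEsep, hEcov⟩ := exists_greedy_separated (f := f) hφ hρ n Set.univ
  have hcont : Continuous (birkhoffSum f φ n) :=
    continuous_finsetSum _ fun k _ => hφ.comp (hf.iterate k)
  obtain ⟨η, hη, hηB⟩ := exists_labelling (ι := E)
    (B := fun i => {y | (∀ k < n, dist (f^[k] i) (f^[k] y) ≤ ρ) ∧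
      birkhoffSum f φ n y ≤ birkhoffSum f φ n i + 1})
    (fun i => by
      refine (IsClosed.inter ?_ (isClosed_le hcont continuous_const)).measurableSet
      have e : {y | ∀ k < n, dist (f^[k] i) (f^[k] y) ≤ ρ} =
          ⋂ k, ⋂ (_ : k < n), {y | dist (f^[k] i) (f^[k] y) ≤ ρ} := by
        simp only [Set.ofPred_forall]
      change IsClosed {y | ∀ k < n, dist (f^[k] i) (f^[k] y) ≤ ρ}
      rw [e]
      exact isClosed_iInter fun k => isClosed_iInter fun _ =>
        isClosed_le (continuous_const.dist (hf.iterate k)) continuous_const)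
    fun y => by
      obtain ⟨x, hx, h⟩ := hEcov y trivial
      exact ⟨⟨x, hx⟩, h⟩
  have hinvn := hinv.iterate n
  have hgibbs : shannonEntropy ν η + n * ∫ x, φ x ∂ν ≤ n * c' + 1 := by
    have h1 := sum_negMulLog_add_le_log_sum_exp (p := fun i : E => ν.real (η ⁻¹' {i}))
      (s := fun i => birkhoffSum f φ n i + 1) (fun _ => measureReal_nonneg)
      (sum_measureReal_fiber ν hη)
    have h2 : ∑ i : E, Real.exp (birkhoffSum f φ n i + 1) = expSum f φ n E * Real.exp 1 := by
      rw [expSum, Finset.sum_mul, ← Finset.sum_coe_sort E]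
      exact Finset.sum_congr rfl fun i _ => Real.exp_add _ _
    have hE0 : 0 < expSum f φ n E := by
      refine (Finset.sum_pos (fun _ _ => Real.exp_pos _) ?_)
      obtain ⟨x⟩ : Nonempty X := by
        by_contra hne
        have := not_nonempty_iff.1 hne
        exact IsProbabilityMeasure.ne_zero ν (Measure.eq_zero_of_isEmpty ν)
      obtain ⟨y, hy, -⟩ := hEcov x trivial
      exact ⟨y, hy⟩
    rw [h2, Real.log_mul hE0.ne' (Real.exp_pos _).ne', Real.log_exp] at h1
    have h3 : Real.log (expSum f φ n E) ≤ n * c' := by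
      rw [Real.log_le_iff_le_exp hE0]
      exact hn E (fun _ _ => trivial) hEsep
    have h4 : n * ∫ x, φ x ∂ν ≤
        ∑ i : E, ν.real (η ⁻¹' {i}) * (birkhoffSum f φ n i + 1) := by
      rw [← integral_comp_eq_sum ν hη fun i : E => birkhoffSum f φ n i + 1]
      have h5 : ∫ x, birkhoffSum f φ n x ∂ν = n * ∫ x, φ x ∂ν := by
        simp only [birkhoffSum]
        rw [integral_finsetSum (f := fun k x => φ (f^[k] x)) _ fun k _ =>
          integrable_of_continuous (hφ.comp (hf.iterate k))]
        have : ∀ k : ℕ, ∫ x, φ (f^[k] x) ∂ν = ∫ x, φ x ∂ν := fun k => by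
          rw [← integral_map (φ := f^[k]) (f := φ) (hinv.iterate k).measurable.aemeasurable
            hφ.aestronglyMeasurable, (hinv.iterate k).map_eq]
        simp [this]
      rw [← h5]
      refine integral_mono (integrable_of_continuous hcont) ?_ fun x => (hηB x).2
      refine Integrable.of_bound (C := ∑ i : E, ‖birkhoffSum f φ n i + 1‖)
        (measurable_comp_of_fibers hη fun i : E => birkhoffSum f φ n i + 1).aestronglyMeasurable
        (Eventually.of_forall fun x => ?_)
      exact Finset.single_le_sum (f := fun i : E => ‖birkhoffSum f φ n i + 1‖)
        (fun _ _ => norm_nonneg _) (Finset.mem_univ (η x))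
    have h6 : shannonEntropy ν η = ∑ i : E, Real.negMulLog (ν.real (η ⁻¹' {i})) := rfl
    linarith
  have hξn := measurableSet_itinerary_fiber hf.measurable hξ n
  obtain ⟨θ, hθ, hH⟩ := exists_shannonEntropy_le (X := X) (Option (Fin n → κ)) one_pos
  obtain ⟨K, err, herr, herrθ, hdet⟩ := exists_error_of_small_cells hf hρε hν hn0 hη
    (fun x y hxy k hk => by
      have h1 := (hηB x).1 k hk
      have h2 := (hηB y).1 k hk
      rw [← hxy] at h2
      linarith [dist_triangle_left (f^[k] x) (f^[k] y) (f^[k] (η x))]) hξn hθ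
  have herr1 := hH ν err none herr herrθ
  obtain ⟨R, hR⟩ := exists_nat_gt (K * shannonEntropy ν η)
  have hR0 : (0 : ℝ) < R :=
    (mul_nonneg (Nat.cast_nonneg K) (shannonEntropy_nonneg ν η)).trans_lt hR
  have hsub := subadditive_entropy_itinerary hinv hξ
  have hbound : shannonEntropy ν (itinerary f ξ (R * n)) ≤
      (R + K) * shannonEntropy ν η + R * 1 := by
    refine (shannonEntropy_le_of_factor ν (measurableSet_itinerary_fiber hinvn.measurable hξn R)
      fun x y hxy => ?_).trans ((shannonEntropy_itinerary_le_of_determined hinvn hη herr hdet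
        R).trans (by gcongr))
    rw [itinerary_eq_iff] at hxy ⊢
    intro k hk
    have h1 := itinerary_eq_iff.1 (hxy (k / n) (Nat.div_lt_of_lt_mul (by rwa [mul_comm])))
      (k % n) (Nat.mod_lt k hn0)
    rw [← Function.iterate_mul, ← Function.iterate_add_apply, ← Function.iterate_add_apply,
      Nat.mod_add_div] at h1
    exact h1
  have hRn : (R * n : ℕ) ≠ 0 := by
    have : R ≠ 0 := by rintro rfl; simp at hR0
    exact Nat.mul_ne_zero this hn0.ne'
  have hdiv : shannonEntropy ν (itinerary f ξ (R * n)) / (R * n : ℕ) < c - ∫ x, φ x ∂ν := by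
    rw [div_lt_iff₀ (by positivity)]
    push_cast
    nlinarith [mul_le_mul_of_nonneg_left hgibbs hR0.le, mul_le_mul_of_nonneg_left hn3 hR0.le]
  filter_upwards [hsub.eventually_div_lt_of_div_lt hRn hdiv] with N hN
  linarith

end Expansive

/-! ### Pressure at an expansive scale -/

section ExpansiveScale

variable {X : Type*} [MetricSpace X] [MeasurableSpace X]

theorem eventually_entropy_add_integral_lt_of_nonExpansive {f : X → X} {φ : X → ℝ} {ν : Measure X}
    [IsProbabilityMeasure ν] (herg : Ergodic f ν) {ε c : ℝ} (hν : ν (nonExpansive f ε) ≠ 0)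
    (hc : expObstruction f φ ε < c) {m : ℕ} {ξ : X → Fin m}
    (hξ : ∀ i, MeasurableSet (ξ ⁻¹' {i})) :
    ∀ᶠ N : ℕ in atTop, shannonEntropy ν (itinerary f ξ N) / N + ∫ x, φ x ∂ν < c := by
  have h1 : measurePressure f φ ν ≤ expObstruction f φ ε :=
    le_iSup₂_of_le ν ⟨inferInstance, herg, pos_iff_ne_zero.2 hν⟩ le_rfl
  have h2 : metricEntropy f ν < ((c - ∫ x, φ x ∂ν : ℝ) : EReal) := by
    rw [EReal.coe_sub]
    exact (EReal.lt_sub_iff_add_lt (Or.inl (EReal.coe_ne_bot _)) (Or.inl (EReal.coe_ne_top _))).2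
      (h1.trans_lt hc)
  have hm : Measurable ξ := fun s _ => measurableSet_preimage_of_fibers hξ s
  have h3 : partitionEntropy f ν ξ ≤ metricEntropy f ν :=
    le_iSup_of_le m (le_iSup₂_of_le ξ hm le_rfl)
  filter_upwards [eventually_lt_of_limsup_lt (h3.trans_lt h2)] with N hN
  have h4 : shannonEntropy ν (itinerary f ξ N) / N < c - ∫ x, φ x ∂ν := EReal.coe_lt_coe_iff.1 hN
  linarith

variable [CompactSpace X] [BorelSpace X]

/-- The topological pressure is attained at any scale at which the measures of large pressure are
expansive. -/
theorem topPressure_le_pressureAt {f : X → X} (hf : Continuous f) {φ : X → ℝ} (hφ : Continuous φ)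
    {ρ ε : ℝ} (hρ : 0 < ρ) (hρε : 2 * ρ < ε) (hexp : expObstruction f φ ε < topPressure f φ) :
    topPressure f φ ≤ pressureAt f φ Set.univ ρ 0 := by
  by_contra! hlt
  obtain ⟨c, hc1, hc2⟩ := EReal.lt_iff_exists_real_btwn.1 (max_lt hexp hlt)
  obtain ⟨β, hβ1, hβ2⟩ := EReal.lt_iff_exists_real_btwn.1 hc2
  have hcβ : c < β := by exact_mod_cast hβ1
  obtain ⟨δ, hβ2⟩ := lt_iSup_iff.1 hβ2
  obtain ⟨hδ, hβ2⟩ := lt_iSup_iff.1 hβ2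
  obtain ⟨μ, hμ, hinv, m, ξ, hξ, hent⟩ := exists_invariant_measure_of_lt_pressureAt hf hφ hδ hβ2
  have hm : MeasurableSpace.invariants f ≤ (inferInstance : MeasurableSpace X) :=
    MeasurableSpace.invariants_le f
  obtain ⟨κ, hκ⟩ : ∃ κ : X → Measure X, ∀ x,
      κ x = ProbabilityTheory.condExpKernel μ (MeasurableSpace.invariants f) x := ⟨_, fun _ => rfl⟩
  have hκp : ∀ x, IsProbabilityMeasure (κ x) := fun x => by rw [hκ]; infer_instance
  obtain ⟨B, hB0, hB⟩ := exists_abs_le hφ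
  obtain ⟨h, hh⟩ : ∃ h : ℕ → X → ℝ, ∀ N x,
      h N x = shannonEntropy (κ x) (itinerary f ξ N) / N + ∫ y, φ y ∂(κ x) := ⟨_, fun _ _ => rfl⟩
  have hI : Measurable fun x => ∫ y, φ y ∂(κ x) := by
    simp_rw [hκ]
    exact ((hφ.stronglyMeasurable.integral_condExpKernel (m := MeasurableSpace.invariants f)
      (μ := μ)).mono hm).measurable
  have hHm : ∀ N, Measurable fun x => shannonEntropy (κ x) (itinerary f ξ N) := fun N => by
    simp_rw [hκ]
    exact measurable_shannonEntropy_condExpKernel hm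
      (measurableSet_itinerary_fiber hf.measurable hξ N)
  have hhm : ∀ N, Measurable (h N) := fun N => by
    rw [funext (hh N)]
    exact ((hHm N).div_const _).add hI
  have hIb : ∀ x, |∫ y, φ y ∂(κ x)| ≤ B := fun x => by
    have := hκp x
    have := norm_integral_le_of_norm_le_const (μ := κ x) (f := φ) (C := B)
      (Eventually.of_forall hB)
    simpa using this
  have hHb : ∀ N x, |shannonEntropy (κ x) (itinerary f ξ N) / N| ≤ Real.log m := fun N x => by
    have := hκp x
    rw [abs_of_nonneg (div_nonneg (shannonEntropy_nonneg _ _) (Nat.cast_nonneg _))]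
    have h1 := shannonEntropy_le_log_card (κ x) (measurableSet_itinerary_fiber hf.measurable hξ N)
    refine div_le_of_le_mul₀ (Nat.cast_nonneg _) (Real.log_natCast_nonneg m) (h1.trans_eq ?_)
    rw [Fintype.card_fun, Fintype.card_fin, Fintype.card_fin, Nat.cast_pow, Real.log_pow, mul_comm]
  have hhb : ∀ N x, |h N x| ≤ Real.log m + B := fun N x => by
    rw [hh]
    exact (abs_add_le _ _).trans (add_le_add (hHb N x) (hIb x))
  have hhi : ∀ N, Integrable (h N) μ := fun N =>
    Integrable.of_bound (hhm N).aestronglyMeasurable _ (Eventually.of_forall (hhb N))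
  -- The averages of the conditional pressures stay above `β`.
  have hβh : ∀ N : ℕ, 0 < N → β ≤ ∫ x, h N x ∂μ := by
    intro N hN
    have h1 := mul_le_integral_shannonEntropy_condExpKernel hinv hξ (a := β - ∫ x, φ x ∂μ)
      (fun q hq => by have := hent q hq; linarith) hN
    have h2 := integral_integral_condExpKernel (μ := μ) hm (integrable_of_continuous hφ)
    simp_rw [← hκ] at h1 h2
    simp_rw [hh]
    have hN' : (0 : ℝ) < N := by exact_mod_cast hN
    rw [integral_add _ _, h2, integral_div]
    · rw [← le_div_iff₀' hN'] at h1
      linarith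
    · exact Integrable.of_bound ((hHm N).div_const _).aestronglyMeasurable _
        (Eventually.of_forall (hHb N))
    · exact Integrable.of_bound hI.aestronglyMeasurable _ (Eventually.of_forall hIb)
  -- Almost every conditional pressure ends up below `c`.
  have hhc : ∀ᵐ x ∂μ, ∀ᶠ N in atTop, h N x < c := by
    filter_upwards [ae_ergodic_condExpKernel hinv] with x hx
    rw [← hκ] at hx
    have := hκp x
    simp_rw [hh]
    by_cases hNE : κ x (nonExpansive f ε) = 0
    · exact eventually_entropy_add_integral_lt hf hφ hx.toMeasurePreserving hρ hρε hNE
        ((le_max_right _ _).trans_lt hc1) hξ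
    · exact eventually_entropy_add_integral_lt_of_nonExpansive hx hNE
        ((le_max_left _ _).trans_lt hc1) hξ
  have hlim : Tendsto (fun N => ∫ x, max (h N x) c ∂μ) atTop (𝓝 (∫ _, c ∂μ)) := by
    refine tendsto_integral_of_dominated_convergence (fun _ => Real.log m + B + |c|)
      (fun N => ((hhm N).max measurable_const).aestronglyMeasurable) (integrable_const _)
      (fun N => Eventually.of_forall fun x => ?_) ?_
    · rw [Real.norm_eq_abs]
      refine abs_max_le_max_abs_abs.trans (max_le ?_ ?_)
      · linarith [hhb N x, abs_nonneg c]
      · linarith [(abs_nonneg _).trans (hhb N x)]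
    · filter_upwards [hhc] with x hx
      refine tendsto_const_nhds.congr' ?_
      filter_upwards [hx] with N hN
      rw [max_eq_right hN.le]
  have hle : β ≤ ∫ _, c ∂μ := by
    refine ge_of_tendsto hlim ?_
    filter_upwards [eventually_gt_atTop 0] with N hN
    refine (hβh N hN).trans (integral_mono (hhi N) ?_ fun x => le_max_left _ _)
    exact (hhi N).sup (integrable_const c)
  rw [integral_const] at hle
  simp only [probReal_univ, one_smul] at hle
  linarith

end ExpansiveScale

/-! ### Invariant sets of prescribed pressure -/

/-- The Bowen property on the cores of a decomposition carries over to segments with prefixes and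
suffixes of bounded length. -/
theorem BowenProp.goodUpTo {X : Type*} [MetricSpace X] [CompactSpace X] {f : X → X} {φ : X → ℝ}
    (hφ : Continuous φ) {D P G S : Set (X × ℕ)} {p g s : X → ℕ → ℕ}
    (hdec : IsCTDecomposition f D P G S p g s) {r : ℝ} (hG : BowenProp f φ G r) (M : ℕ) :
    BowenProp f φ (goodUpTo D p s M) r := by
  obtain ⟨V, hV⟩ := hG
  obtain ⟨B, hB0, hB⟩ := exists_abs_le hφ
  refine ⟨V + 4 * (M * B), fun x n hxn y hy => ?_⟩
  obtain ⟨hD, hp, hs⟩ := hxn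
  obtain ⟨-, hG, -, hn⟩ := hdec x n hD
  dsimp only at hp hs
  have hsplit : ∀ z, birkhoffSum f φ n z = birkhoffSum f φ (p x n) z +
      birkhoffSum f φ (g x n) (f^[p x n] z) + birkhoffSum f φ (s x n) (f^[p x n + g x n] z) := by
    intro z
    rw [← birkhoffSum_add, ← birkhoffSum_add, hn]
  have h1 := hV _ _ hG _ (iterate_mem_bowenBall hy (by omega))
  have hsmall : ∀ {k : ℕ} z, k ≤ M → |birkhoffSum f φ k z| ≤ M * B := fun {k} z hk =>
    (abs_birkhoffSum_le hB k z).trans (by gcongr)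
  rw [hsplit x, hsplit y]
  have h2 := abs_le.1 (hsmall x hp)
  have h3 := abs_le.1 (hsmall y hp)
  have h4 := abs_le.1 (hsmall (f^[p x n + g x n] x) hs)
  have h5 := abs_le.1 (hsmall (f^[p x n + g x n] y) hs)
  have h6 := abs_le.1 h1
  rw [abs_le]
  constructor <;> linarith

end CTSystem

theorem proposition3p1 {X : Type*} [MetricSpace X] [CompactSpace X] [MeasurableSpace X]
    [BorelSpace X] (f : X → X) (hf : Continuous f) (φ : X → ℝ) (hφ : Continuous φ)
    (δ γ ε : ℝ) (hCT : CTSystem.SatisfiesCT f φ δ γ ε)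
    (α : ℝ) (hα : CTSystem.lowerThreshold f φ < (α : EReal))
    (hα' : (α : EReal) < CTSystem.topPressure f φ) (η₀ : ℝ) (hη₀ : 0 < η₀) :
    ∃ Λ : Set X, IsCompact Λ ∧ Set.MapsTo f Λ Λ ∧
      ((α - η₀ : ℝ) : EReal) < CTSystem.setPressureAt f φ Λ (2 * δ) ∧
      CTSystem.setPressureAt f φ Λ (2 * δ) < ((α + η₀ : ℝ) : EReal) := by
  open CTSystem in
  obtain ⟨hδ, hδγ, hγε, D, P, G, S, p, g, s, hdec, hGO, hD, hPS, hBP, hexp⟩ := hCT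
  have hγ : 0 < γ := by linarith
  have htop := topPressure_le_pressureAt hf hφ (ρ := 2 * (2 * γ)) (by positivity) (by linarith) hexp
  have hD' : pressureAt f φ Dᶜ (2 * γ) 0 < topPressure f φ :=
    (pressureAt_zero_le hφ _ _ (by positivity)).trans_lt hD
  have hPS' : pressureAt f φ (P ∪ S) (2 * γ) 0 < topPressure f φ :=
    ((pressureAt_anti f φ _ 0 (by linarith : γ ≤ 2 * γ)).trans
      (pressureAt_zero_le hφ _ _ (by positivity))).trans_lt hPS
  obtain ⟨b, hb, hbtop⟩ := EReal.lt_iff_exists_real_btwn.1 (max_lt hD' hPS')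
  -- `β` exceeds `α`, so that the segments found at rate `β` can be thinned out to rate `α`.
  obtain ⟨β, hβ, hβtop⟩ := EReal.lt_iff_exists_real_btwn.1 (max_lt hbtop hα')
  obtain ⟨M, hM⟩ := exists_le_pressureAt_goodUpTo hφ (by positivity) hdec
    (EReal.coe_lt_coe_iff.1 ((le_max_left _ _).trans_lt hβ)) ((le_max_left _ _).trans_lt hb)
    ((le_max_right _ _).trans_lt hb) (hβtop.trans_le htop)
  exact exists_invariant_of_gluing hf hφ hδ (by linarith) (by linarith : δ < 3 * γ) (hGO M)
    (hBP.goodUpTo hφ hdec M) hα (((le_max_right _ _).trans_lt hβ).trans_le hM) hη₀
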